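/- **Setting.** Let $(j_\ell)_{\ell\ge1}$, $(n_\ell)_{\ell\ge1}$ be sequences of integers $\ge 2$, and put $J_i=\prod_{\ell=1}^i j_\ell$, $N_i=\prod_{\ell=1}^i n_\ell$ ($J_0=N_0=1$), $L_0=2\pi$, $L_i=\pi/J_i$ for $i\ge1$, $[n]=\{1,\dots,n\}$. Let $F_0=\mathbb S^1=\mathbb R/2\pi\mathbb Z$, and let $F_i$ be the quotient of $F_{i-1}\times[n_i]$ in which, for each $x\in F_{i-1}$ whose angle is a multiple of $\pi/J_i$, all the points $(x,w)$, $w\in[n_i]$, are identified with each other. Points of $F_i$ are words $\eta w_1\ldots w_i$, with $\eta\in\mathbb S^1$ and $w_\ell\in[n_\ell]$, where the letter $w_\ell$ is irrelevant if $\eta$ is a multiple of $\pi/J_\ell$. Let $\phi_{ik}:F_i\to F_k$ ($k\le i$) forget the letters $w_\ell$ with $\ell>k$, and let $F_\infty$ be the inverse limit of the $F_i$, with projections $\Phi_i:F_\infty\to F_i$. For $i\ge1$ an $i$-cell is the image in $F_i$ of an arc $[mL_i,(m+1)L_i]$, $0\le m<2J_i$, with a fixed word $w_1\ldots w_i$;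 two $i$-cells are in the same bundle if they have the same $m$ and the same $w_1,\dots,w_{i-1}$. For $i=0$ there is one cell, $F_0$ itself (parametrized by $[0,2\pi]$). Let $\theta_x\in[0,L_i)$ be the position of $x\in F_i$ on its cell. The measure $\mu_i$ on $F_i$ is $1/N_i$ times arc length on every $i$-cell, and $\mu_\infty$ is the limit measure on $F_\infty$, which satisfies $\mu_\infty\circ\Phi_i^{-1}=\mu_i$ for all $i$. Let $p_t^{F_0}(\theta_1,\theta_2)=\frac1{2\pi}+\frac1\pi\sum_{k\ge1}e^{-k^2t}\cos(k(\theta_2-\theta_1))$ and, for $i\ge1$, with $D_t^i(\theta_1,\theta_2)=J_i\big(p^{F_0}_{J_i^2t}(J_i\theta_1,J_i\theta_2)-p^{F_0}_{J_i^2t}(J_i\theta_1,-J_i\theta_2)\big)$ the Dirichlet heat kernel of $[0,L_i]$, let $$p_t^{F_i}(x,y)=p_t^{F_{i-1}}(\phi_{i,i-1}(x),\phi_{i,i-1}(y))+\begin{cases}N_{i-1}(n_i-1)\,D_t^i(\theta_x,\theta_y)&\text{if $x,y$ lie in a common $i$-cell},\\-N_{i-1}\,D_t^i(\theta_x,\theta_y)&\text{if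 $x,y$ lie in different $i$-cells of the same bundle},\\0&\text{otherwise.}\end{cases}$$ For a kernel $p$ on a space $X$ with measure $\mu$, put $T_tf(x)=\int_Xp_t(x,y)f(y)\,\mu(dy)$ for $t>0$ and $T_0=\mathrm{id}$. Call $p$ a *Markov kernel* if it is continuous in $(t,x,y)\in(0,\infty)\times X\times X$, symmetric in $x,y$ and nonnegative, and $(T_t)_{t\ge0}$ is a conservative ($T_t1=1$), strongly continuous semigroup on $C(X)$ with the strong Feller property ($T_tf$ is continuous for every bounded Borel $f$ and $t>0$). **Theorem.** Assume that for some $\varepsilon>0$ the limit $\lim_{i\to\infty}N_ie^{-J_i^2t}$ exists and is finite for all $t\in(0,\varepsilon)$. Then: 1. $\mu_\infty\circ\Phi_i^{-1}=\mu_i$ for every $i\ge0$, and $p^{F_i}$ is the heat kernel of the natural diffusion on the metric graph $F_i$: it is a Markov kernel on $(F_i,\mu_i)$, and for every $f\in C(F_i)$ the function $u(t,x)=T^{F_i}_tf(x)$ is continuous on $(0,\infty)\times F_i$, is $C^2$ in space and satisfies $\partial_tu=\partial_\theta^2u$ on each closed cell, and satisfies the Kirchhoff condition at each point of $F_i$ (the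 derivatives along the cells starting there and along the cells ending there have equal sums). 2. For every $t>0$ the limit $p_t^{F_\infty}(x,y)=\lim_{i\to\infty}p_t^{F_i}(\Phi_i(x),\Phi_i(y))$ exists uniformly in $x,y\in F_\infty$. 3. If $x\ne y$ in $F_\infty$, then there is a largest integer $i_*=i_*(x,y)\ge0$ such that $\Phi_{i_*}(x)$ and $\Phi_{i_*}(y)$ belong to $i_*$-cells in the same bundle, and $$p_t^{F_\infty}(x,y)=p_t^{F_{i_*}}(\Phi_{i_*}(x),\Phi_{i_*}(y))\qquad\text{for all }t>0.$$ 4. $p^{F_\infty}$ is the heat kernel of $F_\infty$: it is a Markov kernel on $(F_\infty,\mu_\infty)$, and its semigroup is compatible with those on the $F_i$, that is, $T_t^{F_\infty}(h\circ\Phi_i)=(T_t^{F_i}h)\circ\Phi_i$ for all $i\ge0$, $t>0$, $h\in C(F_i)$. It is the only kernel with these properties. -/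

import Mathlib

open MeasureTheory Filter Topology

noncomputable section

namespace Diamond

instance factTwoPiPos : Fact (0 < 2 * Real.pi) := ⟨Real.two_pi_pos⟩

/-- The circle `𝕊¹ = ℝ / 2πℤ`, with its arc-length measure of total mass `2π`. -/
abbrev Circ : Type := AddCircle (2 * Real.pi)

/-- Parameter sequences `(j_ℓ)` and `(n_ℓ)` with `j_ℓ, n_ℓ ≥ 2` for `ℓ ≥ 1`.
(The entries with index `0` are never used.) -/
structure Params where
  j : ℕ → ℕ
  n : ℕ → ℕ
  two_le_j : ∀ l, 1 ≤ l → 2 ≤ j l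
  two_le_n : ∀ l, 1 ≤ l → 2 ≤ n l

namespace Params

variable (P : Params)

/-- `J_i = j_1 ⋯ j_i`. -/
def J (i : ℕ) : ℕ := ∏ l ∈ Finset.Icc 1 i, P.j l

/-- `N_i = n_1 ⋯ n_i`. -/
def N (i : ℕ) : ℕ := ∏ l ∈ Finset.Icc 1 i, P.n l

instance neZero_n (l : ℕ) : NeZero (P.n (l + 1)) :=
  ⟨by have := P.two_le_n (l + 1) (by omega); omega⟩

/-- The angles `π k / J_l`, `k ∈ ℤ`: the union `ϑ_0 ∪ ⋯ ∪ ϑ_l` of the angles of the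
identification points used up to stage `l`. -/
def grid (l : ℕ) : Set Circ :=
  Set.range fun k : ℤ => ((Real.pi * k / P.J l : ℝ) : Circ)

/-- Words `w_1 … w_i` with `w_l ∈ [n_l]`; the letter `w_{l+1}` is the entry with index `l`. -/
abbrev Word (i : ℕ) : Type := ∀ l : Fin i, Fin (P.n ((l : ℕ) + 1))

/-- Two words `η w_1 … w_i` and `η' w'_1 … w'_i` describe the same point of `F_i` when
`η = η'` and `w_l = w'_l` for every `l ≤ i` such that `η` is not an identification angle of a
stage up to `l`. -/
def levelSetoid (i : ℕ) : Setoid (Circ × P.Word i) where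
  r p q := p.1 = q.1 ∧ ∀ l : Fin i, p.1 ∉ P.grid ((l : ℕ) + 1) → p.2 l = q.2 l
  iseqv :=
    { refl := fun _ => ⟨rfl, fun _ _ => rfl⟩
      symm := fun h => ⟨h.1.symm, fun l hl => (h.2 l (by rw [h.1]; exact hl)).symm⟩
      trans := fun h k => ⟨h.1.trans k.1, fun l hl =>
        (h.2 l hl).trans (k.2 l (by rw [← h.1]; exact hl))⟩ }

/-- The approximating space `F_i` (with the quotient topology, see below). -/
def Level (i : ℕ) : Type := Quotient (P.levelSetoid i)

instance (i : ℕ) : TopologicalSpace (P.Level i) :=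
  inferInstanceAs (TopologicalSpace (Quotient (P.levelSetoid i)))

instance (i : ℕ) : MeasurableSpace (P.Level i) := borel _

instance (i : ℕ) : BorelSpace (P.Level i) := ⟨rfl⟩

variable {P}

/-- The point of `F_i` with the word `η w_1 … w_i`. -/
def ofFiniteWord {i : ℕ} (p : Circ × P.Word i) : P.Level i := Quotient.mk (P.levelSetoid i) p

/-- The angle `η` of a point of `F_i`, as an element of the circle. -/
def angle {i : ℕ} (x : P.Level i) : Circ :=
  Quotient.lift (s := P.levelSetoid i) (fun p : Circ × P.Word i => p.1) (fun _ _ h => h.1) x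

/-- The angle of a point of `F_i`, as a number in `[0, 2π)`. -/
def arg {i : ℕ} (x : P.Level i) : ℝ := (AddCircle.equivIco (2 * Real.pi) 0 (angle x) : ℝ)

/-- The map `φ_{ik} : F_i → F_k` that shortens words. -/
def proj {k i : ℕ} (h : k ≤ i) (x : P.Level i) : P.Level k :=
  Quotient.map (sa := P.levelSetoid i) (sb := P.levelSetoid k)
    (fun p : Circ × P.Word i =>
      ((p.1, fun l : Fin k => p.2 (Fin.castLE h l)) : Circ × P.Word k))
    (fun _ _ hp => ⟨hp.1, fun l hl => hp.2 (Fin.castLE h l) hl⟩) x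

/-- Sanity check: `F_{i+1}` arises from `F_i × [n_{i+1}]` by identifying, for each point `x`
of `F_i` whose angle is an identification angle of a stage up to `i + 1`, all the pairs `x w`. -/
theorem ofFiniteWord_succ_eq_iff {i : ℕ} (p q : Circ × P.Word (i + 1)) :
    ofFiniteWord p = ofFiniteWord q ↔
      proj (Nat.le_succ i) (ofFiniteWord p) = proj (Nat.le_succ i) (ofFiniteWord q) ∧
      (angle (ofFiniteWord p) ∉ P.grid (i + 1) → p.2 (Fin.last i) = q.2 (Fin.last i)) := by
  constructor
  · intro h
    refine ⟨by rw [h], fun hp => ?_⟩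
    exact (Quotient.exact h).2 (Fin.last i) hp
  · rintro ⟨h1, h2⟩
    have h3 := Quotient.exact h1
    refine Quotient.sound ⟨h3.1, fun l hl => ?_⟩
    induction l using Fin.lastCases with
    | last => exact h2 hl
    | cast l => exact h3.2 l hl

variable (P)

/-- The number of arcs into which level `i` cuts the circle: `1` for `i = 0`,
and `2 J_i` for `i ≥ 1`. -/
def arcs : ℕ → ℕ
  | 0 => 1
  | i + 1 => 2 * P.J (i + 1)

/-- The length of an `i`-cell: `L_0 = 2π` and `L_i = π / J_i` for `i ≥ 1`. -/
def L : ℕ → ℝ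
  | 0 => 2 * Real.pi
  | i + 1 => Real.pi / P.J (i + 1)

/-- The index set `𝒜_i` of the `i`-cells; the cell `(m, w)` starts at the angle `m L_i`. -/
abbrev Cell (i : ℕ) : Type := Fin (P.arcs i) × P.Word i

variable {P}

/-- The parametrization `φ_α` of the `i`-cell `I_α`, to be used on `[0, L_i]`. -/
def cellMap {i : ℕ} (α : P.Cell i) (θ : ℝ) : P.Level i :=
  ofFiniteWord ((((α.1 : ℕ) * P.L i + θ : ℝ) : Circ), α.2)

/-- The (closed) `i`-cell `I_α`. -/
def cellSet {i : ℕ} (α : P.Cell i) : Set (P.Level i) := cellMap α '' Set.Icc 0 (P.L i)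

/-- Two `i`-cells belong to the same bundle: same arc, and same letters `w_1, …, w_{i-1}`. -/
def SameBundleCell {i : ℕ} (α β : P.Cell i) : Prop :=
  α.1 = β.1 ∧ ∀ l : Fin i, (l : ℕ) + 1 < i → α.2 l = β.2 l

/-- `x` and `y` belong to a common `i`-cell. -/
def SameCell {i : ℕ} (x y : P.Level i) : Prop :=
  ∃ α : P.Cell i, x ∈ cellSet α ∧ y ∈ cellSet α

/-- `x` and `y` belong to `i`-cells in the same bundle. -/
def SameBundle {i : ℕ} (x y : P.Level i) : Prop :=
  ∃ α β : P.Cell i, SameBundleCell α β ∧ x ∈ cellSet α ∧ y ∈ cellSet β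

/-- The position `θ_x ∈ [0, L_i)` of `x` in an `i`-cell that contains it. -/
def pos {i : ℕ} (x : P.Level i) : ℝ := P.L i * Int.fract (arg x / P.L i)

variable (P)

/-- The measure `μ_i` on `F_i`: on each `i`-cell, `1 / N_i` times arc length. -/
def levelMeasure (i : ℕ) : Measure (P.Level i) :=
  ((P.N i : ENNReal))⁻¹ •
    ∑ α : P.Cell i, (volume.restrict (Set.Icc 0 (P.L i))).map (cellMap α)

end Params

/-- The heat kernel of the circle, `1/(2π) + (1/π) ∑_{k ≥ 1} exp(-k² t) cos(k (θ₂ - θ₁))`. -/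
def circleKernel (t θ₁ θ₂ : ℝ) : ℝ :=
  1 / (2 * Real.pi) + 1 / Real.pi *
    ∑' k : ℕ, Real.exp (-((k : ℝ) + 1) ^ 2 * t) * Real.cos (((k : ℝ) + 1) * (θ₂ - θ₁))

namespace Params

variable (P : Params)

/-- The heat kernel of `[0, L_i]` with Dirichlet boundary conditions (for `i ≥ 1`), through the
kernel of the circle: `J_i (p_{J_i² t}(J_i θ₁, J_i θ₂) - p_{J_i² t}(J_i θ₁, -J_i θ₂))`. -/
def dirichletKernel (i : ℕ) (t θ₁ θ₂ : ℝ) : ℝ :=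
  (P.J i : ℝ) * (circleKernel ((P.J i : ℝ) ^ 2 * t) (P.J i * θ₁) (P.J i * θ₂)
    - circleKernel ((P.J i : ℝ) ^ 2 * t) (P.J i * θ₁) (-(P.J i * θ₂)))

open Classical in
/-- The kernel `p_t^{F_i}(x, y)`, by recursion on the level `i`. -/
def kernel : (i : ℕ) → ℝ → P.Level i → P.Level i → ℝ
  | 0, t, x, y => circleKernel t (arg x) (arg y)
  | i + 1, t, x, y =>
    kernel i t (proj (Nat.le_succ i) x) (proj (Nat.le_succ i) y) +
      if SameCell x y then
        (P.N i : ℝ) * ((P.n (i + 1) : ℝ) - 1) * P.dirichletKernel (i + 1) t (pos x) (pos y)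
      else if SameBundle x y then
        -((P.N i : ℝ) * P.dirichletKernel (i + 1) t (pos x) (pos y))
      else 0

/-- The diamond fractal `F_∞`: the inverse limit of the spaces `F_i`, with the topology
induced by the product topology. -/
def Limit : Type :=
  {x : ∀ i, P.Level i // ∀ (k i : ℕ) (h : k ≤ i), proj h (x i) = x k}

instance : TopologicalSpace P.Limit :=
  inferInstanceAs (TopologicalSpace
    {x : ∀ i, P.Level i // ∀ (k i : ℕ) (h : k ≤ i), proj h (x i) = x k})

instance : MeasurableSpace P.Limit := borel _

instance : BorelSpace P.Limit := ⟨rfl⟩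

variable {P}

/-- The projection `Φ_i : F_∞ → F_i`. -/
def toLevel (i : ℕ) (x : P.Limit) : P.Level i := x.1 i

variable (P)

/-- The point of `F_∞` with the infinite word `η w_1 w_2 …`. -/
def ofWord (p : Circ × (∀ l : ℕ, Fin (P.n (l + 1)))) : P.Limit :=
  ⟨fun i => ofFiniteWord (p.1, fun l : Fin i => p.2 l), fun _ _ _ => rfl⟩

/-- The measure `μ_∞` on `F_∞`: the image of arc length on the circle times the uniform
distribution of the infinite word `w_1 w_2 …`. It is the limit of the measures `μ_i`, in the
sense that its image under each `Φ_i` is `μ_i`; this is part of the theorem. -/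
def limitMeasure : Measure P.Limit :=
  ((volume : Measure Circ).prod
    (Measure.infinitePi fun l : ℕ =>
      (PMF.uniformOfFintype (Fin (P.n (l + 1)))).toMeasure)).map P.ofWord

/-- `p_t^{F_∞}(x, y) = lim_i p_t^{F_i}(Φ_i x, Φ_i y)`. -/
def limitKernel (t : ℝ) (x y : P.Limit) : ℝ :=
  limUnder atTop fun i : ℕ => P.kernel i t (toLevel i x) (toLevel i y)

end Params

/-- The operators `T_t f (x) = ∫ p_t(x, y) f(y) μ(dy)` of a kernel `p`. -/
def heatOp {X : Type} [MeasurableSpace X] (μ : Measure X) (p : ℝ → X → X → ℝ)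
    (t : ℝ) (f : X → ℝ) (x : X) : ℝ := ∫ y, p t x y * f y ∂μ

/-- The kernel `p_t(x, y)`, `t > 0`, is continuous, and the operators `T_t` (with `T_0 = id`)
form a symmetric, conservative, strongly continuous Markov semigroup on `C(X)` with the strong
Feller property. -/
structure IsMarkovKernel {X : Type} [TopologicalSpace X] [MeasurableSpace X] (μ : Measure X)
    (p : ℝ → X → X → ℝ) : Prop where
  continuousOn : ContinuousOn (fun z : ℝ × X × X => p z.1 z.2.1 z.2.2) (Set.Ioi 0 ×ˢ Set.univ)
  symm : ∀ t, 0 < t → ∀ x y, p t x y = p t y x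
  nonneg : ∀ t, 0 < t → ∀ x y, 0 ≤ p t x y
  conservative : ∀ t, 0 < t → ∀ x, ∫ y, p t x y ∂μ = 1
  semigroup : ∀ s t, 0 < s → 0 < t → ∀ f : X → ℝ, Continuous f → ∀ x,
    heatOp μ p (s + t) f x = heatOp μ p s (heatOp μ p t f) x
  strongContinuity : ∀ f : X → ℝ, Continuous f →
    TendstoUniformly (fun t => heatOp μ p t f) f (𝓝[>] 0)
  strongFeller : ∀ t, 0 < t → ∀ f : X → ℝ, Measurable f → (∃ C, ∀ x, |f x| ≤ C) →
    Continuous (heatOp μ p t f)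

namespace Params

variable (P : Params)

open Classical in
/-- `u(t, x)` solves the heat equation `∂ₜ u = ∂²u/∂θ²` on the metric graph `F_i`: the equation
holds on each `i`-cell, and at each point the derivatives of `u(t, ·)` along the cells that start
there and along the cells that end there have the same sum (Kirchhoff condition). -/
structure SolvesHeatEquation (i : ℕ) (u : ℝ → P.Level i → ℝ) : Prop where
  continuousOn : ContinuousOn (fun z : ℝ × P.Level i => u z.1 z.2) (Set.Ioi 0 ×ˢ Set.univ)
  smooth : ∀ t, 0 < t → ∀ α : P.Cell i,
    ContDiffOn ℝ 2 (fun θ => u t (cellMap α θ)) (Set.Icc 0 (P.L i))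
  equation : ∀ t, 0 < t → ∀ α : P.Cell i, ∀ θ ∈ Set.Icc 0 (P.L i),
    HasDerivAt (fun s => u s (cellMap α θ))
      (iteratedDerivWithin 2 (fun θ' => u t (cellMap α θ')) (Set.Icc 0 (P.L i)) θ) t
  kirchhoff : ∀ t, 0 < t → ∀ x : P.Level i,
    (∑ α : P.Cell i, if cellMap α 0 = x then
      derivWithin (fun θ => u t (cellMap α θ)) (Set.Icc 0 (P.L i)) 0 else 0) =
    ∑ α : P.Cell i, if cellMap α (P.L i) = x then
      derivWithin (fun θ => u t (cellMap α θ)) (Set.Icc 0 (P.L i)) (P.L i) else 0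

/-- `p` is the heat kernel of the natural diffusion (Brownian motion on the metric graph)
on `F_i`: a Markov kernel that is the fundamental solution of the heat equation. -/
structure IsLevelHeatKernel (i : ℕ) (p : ℝ → P.Level i → P.Level i → ℝ) : Prop where
  markov : IsMarkovKernel (P.levelMeasure i) p
  heat : ∀ f : P.Level i → ℝ, Continuous f →
    P.SolvesHeatEquation i (fun t => heatOp (P.levelMeasure i) p t f)

/-- `p` is the heat kernel of the diamond fractal: a Markov kernel on `F_∞` whose semigroup
is compatible with those on the `F_i`: `T_t^{F_∞} (h ∘ Φ_i) = (T_t^{F_i} h) ∘ Φ_i`. -/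
structure IsLimitHeatKernel (p : ℝ → P.Limit → P.Limit → ℝ) : Prop where
  markov : IsMarkovKernel P.limitMeasure p
  compatible : ∀ (i : ℕ) (t : ℝ), 0 < t → ∀ h : P.Level i → ℝ, Continuous h → ∀ x : P.Limit,
    heatOp P.limitMeasure p t (fun y => h (toLevel i y)) x =
      heatOp (P.levelMeasure i) (P.kernel i) t h (toLevel i x)

end Params

end Diamond

end

/-!
# The heat kernel of a generalized diamond fractal

Everything rests on a recursion for the kernels. In terms of words, `kernel_succ` says that
`p^{F_{i+1}}` is the lift of `p^{F_i}` plus `N_i` times a matrix coupling the last letters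
(`n_{i+1} - 1` on the diagonal, `-1` off it) times the kernel of Brownian motion on an arc of level
`i + 1` killed at its ends. For a function `f` on `F_{i+1}` this becomes `heatOp_succ`: the
semigroup of `F_{i+1}` applies the semigroup of `F_i` to the average `fiberAvg f` of `f` over the
last letter, and the killed semigroup of the arcs, `arcOp`, to the fluctuation `fluct f` about that
average, which vanishes at the identification points and sums to zero over the last letter.

**Levels.** By the reflection principle, `arcOp` is the semigroup of the circle applied to a rescaled
odd extension, so that by induction on `i` every `T_t f` solves the heat equation on each cell
(`exists_isHeatSol`), depends compatibly on `i` (`heatOp_comp_proj`) and converges uniformly to `f`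
(`eventually_abs_heatOp_sub_le`). The Kirchhoff condition also goes up by induction: at an
identification point of level `i + 1` the contributions of the fluctuations cancel because these sum
to zero, and elsewhere they are differentiable (`sum_rightDeriv_eq_sum_leftDeriv`).

Positivity and the semigroup property are not visible in the formula for the kernel. They follow
from the maximum principle for the heat equation on the metric graph (`SolvesHeatEquation.nonneg`):
at a negative space-time minimum inside a cell `∂ₜ` and `∂²/∂θ²` have incompatible signs, and at a
vertex the Kirchhoff condition forces all one-sided derivatives to vanish, which reduces that case
to the first one. Thus `T_t` preserves positivity, and `T_{s+t} f` and `T_s T_t f`, having the same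
initial values, agree.

**Limit.** The kernels of the levels `i` and `i + 1` differ by at most a constant times
`N_{i+1} J_{i+1} exp (-J_{i+1}² t₀)` for all `t ≥ t₀`, which is summable by the hypothesis
(`summable_incrementBound`). This gives uniform convergence and continuity of the limit. The kernels
agree off the common bundles of cells, and two different points are in a common bundle on finitely
many levels only (`bddAbove_sameBundle`). Finally, the functions that factor through some `F_i` are
dense in `C(F_∞)`, and on them the limit semigroup is that of `F_i`. Contractivity carries the
semigroup property, strong continuity and uniqueness over to all continuous functions.
-/

noncomputable section

namespace Diamond

/-! ### Trigonometric series solving the heat equation on the line -/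

/-- `V t θ` is, for `t > 0`, a solution of the heat equation on the whole line that is `C²` in the
space variable. -/
structure IsHeatSol (V : ℝ → ℝ → ℝ) : Prop where
  smooth : ∀ t, 0 < t → ContDiff ℝ 2 (V t)
  equation : ∀ t, 0 < t → ∀ θ, HasDerivAt (fun s => V s θ) (deriv (deriv (V t)) θ) t

theorem deriv_differentiable_of_contDiff_two {f : ℝ → ℝ} (hf : ContDiff ℝ 2 f) :
    Differentiable ℝ (deriv f) := by
  have h : ContDiff ℝ (1 + 1) f := by simpa [one_add_one_eq_two] using hf
  exact (contDiff_succ_iff_deriv.1 h).2.2.differentiable one_ne_zero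

theorem IsHeatSol.add {V W : ℝ → ℝ → ℝ} (hV : IsHeatSol V) (hW : IsHeatSol W) :
    IsHeatSol (fun t θ => V t θ + W t θ) where
  smooth t ht := (hV.smooth t ht).add (hW.smooth t ht)
  equation t ht θ := by
    have dV := (hV.smooth t ht).differentiable two_ne_zero
    have dW := (hW.smooth t ht).differentiable two_ne_zero
    have e : deriv (fun θ => V t θ + W t θ) = fun θ => deriv (V t) θ + deriv (W t) θ := by
      ext x; exact deriv_fun_add (dV x) (dW x)
    rw [e, deriv_fun_add (deriv_differentiable_of_contDiff_two (hV.smooth t ht) θ)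
      (deriv_differentiable_of_contDiff_two (hW.smooth t ht) θ)]
    exact (hV.equation t ht θ).add (hW.equation t ht θ)

/-- Parabolic rescaling. -/
theorem IsHeatSol.comp_affine {V : ℝ → ℝ → ℝ} (hV : IsHeatSol V) {c : ℝ} (hc : 0 < c) (d : ℝ) :
    IsHeatSol (fun t θ => V (c ^ 2 * t) (c * θ + d)) where
  smooth t ht := by
    have := hV.smooth (c ^ 2 * t) (by positivity)
    exact this.comp (by fun_prop)
  equation t ht θ := by
    have h0 : 0 < c ^ 2 * t := by positivity
    have hs := hV.smooth _ h0
    have hin : ∀ x, HasDerivAt (fun θ : ℝ => c * θ + d) c x := fun x => by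
      simpa using ((hasDerivAt_id x).const_mul c).add_const d
    have e : deriv (fun θ => V (c ^ 2 * t) (c * θ + d)) =
        fun θ => deriv (V (c ^ 2 * t)) (c * θ + d) * c := by
      ext x
      exact (((hs.differentiable two_ne_zero) (c * x + d)).hasDerivAt.comp x (hin x)).deriv
    have e2 : deriv (fun θ => deriv (V (c ^ 2 * t)) (c * θ + d) * c) θ =
        deriv (deriv (V (c ^ 2 * t))) (c * θ + d) * c * c := by
      have h1 := ((deriv_differentiable_of_contDiff_two hs) (c * θ + d)).hasDerivAt.comp θ (hin θ)
      exact (h1.mul_const c).deriv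
    rw [e, e2]
    have hl : HasDerivAt (fun s : ℝ => c ^ 2 * s) (c ^ 2) t := by
      simpa using (hasDerivAt_id t).const_mul (c ^ 2)
    have := (hV.equation _ h0 (c * θ + d)).comp t hl
    rwa [pow_two, ← mul_assoc, ← pow_two] at this

theorem IsHeatSol.of_eq {V W : ℝ → ℝ → ℝ} (hV : IsHeatSol V) (h : ∀ t, 0 < t → W t = V t) :
    IsHeatSol W where
  smooth t ht := by rw [h t ht]; exact hV.smooth t ht
  equation t ht θ := by
    rw [h t ht]
    refine (hV.equation t ht θ).congr_of_eventuallyEq ?_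
    filter_upwards [lt_mem_nhds ht] with s hs
    rw [h s hs]

theorem isHeatSol_const (c : ℝ) : IsHeatSol (fun _ _ => c) where
  smooth _ _ := contDiff_const
  equation t _ θ := by
    have : deriv (fun _ : ℝ => c) = fun _ => 0 := by ext; simp
    rw [this]; simpa using hasDerivAt_const t c

/-- The series `∑_{k ≥ 1} exp(-k² t) (a_k cos (k θ) + b_k sin (k θ))`; the coefficients of
frequency `k + 1` are the entries with index `k`. -/
def heatSeries (a b : ℕ → ℝ) (t θ : ℝ) : ℝ :=
  ∑' k : ℕ, Real.exp (-((k : ℝ) + 1) ^ 2 * t) *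
    (a k * Real.cos (((k : ℝ) + 1) * θ) + b k * Real.sin (((k : ℝ) + 1) * θ))

/-- Coefficients of at most polynomial growth. -/
def PolyBdd (a : ℕ → ℝ) : Prop := ∃ (M : ℝ) (p : ℕ), ∀ k, |a k| ≤ M * ((k : ℝ) + 1) ^ p

theorem PolyBdd.mul_index {a : ℕ → ℝ} (h : PolyBdd a) : PolyBdd fun k => ((k : ℝ) + 1) * a k := by
  obtain ⟨M, p, h⟩ := h
  refine ⟨M, p + 1, fun k => ?_⟩
  have : (0 : ℝ) ≤ (k : ℝ) + 1 := by positivity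
  rw [abs_mul, abs_of_nonneg this, pow_succ]
  nlinarith [h k]

theorem PolyBdd.neg {a : ℕ → ℝ} (h : PolyBdd a) : PolyBdd fun k => -a k := by
  obtain ⟨M, p, h⟩ := h
  exact ⟨M, p, fun k => by simpa using h k⟩

theorem polyBdd_of_abs_le {a : ℕ → ℝ} {M : ℝ} (h : ∀ k, |a k| ≤ M) : PolyBdd a :=
  ⟨M, 0, fun k => by simpa using h k⟩

theorem exp_neg_sq_le {t₀ t : ℝ} (h₀ : 0 < t₀) (h : t₀ ≤ t) (k : ℕ) :
    Real.exp (-((k : ℝ) + 1) ^ 2 * t) ≤ Real.exp (-t₀ * ((k + 1 : ℕ) : ℝ)) := by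
  apply Real.exp_le_exp.2
  push_cast
  have : (0 : ℝ) ≤ k := by positivity
  nlinarith [mul_nonneg this h₀.le, mul_nonneg (mul_nonneg this this) h₀.le,
    mul_nonneg (sq_nonneg ((k : ℝ) + 1)) (sub_nonneg.2 h)]

theorem exists_summable_bound {a b : ℕ → ℝ} (ha : PolyBdd a) (hb : PolyBdd b) {t₀ : ℝ}
    (h₀ : 0 < t₀) : ∃ u : ℕ → ℝ, Summable u ∧ ∀ t, t₀ ≤ t → ∀ θ : ℝ, ∀ k : ℕ,
      ‖Real.exp (-((k : ℝ) + 1) ^ 2 * t) *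
        (a k * Real.cos (((k : ℝ) + 1) * θ) + b k * Real.sin (((k : ℝ) + 1) * θ))‖ ≤ u k := by
  obtain ⟨M, p, ha⟩ := ha
  obtain ⟨M', q, hb⟩ := hb
  have s1 := ((summable_nat_add_iff 1).2 (Real.summable_pow_mul_exp_neg_nat_mul p h₀)).mul_left M
  have s2 := ((summable_nat_add_iff 1).2 (Real.summable_pow_mul_exp_neg_nat_mul q h₀)).mul_left M'
  refine ⟨_, s1.add s2, fun t ht θ k => ?_⟩
  rw [Real.norm_eq_abs, abs_mul, abs_of_pos (Real.exp_pos _)]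
  have hA : |a k * Real.cos (((k : ℝ) + 1) * θ) + b k * Real.sin (((k : ℝ) + 1) * θ)| ≤
      |a k| + |b k| := by
    refine (abs_add_le _ _).trans (add_le_add ?_ ?_)
    · rw [abs_mul]; exact mul_le_of_le_one_right (abs_nonneg _) (Real.abs_cos_le_one _)
    · rw [abs_mul]; exact mul_le_of_le_one_right (abs_nonneg _) (Real.abs_sin_le_one _)
  have hB : |a k| + |b k| ≤ M * ((k : ℝ) + 1) ^ p + M' * ((k : ℝ) + 1) ^ q :=
    add_le_add (ha k) (hb k)
  have hE := exp_neg_sq_le h₀ ht k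
  calc _ ≤ Real.exp (-t₀ * ((k + 1 : ℕ) : ℝ)) *
        (M * ((k : ℝ) + 1) ^ p + M' * ((k : ℝ) + 1) ^ q) :=
        mul_le_mul hE (hA.trans hB) (abs_nonneg _) (Real.exp_pos _).le
    _ = _ := by push_cast; ring

theorem continuousOn_heatSeries {a b : ℕ → ℝ} (ha : PolyBdd a) (hb : PolyBdd b) :
    ContinuousOn (fun z : ℝ × ℝ => heatSeries a b z.1 z.2) (Set.Ioi 0 ×ˢ Set.univ) := by
  rintro ⟨t, θ⟩ ⟨ht, -⟩
  have ht : 0 < t := ht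
  obtain ⟨u, hu, hu'⟩ := exists_summable_bound ha hb (half_pos ht)
  have : ContinuousOn (fun z : ℝ × ℝ => heatSeries a b z.1 z.2) (Set.Ioi (t / 2) ×ˢ Set.univ) := by
    unfold heatSeries
    refine continuousOn_tsum (fun k => ?_) hu (fun k z hz => hu' z.1 (le_of_lt hz.1) z.2 k)
    exact Continuous.continuousOn (by fun_prop)
  refine (this.continuousAt ?_).continuousWithinAt
  exact (isOpen_Ioi.prod isOpen_univ).mem_nhds ⟨half_lt_self ht, trivial⟩

theorem summable_heatSeries {a b : ℕ → ℝ} (ha : PolyBdd a) (hb : PolyBdd b) {t : ℝ}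
    (ht : 0 < t) (θ : ℝ) : Summable fun k : ℕ => Real.exp (-((k : ℝ) + 1) ^ 2 * t) *
        (a k * Real.cos (((k : ℝ) + 1) * θ) + b k * Real.sin (((k : ℝ) + 1) * θ)) := by
  obtain ⟨u, hu, hb⟩ := exists_summable_bound ha hb ht
  exact Summable.of_norm_bounded hu (hb t le_rfl θ)

/-- Differentiation in space multiplies the coefficients by the frequency and interchanges them. -/
theorem hasDerivAt_heatSeries {a b : ℕ → ℝ} (ha : PolyBdd a) (hb : PolyBdd b) {t : ℝ}
    (ht : 0 < t) (θ : ℝ) : HasDerivAt (heatSeries a b t)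
      (heatSeries (fun k => ((k : ℝ) + 1) * b k) (fun k => -(((k : ℝ) + 1) * a k)) t θ) θ := by
  obtain ⟨u, hu, hu'⟩ := exists_summable_bound hb.mul_index ha.mul_index.neg ht
  suffices key : ∀ (k : ℕ) (y : ℝ), HasDerivAt (fun y : ℝ => Real.exp (-((k : ℝ) + 1) ^ 2 * t) *
      (a k * Real.cos (((k : ℝ) + 1) * y) + b k * Real.sin (((k : ℝ) + 1) * y)))
      (Real.exp (-((k : ℝ) + 1) ^ 2 * t) * (((k : ℝ) + 1) * b k * Real.cos (((k : ℝ) + 1) * y) +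
        -(((k : ℝ) + 1) * a k) * Real.sin (((k : ℝ) + 1) * y))) y by
    exact hasDerivAt_tsum (y₀ := 0) hu key (fun k y => hu' t le_rfl y k)
      (summable_heatSeries ha hb ht 0) θ
  intro k y
  have h1 : HasDerivAt (fun y : ℝ => ((k : ℝ) + 1) * y) ((k : ℝ) + 1) y := by
    simpa using (hasDerivAt_id y).const_mul ((k : ℝ) + 1)
  refine (((h1.cos.const_mul (a k)).add (h1.sin.const_mul (b k))).const_mul
    (Real.exp (-((k : ℝ) + 1) ^ 2 * t))).congr_deriv ?_
  ring

theorem hasDerivAt_heatSeries_time {a b : ℕ → ℝ} (ha : PolyBdd a) (hb : PolyBdd b) {t : ℝ}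
    (ht : 0 < t) (θ : ℝ) : HasDerivAt (fun s => heatSeries a b s θ)
      (heatSeries (fun k => ((k : ℝ) + 1) * -(((k : ℝ) + 1) * a k))
        (fun k => -(((k : ℝ) + 1) * (((k : ℝ) + 1) * b k))) t θ) t := by
  obtain ⟨u, hu, hu'⟩ := exists_summable_bound ha.mul_index.neg.mul_index
    hb.mul_index.mul_index.neg (half_pos ht)
  refine hasDerivAt_tsum_of_isPreconnected (t := Set.Ioi (t / 2)) (y₀ := t) hu isOpen_Ioi
    isPreconnected_Ioi (fun k y _ => ?_) (fun k y hy => hu' y (le_of_lt hy) θ k)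
    (half_lt_self ht) (summable_heatSeries ha hb ht θ) (half_lt_self ht)
  have h1 : HasDerivAt (fun y : ℝ => -((k : ℝ) + 1) ^ 2 * y) (-((k : ℝ) + 1) ^ 2) y := by
    simpa using (hasDerivAt_id y).const_mul (-((k : ℝ) + 1) ^ 2)
  refine (h1.exp.mul_const
    (a k * Real.cos (((k : ℝ) + 1) * θ) + b k * Real.sin (((k : ℝ) + 1) * θ))).congr_deriv ?_
  ring

theorem isHeatSol_heatSeries {a b : ℕ → ℝ} (ha : PolyBdd a) (hb : PolyBdd b) :
    IsHeatSol (heatSeries a b) := by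
  have d1 : ∀ t, 0 < t → deriv (heatSeries a b t) =
      heatSeries (fun k => ((k : ℝ) + 1) * b k) (fun k => -(((k : ℝ) + 1) * a k)) t :=
    fun t ht => by ext θ; exact (hasDerivAt_heatSeries ha hb ht θ).deriv
  refine ⟨fun t ht => ?_, fun t ht θ => ?_⟩
  · have h : ContDiff ℝ (1 + 1) (heatSeries a b t) := by
      refine contDiff_succ_iff_deriv.2
        ⟨fun θ => (hasDerivAt_heatSeries ha hb ht θ).differentiableAt, by simp, ?_⟩
      rw [d1 t ht, contDiff_one_iff_deriv]
      refine ⟨fun θ =>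
        (hasDerivAt_heatSeries hb.mul_index ha.mul_index.neg ht θ).differentiableAt, ?_⟩
      have : deriv (heatSeries (fun k => ((k : ℝ) + 1) * b k)
          (fun k => -(((k : ℝ) + 1) * a k)) t) = _ :=
        funext fun θ => (hasDerivAt_heatSeries hb.mul_index ha.mul_index.neg ht θ).deriv
      rw [this]
      exact (continuousOn_heatSeries ha.mul_index.neg.mul_index hb.mul_index.mul_index.neg
        ).comp_continuous (f := fun θ : ℝ => (t, θ)) (by fun_prop) (fun θ => ⟨ht, trivial⟩)
    simpa [one_add_one_eq_two] using h
  · rw [d1 t ht, (hasDerivAt_heatSeries hb.mul_index ha.mul_index.neg ht θ).deriv]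
    exact hasDerivAt_heatSeries_time ha hb ht θ

/-! ### The heat kernel of the circle -/

/-- The heat kernel of the circle as a function of the difference of the angles. -/
def theta (t θ : ℝ) : ℝ := circleKernel t 0 θ

theorem circleKernel_eq (t a b : ℝ) : circleKernel t a b = theta t (b - a) := by
  simp [theta, circleKernel]

theorem theta_eq (t θ : ℝ) :
    theta t θ = 1 / (2 * Real.pi) + heatSeries (fun _ => 1 / Real.pi) (fun _ => 0) t θ := by
  rw [theta, circleKernel, heatSeries, ← tsum_mul_left]
  congr 1
  refine tsum_congr fun k => ?_
  rw [sub_zero]; ring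

theorem polyBdd_const (c : ℝ) : PolyBdd fun _ => c := polyBdd_of_abs_le fun _ => le_rfl

theorem theta_neg (t θ : ℝ) : theta t (-θ) = theta t θ := by
  simp [theta, circleKernel]

theorem theta_periodic (t : ℝ) : Function.Periodic (theta t) (2 * Real.pi) := by
  intro θ
  rw [theta, theta, circleKernel, circleKernel]
  congr 2
  refine tsum_congr fun k => ?_
  have := Real.cos_add_nat_mul_two_pi (((k : ℝ) + 1) * (θ - 0)) (k + 1)
  push_cast at this
  rw [← this]
  congr 2; ring

theorem continuousOn_theta :
    ContinuousOn (fun z : ℝ × ℝ => theta z.1 z.2) (Set.Ioi 0 ×ˢ Set.univ) := by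
  simp only [theta_eq]
  exact continuousOn_const.add (continuousOn_heatSeries (polyBdd_const _) (polyBdd_const _))

theorem continuous_theta {t : ℝ} (ht : 0 < t) : Continuous (theta t) :=
  continuousOn_theta.comp_continuous (f := fun θ : ℝ => (t, θ)) (by fun_prop)
    (fun θ => ⟨ht, trivial⟩)

/-- Poisson summation turns the cosine series into a sum of Gaussians. -/
theorem theta_nonneg {t : ℝ} (ht : 0 < t) (θ : ℝ) : 0 ≤ theta t θ := by
  have hpi := Real.pi_pos
  have hs : 0 < t / Real.pi := by positivity
  have h := HurwitzZeta.hasSum_nat_cosKernel₀ (θ / (2 * Real.pi)) hs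
  have e : theta t θ = 1 / (2 * Real.pi) *
      HurwitzZeta.cosKernel ((θ / (2 * Real.pi) : ℝ) : UnitAddCircle) (t / Real.pi) := by
    have h2 : HurwitzZeta.cosKernel ((θ / (2 * Real.pi) : ℝ) : UnitAddCircle) (t / Real.pi) =
      1 + ∑' k : ℕ, 2 * Real.cos (2 * Real.pi * (θ / (2 * Real.pi)) * ((k : ℝ) + 1)) *
        Real.exp (-Real.pi * ((k : ℝ) + 1) ^ 2 * (t / Real.pi)) := by rw [h.tsum_eq]; ring
    rw [h2, theta, circleKernel, mul_add, mul_one, ← tsum_mul_left, ← tsum_mul_left]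
    congr 1
    refine tsum_congr fun k => ?_
    have e1 : 2 * Real.pi * (θ / (2 * Real.pi)) * ((k : ℝ) + 1) = ((k : ℝ) + 1) * (θ - 0) := by
      field_simp; ring
    have e2 : -Real.pi * ((k : ℝ) + 1) ^ 2 * (t / Real.pi) = -((k : ℝ) + 1) ^ 2 * t := by
      field_simp
    rw [e1, e2]; field_simp
  have hf := HurwitzZeta.evenKernel_functional_equation
    ((θ / (2 * Real.pi) : ℝ) : UnitAddCircle) (1 / (t / Real.pi))
  rw [one_div_one_div] at hf
  have hnn : 0 ≤ HurwitzZeta.evenKernel ((θ / (2 * Real.pi) : ℝ) : UnitAddCircle)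
      (1 / (t / Real.pi)) :=
    (HurwitzZeta.hasSum_int_evenKernel _ (by positivity)).nonneg fun n => (Real.exp_pos _).le
  rw [hf] at hnn
  have hc : 0 < 1 / (1 / (t / Real.pi)) ^ (1 / 2 : ℝ) := by positivity
  have : 0 ≤ HurwitzZeta.cosKernel ((θ / (2 * Real.pi) : ℝ) : UnitAddCircle) (t / Real.pi) :=
    nonneg_of_mul_nonneg_right hnn hc
  rw [e]; positivity

/-- The deviation of the kernel from its mean decays exponentially. -/
theorem abs_theta_sub_le {t₀ t : ℝ} (h₀ : 0 < t₀) (ht : t₀ ≤ t) (θ : ℝ) :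
    |theta t θ - 1 / (2 * Real.pi)| ≤ 1 / Real.pi * (Real.exp (-t) / (1 - Real.exp (-t₀))) := by
  have hpi := Real.pi_pos
  have hq : Real.exp (-t) < 1 := by simpa using h₀.trans_le ht
  have hg := (hasSum_geometric_of_lt_one (Real.exp_pos (-t)).le hq).mul_left (Real.exp (-t))
  have h1 : theta t θ - 1 / (2 * Real.pi) = 1 / Real.pi *
      ∑' k : ℕ, Real.exp (-((k : ℝ) + 1) ^ 2 * t) * Real.cos (((k : ℝ) + 1) * (θ - 0)) := by
    rw [theta, circleKernel]; ring
  rw [h1, abs_mul, abs_of_pos (by positivity : 0 < 1 / Real.pi)]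
  refine mul_le_mul_of_nonneg_left ?_ (by positivity)
  have h2 : ‖∑' k : ℕ, Real.exp (-((k : ℝ) + 1) ^ 2 * t) *
      Real.cos (((k : ℝ) + 1) * (θ - 0))‖ ≤ Real.exp (-t) * (1 - Real.exp (-t))⁻¹ := by
    refine tsum_of_norm_bounded hg fun k => ?_
    rw [Real.norm_eq_abs, abs_mul, abs_of_pos (Real.exp_pos _)]
    refine (mul_le_of_le_one_right (Real.exp_pos _).le (Real.abs_cos_le_one _)).trans ?_
    refine (exp_neg_sq_le (h₀.trans_le ht) le_rfl k).trans (le_of_eq ?_)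
    rw [← Real.exp_nat_mul, ← Real.exp_add]; congr 1; push_cast; ring
  refine h2.trans ?_
  rw [div_eq_mul_inv]
  refine mul_le_mul_of_nonneg_left ?_ (Real.exp_pos _).le
  have h3 : Real.exp (-t₀) < 1 := by simpa using h₀
  exact inv_anti₀ (by linarith) (by
    have := Real.exp_le_exp.2 (neg_le_neg ht); linarith)

/-! ### The heat semigroup of the circle -/

/-- The heat semigroup of the circle, acting on a `2π`-periodic function `G`. -/
def circOp (t : ℝ) (G : ℝ → ℝ) (a : ℝ) : ℝ :=
  ∫ b in (0 : ℝ)..2 * Real.pi, theta t (b - a) * G b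

/-- The heat semigroup of the circle multiplies the Fourier coefficients by `exp (-k² t)`. -/
theorem circOp_eq_heatSeries {t : ℝ} (ht : 0 < t) {G : ℝ → ℝ} (hG : Continuous G) (a : ℝ) :
    circOp t G a = 1 / (2 * Real.pi) * (∫ b in (0 : ℝ)..2 * Real.pi, G b) +
      heatSeries
        (fun k => 1 / Real.pi * ∫ b in (0 : ℝ)..2 * Real.pi, Real.cos (((k : ℝ) + 1) * b) * G b)
        (fun k => 1 / Real.pi * ∫ b in (0 : ℝ)..2 * Real.pi, Real.sin (((k : ℝ) + 1) * b) * G b)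
        t a := by
  have hpi := Real.pi_pos
  obtain ⟨u, hu, hu'⟩ := exists_summable_bound (polyBdd_const (1 / Real.pi)) (polyBdd_const 0) ht
  obtain ⟨M, hM⟩ := (isCompact_uIcc (a := (0 : ℝ)) (b := 2 * Real.pi)).exists_bound_of_continuousOn
    hG.continuousOn
  let F : ℕ → ℝ → ℝ := fun k b => Real.exp (-((k : ℝ) + 1) ^ 2 * t) *
    (1 / Real.pi * Real.cos (((k : ℝ) + 1) * (b - a)) +
      0 * Real.sin (((k : ℝ) + 1) * (b - a))) * G b
  have key : HasSum (fun k => ∫ b in (0 : ℝ)..2 * Real.pi, F k b)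
      (∫ b in (0 : ℝ)..2 * Real.pi, ∑' k, F k b) := by
    refine intervalIntegral.hasSum_integral_of_dominated_convergence (fun k _ => u k * M)
      (fun k => ?_) (fun k => ?_) ?_ ?_ ?_
    · exact (Continuous.aestronglyMeasurable (by fun_prop))
    · refine Eventually.of_forall fun b hb => ?_
      rw [norm_mul]
      exact mul_le_mul (hu' t le_rfl _ k) (hM b (Set.uIoc_subset_uIcc hb)) (norm_nonneg _)
        ((norm_nonneg _).trans (hu' t le_rfl 0 k))
    · exact Eventually.of_forall fun b _ => hu.mul_right M
    · exact intervalIntegrable_const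
    · refine Eventually.of_forall fun b _ => Summable.hasSum ?_
      exact (summable_heatSeries (polyBdd_const _) (polyBdd_const _) ht (b - a)).mul_right _
  have e1 : circOp t G a = 1 / (2 * Real.pi) * (∫ b in (0 : ℝ)..2 * Real.pi, G b) +
      ∫ b in (0 : ℝ)..2 * Real.pi, ∑' k, F k b := by
    have : ∀ b, theta t (b - a) * G b = 1 / (2 * Real.pi) * G b + ∑' k, F k b := by
      intro b; rw [theta_eq, add_mul, heatSeries, ← tsum_mul_right]
    rw [circOp]
    simp only [this]
    rw [intervalIntegral.integral_add, intervalIntegral.integral_const_mul]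
    · exact (Continuous.intervalIntegrable (by fun_prop) _ _)
    · have : ∀ b, ∑' k, F k b = theta t (b - a) * G b - 1 / (2 * Real.pi) * G b := by
        intro b; rw [this]; ring
      simp only [this]
      have := continuous_theta ht
      exact (Continuous.intervalIntegrable (by fun_prop) _ _)
  rw [e1, ← key.tsum_eq, heatSeries]
  congr 1
  refine tsum_congr fun k => ?_
  have : ∀ b, F k b = Real.exp (-((k : ℝ) + 1) ^ 2 * t) * (1 / Real.pi) *
      Real.cos (((k : ℝ) + 1) * a) * (Real.cos (((k : ℝ) + 1) * b) * G b) +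
      Real.exp (-((k : ℝ) + 1) ^ 2 * t) * (1 / Real.pi) *
      Real.sin (((k : ℝ) + 1) * a) * (Real.sin (((k : ℝ) + 1) * b) * G b) := by
    intro b
    simp only [F]
    rw [mul_sub, Real.cos_sub]; ring
  simp only [this]
  rw [intervalIntegral.integral_add, intervalIntegral.integral_const_mul,
    intervalIntegral.integral_const_mul]
  · ring
  · exact (Continuous.intervalIntegrable (by fun_prop) _ _)
  · exact (Continuous.intervalIntegrable (by fun_prop) _ _)

theorem isHeatSol_circOp {G : ℝ → ℝ} (hG : Continuous G) :
    IsHeatSol fun t => circOp t G := by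
  have hpi := Real.pi_pos
  obtain ⟨M, hM⟩ := (isCompact_uIcc (a := (0 : ℝ)) (b := 2 * Real.pi)).exists_bound_of_continuousOn
    hG.continuousOn
  have hb : ∀ φ : ℕ → ℝ → ℝ, (∀ k b, |φ k b| ≤ 1) → PolyBdd fun k =>
      1 / Real.pi * ∫ b in (0 : ℝ)..2 * Real.pi, φ k b * G b := by
    intro φ hφ
    refine polyBdd_of_abs_le (M := 1 / Real.pi * (M * |2 * Real.pi - 0|)) fun k => ?_
    rw [abs_mul, abs_of_pos (by positivity : 0 < 1 / Real.pi)]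
    refine mul_le_mul_of_nonneg_left ?_ (by positivity)
    rw [← Real.norm_eq_abs]
    refine intervalIntegral.norm_integral_le_of_norm_le_const fun b hb => ?_
    rw [norm_mul]
    exact (mul_le_of_le_one_left (norm_nonneg _) (hφ k b)).trans
      (hM b (Set.uIoc_subset_uIcc hb))
  refine ((isHeatSol_const (1 / (2 * Real.pi) * (∫ b in (0 : ℝ)..2 * Real.pi, G b))).add
    (isHeatSol_heatSeries (hb (fun k b => Real.cos (((k : ℝ) + 1) * b))
      fun k b => Real.abs_cos_le_one _) (hb (fun k b => Real.sin (((k : ℝ) + 1) * b))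
      fun k b => Real.abs_sin_le_one _))).of_eq fun t ht => ?_
  ext a
  exact circOp_eq_heatSeries ht hG a

theorem integral_cos_nat_mul (n : ℕ) (hn : n ≠ 0) :
    ∫ b in (0 : ℝ)..2 * Real.pi, Real.cos ((n : ℝ) * b) = 0 := by
  have hn' : (n : ℝ) ≠ 0 := by exact_mod_cast hn
  have h0 : Real.sin ((n : ℝ) * (2 * Real.pi)) = 0 := by
    have := Real.sin_nat_mul_pi (2 * n)
    rw [← this]; congr 1; push_cast; ring
  rw [intervalIntegral.integral_comp_mul_left _ hn', integral_cos, h0]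
  simp

theorem integral_cos_nat_mul_cos (n : ℕ) :
    ∫ b in (0 : ℝ)..2 * Real.pi, Real.cos (((n : ℝ) + 1) * b) * Real.cos b =
      if n = 0 then Real.pi else 0 := by
  have : ∀ b, Real.cos (((n : ℝ) + 1) * b) * Real.cos b =
      1 / 2 * Real.cos (((n + 2 : ℕ) : ℝ) * b) + 1 / 2 * Real.cos ((n : ℝ) * b) := by
    intro b
    have e1 : ((n + 2 : ℕ) : ℝ) * b = ((n : ℝ) + 1) * b + b := by push_cast; ring
    have e2 : (n : ℝ) * b = ((n : ℝ) + 1) * b - b := by ring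
    rw [e1, e2, Real.cos_add, Real.cos_sub]; ring
  simp only [this]
  rw [intervalIntegral.integral_add (Continuous.intervalIntegrable (by fun_prop) _ _)
    (Continuous.intervalIntegrable (by fun_prop) _ _), intervalIntegral.integral_const_mul,
    intervalIntegral.integral_const_mul, integral_cos_nat_mul (n + 2) (by omega)]
  split_ifs with h
  · subst h; simp
  · rw [integral_cos_nat_mul n h]; simp

theorem integral_theta {t : ℝ} (ht : 0 < t) : ∫ b in (0 : ℝ)..2 * Real.pi, theta t b = 1 := by
  have h := circOp_eq_heatSeries ht (G := fun _ => 1) continuous_const 0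
  simp only [circOp, sub_zero, mul_one] at h
  have h0 : ∀ k : ℕ, ∫ b in (0 : ℝ)..2 * Real.pi, Real.cos (((k : ℝ) + 1) * b) = 0 := fun k => by
    exact_mod_cast integral_cos_nat_mul (k + 1) (by omega)
  rw [h, heatSeries]
  simp [h0]
  field_simp

theorem integral_theta_mul_cos {t : ℝ} (ht : 0 < t) :
    ∫ b in (0 : ℝ)..2 * Real.pi, theta t b * Real.cos b = Real.exp (-t) := by
  have h := circOp_eq_heatSeries ht Real.continuous_cos 0
  simp only [circOp, sub_zero] at h
  rw [h, heatSeries, tsum_eq_single 0]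
  · have := integral_cos_nat_mul 1 one_ne_zero
    have h1 := integral_cos_nat_mul_cos 0
    simp only [Nat.cast_zero, Nat.cast_one, zero_add, one_mul, if_true] at this h1
    simp [this, h1]
  · intro k hk
    rw [integral_cos_nat_mul_cos, if_neg hk]; simp

theorem circOp_eq_shift (t : ℝ) {G : ℝ → ℝ} (hper : Function.Periodic G (2 * Real.pi)) (a : ℝ) :
    circOp t G a = ∫ b in (0 : ℝ)..2 * Real.pi, theta t b * G (b + a) := by
  have hp : Function.Periodic (fun b => theta t b * G (b + a)) (2 * Real.pi) := by
    intro b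
    have : b + 2 * Real.pi + a = b + a + 2 * Real.pi := by ring
    simp only [this, theta_periodic t b, hper (b + a)]
  have h1 := hp.intervalIntegral_add_eq (-a) 0
  have h2 := intervalIntegral.integral_comp_sub_right (a := 0) (b := 2 * Real.pi)
    (fun b => theta t b * G (b + a)) a
  simp only [sub_add_cancel] at h2
  rw [circOp, h2]
  rw [zero_add] at h1
  rw [← h1]; congr 1 <;> ring

theorem circOp_const {t : ℝ} (ht : 0 < t) (c a : ℝ) : circOp t (fun _ => c) a = c := by
  rw [circOp_eq_shift t (fun _ => rfl), intervalIntegral.integral_mul_const, integral_theta ht,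
    one_mul]

/-- A bound in terms of the test functions `1` and `cos`, on which the semigroup is explicit. -/
theorem abs_circOp_sub_le {t : ℝ} (ht : 0 < t) {G : ℝ → ℝ} (hG : Continuous G)
    (hper : Function.Periodic G (2 * Real.pi)) {ε M a : ℝ}
    (h : ∀ b, |G (b + a) - G a| ≤ ε + M * (1 - Real.cos b)) :
    |circOp t G a - G a| ≤ ε + M * (1 - Real.exp (-t)) := by
  have hθ := continuous_theta ht
  have e1 : circOp t G a - G a =
      ∫ b in (0 : ℝ)..2 * Real.pi, theta t b * (G (b + a) - G a) := by
    simp only [mul_sub]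
    rw [intervalIntegral.integral_sub, intervalIntegral.integral_mul_const, integral_theta ht,
      circOp_eq_shift t hper, one_mul]
    · exact (Continuous.intervalIntegrable (by fun_prop) _ _)
    · exact (Continuous.intervalIntegrable (by fun_prop) _ _)
  have e2 : ε + M * (1 - Real.exp (-t)) =
      ∫ b in (0 : ℝ)..2 * Real.pi, theta t b * (ε + M * (1 - Real.cos b)) := by
    have : ∀ b, theta t b * (ε + M * (1 - Real.cos b)) =
        theta t b * (ε + M) - M * (theta t b * Real.cos b) := fun b => by ring
    simp only [this]
    rw [intervalIntegral.integral_sub, intervalIntegral.integral_mul_const, integral_theta ht,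
      intervalIntegral.integral_const_mul, integral_theta_mul_cos ht]
    · ring
    · exact (Continuous.intervalIntegrable (by fun_prop) _ _)
    · exact (Continuous.intervalIntegrable (by fun_prop) _ _)
  rw [e1, e2, ← Real.norm_eq_abs]
  refine intervalIntegral.norm_integral_le_of_norm_le (by positivity) ?_
    (Continuous.intervalIntegrable (by fun_prop) _ _)
  refine Eventually.of_forall fun b _ => ?_
  rw [norm_mul, Real.norm_of_nonneg (theta_nonneg ht b)]
  exact mul_le_mul_of_nonneg_left (h b) (theta_nonneg ht b)

/-- The modulus of continuity in Korovkin's argument: a continuous periodic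
function satisfies the hypothesis of `abs_circOp_sub_le` with an arbitrarily small `ε`. -/
theorem exists_modulus_one_sub_cos {G : ℝ → ℝ} (hG : Continuous G)
    (hper : Function.Periodic G (2 * Real.pi)) {ε : ℝ} (hε : 0 < ε) :
    ∃ M, 0 ≤ M ∧ ∀ a b, |G (b + a) - G a| ≤ ε + M * (1 - Real.cos b) := by
  have hpi := Real.pi_pos
  let S : Set (ℝ × ℝ) := Set.Icc 0 (2 * Real.pi) ×ˢ Set.Icc (-Real.pi) Real.pi
  have hS : IsCompact S := isCompact_Icc.prod isCompact_Icc
  let B : Set (ℝ × ℝ) := S ∩ {z | ε ≤ |G (z.2 + z.1) - G z.1|}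
  have hB : IsCompact B := hS.inter_right (isClosed_le continuous_const (by fun_prop))
  obtain ⟨D, hD⟩ := hS.exists_bound_of_continuousOn
    (f := fun z : ℝ × ℝ => G (z.2 + z.1) - G z.1) (Continuous.continuousOn (by fun_prop))
  have hmain : ∃ M, 0 ≤ M ∧ ∀ z ∈ S, |G (z.2 + z.1) - G z.1| ≤ ε + M * (1 - Real.cos z.2) := by
    rcases B.eq_empty_or_nonempty with h0 | h0
    · refine ⟨0, le_rfl, fun z hz => ?_⟩
      by_contra hcon
      have : z ∈ B := ⟨hz, by simp only [zero_mul, add_zero, not_le] at hcon; exact hcon.le⟩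
      simp [h0] at this
    · obtain ⟨z₀, hz₀, hmin⟩ := hB.exists_isMinOn h0
        (f := fun z : ℝ × ℝ => 1 - Real.cos z.2) (Continuous.continuousOn (by fun_prop))
      have hpos : 0 < 1 - Real.cos z₀.2 := by
        have h1 : z₀.2 ≠ 0 := by
          intro h
          have := hz₀.2
          simp only [Set.mem_ofPred_eq, h, zero_add, sub_self, abs_zero] at this
          linarith
        have h2 : Real.cos z₀.2 ≠ 1 := by
          intro h
          have h3 := hz₀.1.2
          exact h1 ((Real.cos_eq_one_iff_of_lt_of_lt (by linarith [h3.1]) (by linarith [h3.2])).1 h)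
        have := lt_of_le_of_ne (Real.cos_le_one z₀.2) h2
        linarith
      have hD0 : 0 ≤ D := (norm_nonneg _).trans (hD z₀ hz₀.1)
      refine ⟨D / (1 - Real.cos z₀.2), by positivity, fun z hz => ?_⟩
      by_cases hzB : z ∈ B
      · have h1 : 1 - Real.cos z₀.2 ≤ 1 - Real.cos z.2 := hmin hzB
        have h2 := hD z hz
        rw [Real.norm_eq_abs] at h2
        have h3 : D ≤ D / (1 - Real.cos z₀.2) * (1 - Real.cos z.2) := by
          rw [div_mul_eq_mul_div, le_div_iff₀ hpos]
          exact mul_le_mul_of_nonneg_left h1 hD0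
        linarith
      · have h1 : |G (z.2 + z.1) - G z.1| < ε := by
          by_contra hcon
          exact hzB ⟨hz, not_lt.1 hcon⟩
        have h2 : 0 ≤ D / (1 - Real.cos z₀.2) * (1 - Real.cos z.2) :=
          mul_nonneg (by positivity) (by linarith [Real.cos_le_one z.2])
        linarith
  obtain ⟨M, hM0, hM⟩ := hmain
  refine ⟨M, hM0, fun a b => ?_⟩
  have hper2 : Function.Periodic (fun x => |G (x + a) - G a| - (ε + M * (1 - Real.cos x)))
      (2 * Real.pi) := by
    intro x
    have : x + 2 * Real.pi + a = x + a + 2 * Real.pi := by ring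
    simp only [this, hper (x + a), Real.cos_periodic x]
  obtain ⟨b', hb', eb⟩ := hper2.exists_mem_Ico Real.two_pi_pos b (-Real.pi)
  have hper3 : Function.Periodic (fun x => G (b' + x) - G x) (2 * Real.pi) := by
    intro x
    have : b' + (x + 2 * Real.pi) = b' + x + 2 * Real.pi := by ring
    simp only [this, hper (b' + x), hper x]
  obtain ⟨a'', ha'', ea'⟩ := hper3.exists_mem_Ico₀ Real.two_pi_pos a
  have h := hM (a'', b') ⟨⟨ha''.1, ha''.2.le⟩, ⟨hb'.1, by linarith [hb'.2]⟩⟩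
  simp only at h ea' eb
  rw [← ea'] at h
  linarith

/-- Strong continuity of the heat semigroup of the circle. -/
theorem eventually_abs_circOp_sub_le {G : ℝ → ℝ} (hG : Continuous G)
    (hper : Function.Periodic G (2 * Real.pi)) {ε : ℝ} (hε : 0 < ε) :
    ∀ᶠ t in 𝓝[>] (0 : ℝ), ∀ a, |circOp t G a - G a| ≤ ε := by
  obtain ⟨M, hM0, hM⟩ := exists_modulus_one_sub_cos hG hper (half_pos hε)
  have hlim : Tendsto (fun t : ℝ => M * (1 - Real.exp (-t))) (𝓝[>] 0) (𝓝 0) := by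
    have : Continuous fun t : ℝ => M * (1 - Real.exp (-t)) := by fun_prop
    have h := this.tendsto 0
    simp only [neg_zero, Real.exp_zero, sub_self, mul_zero] at h
    exact h.mono_left nhdsWithin_le_nhds
  filter_upwards [hlim.eventually (gt_mem_nhds (half_pos hε)), self_mem_nhdsWithin] with t h1 h2 a
  have := abs_circOp_sub_le h2 hG hper (hM a)
  linarith


/-! ### Integral operators with continuous kernels on compact spaces -/

section Kernels

set_option linter.unusedSectionVars false

variable {X : Type} [TopologicalSpace X] [CompactSpace X] [SecondCountableTopology X]
  [MeasurableSpace X] [BorelSpace X] {μ : Measure X} [IsFiniteMeasure μ]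

theorem integrable_of_continuous {f : X → ℝ} (hf : Continuous f) : Integrable f μ :=
  hf.integrable_of_hasCompactSupport (HasCompactSupport.of_compactSpace f)

theorem continuous_kernel_section {p : ℝ → X → X → ℝ}
    (hp : ContinuousOn (fun z : ℝ × X × X => p z.1 z.2.1 z.2.2) (Set.Ioi 0 ×ˢ Set.univ))
    {t : ℝ} (ht : 0 < t) (x : X) : Continuous (p t x) :=
  hp.comp_continuous (f := fun y : X => (t, x, y)) (by fun_prop) fun _ => ⟨ht, trivial⟩

/-- For a kernel that is continuous for `t > 0`, the operators map bounded measurable functions to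
jointly continuous ones; in particular they are strong Feller. -/
theorem continuousOn_heatOp {p : ℝ → X → X → ℝ}
    (hp : ContinuousOn (fun z : ℝ × X × X => p z.1 z.2.1 z.2.2) (Set.Ioi 0 ×ˢ Set.univ))
    {f : X → ℝ} (hf : Measurable f) {C : ℝ} (hC : ∀ x, |f x| ≤ C) :
    ContinuousOn (fun z : ℝ × X => heatOp μ p z.1 f z.2) (Set.Ioi 0 ×ˢ Set.univ) := by
  rintro ⟨t, x⟩ ⟨ht, -⟩
  have ht : 0 < t := ht
  have hK : IsCompact (Set.Icc (t / 2) (2 * t) ×ˢ (Set.univ : Set (X × X))) :=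
    isCompact_Icc.prod isCompact_univ
  obtain ⟨D, hD⟩ := hK.exists_bound_of_continuousOn
    (hp.mono (Set.prod_mono (fun s hs => lt_of_lt_of_le (half_pos ht) hs.1) le_rfl))
  have hev : ∀ᶠ z : ℝ × X in 𝓝 (t, x), z.1 ∈ Set.Ioo (t / 2) (2 * t) :=
    continuous_fst.continuousAt.eventually
      (isOpen_Ioo.mem_nhds ⟨by simp; linarith, by simp; linarith⟩)
  refine ContinuousAt.continuousWithinAt ?_
  refine continuousAt_of_dominated (bound := fun _ => D * C) ?_ ?_ (integrable_const _) ?_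
  · filter_upwards [hev] with z hz
    exact ((continuous_kernel_section hp (lt_trans (half_pos ht) hz.1) z.2).measurable.mul
      hf).aestronglyMeasurable
  · filter_upwards [hev] with z hz
    refine Eventually.of_forall fun y => ?_
    rw [norm_mul]
    have h1 := hD (z.1, z.2, y) ⟨⟨hz.1.le, hz.2.le⟩, trivial⟩
    exact mul_le_mul h1 (hC y) (norm_nonneg _) ((norm_nonneg _).trans h1)
  · refine Eventually.of_forall fun y => ContinuousAt.mul ?_ continuousAt_const
    have h1 : ContinuousAt (fun z : ℝ × X × X => p z.1 z.2.1 z.2.2) (t, x, y) :=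
      hp.continuousAt ((isOpen_Ioi.prod isOpen_univ).mem_nhds ⟨ht, trivial⟩)
    have h2 : Continuous fun z : ℝ × X => (z.1, z.2, y) := by fun_prop
    exact ContinuousAt.comp (x := (t, x)) h1 h2.continuousAt

theorem exists_bound_of_continuous {f : X → ℝ} (hf : Continuous f) : ∃ C, ∀ x, |f x| ≤ C := by
  obtain ⟨C, hC⟩ := isCompact_univ.exists_bound_of_continuousOn hf.continuousOn
  exact ⟨C, fun x => hC x trivial⟩

theorem continuousOn_heatOp_of_continuous {p : ℝ → X → X → ℝ}
    (hp : ContinuousOn (fun z : ℝ × X × X => p z.1 z.2.1 z.2.2) (Set.Ioi 0 ×ˢ Set.univ))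
    {f : X → ℝ} (hf : Continuous f) :
    ContinuousOn (fun z : ℝ × X => heatOp μ p z.1 f z.2) (Set.Ioi 0 ×ˢ Set.univ) := by
  obtain ⟨C, hC⟩ := exists_bound_of_continuous hf
  exact continuousOn_heatOp hp hf.measurable hC

theorem continuous_heatOp {p : ℝ → X → X → ℝ}
    (hp : ContinuousOn (fun z : ℝ × X × X => p z.1 z.2.1 z.2.2) (Set.Ioi 0 ×ˢ Set.univ))
    {t : ℝ} (ht : 0 < t) {f : X → ℝ} (hf : Measurable f) {C : ℝ} (hC : ∀ x, |f x| ≤ C) :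
    Continuous (heatOp μ p t f) :=
  (continuousOn_heatOp (μ := μ) hp hf hC).comp_continuous (f := fun x : X => (t, x)) (by fun_prop)
    fun _ => ⟨ht, trivial⟩

theorem continuous_heatOp_of_continuous {p : ℝ → X → X → ℝ}
    (hp : ContinuousOn (fun z : ℝ × X × X => p z.1 z.2.1 z.2.2) (Set.Ioi 0 ×ˢ Set.univ))
    {t : ℝ} (ht : 0 < t) {f : X → ℝ} (hf : Continuous f) : Continuous (heatOp μ p t f) := by
  obtain ⟨C, hC⟩ := exists_bound_of_continuous hf
  exact continuous_heatOp hp ht hf.measurable hC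

theorem heatOp_sub {p : ℝ → X → X → ℝ}
    (hp : ContinuousOn (fun z : ℝ × X × X => p z.1 z.2.1 z.2.2) (Set.Ioi 0 ×ˢ Set.univ))
    {t : ℝ} (ht : 0 < t) {f g : X → ℝ} (hf : Continuous f) (hg : Continuous g) (x : X) :
    heatOp μ p t (fun y => f y - g y) x = heatOp μ p t f x - heatOp μ p t g x := by
  have hc := continuous_kernel_section hp ht x
  simp only [heatOp, mul_sub]
  exact integral_sub (integrable_of_continuous (hc.mul hf)) (integrable_of_continuous (hc.mul hg))

/-- A continuous function that is nonnegative against all continuous nonnegative functions is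
nonnegative. -/
theorem nonneg_of_integral_mul_nonneg [μ.IsOpenPosMeasure] {q : X → ℝ} (hq : Continuous q)
    (h : ∀ f : X → ℝ, Continuous f → (∀ y, 0 ≤ f y) → 0 ≤ ∫ y, q y * f y ∂μ) (y : X) :
    0 ≤ q y := by
  -- Test against the negative part of `q`.
  have hn : Continuous fun y => max (-q y) 0 := by fun_prop
  have h1 := h _ hn fun y => le_max_right _ _
  have e : ∀ y, q y * max (-q y) 0 = -(max (-q y) 0 * max (-q y) 0) := by
    intro y
    rcases le_total (-q y) 0 with h | h
    · simp [max_eq_right h]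
    · rw [max_eq_left h]; ring
  simp only [e, integral_neg] at h1
  have h2 : ∫ y, max (-q y) 0 * max (-q y) 0 ∂μ = 0 :=
    le_antisymm (by linarith) (integral_nonneg fun y => mul_self_nonneg _)
  rw [integral_eq_zero_iff_of_nonneg (fun y => mul_self_nonneg _)
    (integrable_of_continuous (hn.mul hn))] at h2
  have h3 := congrFun (((hn.mul hn).ae_eq_iff_eq μ continuous_const).1 h2) y
  have h4 : max (-q y) 0 = 0 := mul_self_eq_zero.1 h3
  have := le_max_left (-q y) 0
  linarith

theorem eq_of_integral_mul_eq [μ.IsOpenPosMeasure] {p q : X → ℝ} (hp : Continuous p)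
    (hq : Continuous q)
    (h : ∀ f : X → ℝ, Continuous f → ∫ y, p y * f y ∂μ = ∫ y, q y * f y ∂μ) (y : X) :
    p y = q y := by
  have hz : ∀ f : X → ℝ, Continuous f → ∫ y, (p y - q y) * f y ∂μ = 0 := by
    intro f hf
    simp only [sub_mul]
    have := integral_sub (μ := μ) (integrable_of_continuous (hp.mul hf))
      (integrable_of_continuous (hq.mul hf))
    simp only [Pi.mul_apply] at this
    rw [this, h f hf, sub_self]
  have h1 := nonneg_of_integral_mul_nonneg (μ := μ) (hp.sub hq) (fun f hf _ => (hz f hf).ge) y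
  have h2 := nonneg_of_integral_mul_nonneg (μ := μ) (hp.sub hq).neg (fun f hf _ => by
    have := hz f hf
    simp only [Pi.neg_apply, Pi.sub_apply, neg_mul, integral_neg, this, neg_zero, le_refl]) y
  simp only [Pi.neg_apply, Pi.sub_apply] at h1 h2
  linarith

/-- Conservative nonnegative kernels are contractions in the supremum norm. -/
theorem abs_heatOp_sub_le {p : ℝ → X → X → ℝ}
    (hp : ContinuousOn (fun z : ℝ × X × X => p z.1 z.2.1 z.2.2) (Set.Ioi 0 ×ˢ Set.univ))
    {t : ℝ} (ht : 0 < t) {x : X} (h0 : ∀ y, 0 ≤ p t x y) (h1 : ∫ y, p t x y ∂μ = 1)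
    {f g : X → ℝ} (hf : Continuous f) (hg : Continuous g) {ε : ℝ} (h : ∀ y, |f y - g y| ≤ ε) :
    |heatOp μ p t f x - heatOp μ p t g x| ≤ ε := by
  have hc := continuous_kernel_section hp ht x
  rw [← heatOp_sub hp ht hf hg]
  have e : ε = ∫ y, p t x y * ε ∂μ := by rw [integral_mul_const, h1, one_mul]
  rw [e, ← Real.norm_eq_abs]
  refine norm_integral_le_of_norm_le (integrable_of_continuous (by fun_prop))
    (Eventually.of_forall fun y => ?_)
  rw [norm_mul, Real.norm_of_nonneg (h0 y)]
  exact mul_le_mul_of_nonneg_left (h y) (h0 y)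

end Kernels

namespace Params

variable (P : Params)

/-! ### The parameters -/

theorem J_zero : P.J 0 = 1 := by simp [J]

theorem N_zero : P.N 0 = 1 := by simp [N]

theorem J_succ (i : ℕ) : P.J (i + 1) = P.J i * P.j (i + 1) :=
  Finset.prod_Icc_succ_top (by omega) _

theorem N_succ (i : ℕ) : P.N (i + 1) = P.N i * P.n (i + 1) :=
  Finset.prod_Icc_succ_top (by omega) _

theorem two_pow_le_J (i : ℕ) : 2 ^ i ≤ P.J i := by
  induction i with
  | zero => simp [J_zero]
  | succ i ih =>
    rw [J_succ, pow_succ]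
    exact Nat.mul_le_mul ih (P.two_le_j _ (by omega))

theorem J_pos (i : ℕ) : 0 < P.J i := lt_of_lt_of_le (by positivity) (P.two_pow_le_J i)

theorem N_pos (i : ℕ) : 0 < P.N i := by
  induction i with
  | zero => simp [N_zero]
  | succ i ih =>
    rw [N_succ]
    exact Nat.mul_pos ih (lt_of_lt_of_le (by omega) (P.two_le_n (i + 1) (by omega)))

theorem J_pos' (i : ℕ) : (0 : ℝ) < P.J i := by exact_mod_cast P.J_pos i

theorem N_pos' (i : ℕ) : (0 : ℝ) < P.N i := by exact_mod_cast P.N_pos i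

theorem n_pos' (i : ℕ) : (0 : ℝ) < P.n (i + 1) := by
  have := P.two_le_n (i + 1) (by omega)
  exact_mod_cast (by omega : 0 < P.n (i + 1))

theorem L_pos (i : ℕ) : 0 < P.L i := by
  cases i with
  | zero => exact Real.two_pi_pos
  | succ i => exact div_pos Real.pi_pos (P.J_pos' _)

theorem arcs_pos (i : ℕ) : 0 < P.arcs i := by
  cases i with
  | zero => exact one_pos
  | succ i => exact Nat.mul_pos two_pos (P.J_pos _)

instance neZero_arcs (i : ℕ) : NeZero (P.arcs i) := ⟨(P.arcs_pos i).ne'⟩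

theorem arcs_mul_L (i : ℕ) : (P.arcs i : ℝ) * P.L i = 2 * Real.pi := by
  cases i with
  | zero => simp [arcs, L]
  | succ i =>
    have := (P.J_pos' (i + 1)).ne'
    simp only [arcs, L]; push_cast; field_simp

theorem J_mul_L (i : ℕ) : (P.J (i + 1) : ℝ) * P.L (i + 1) = Real.pi := by
  have := (P.J_pos' (i + 1)).ne'
  simp only [L]; field_simp

theorem grid_mono {k l : ℕ} (h : k ≤ l) : P.grid k ⊆ P.grid l := by
  induction l, h using Nat.le_induction with
  | base => exact le_rfl
  | succ l _ ih =>
    refine ih.trans ?_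
    rintro _ ⟨m, rfl⟩
    refine ⟨m * P.j (l + 1), ?_⟩
    have h1 := (P.J_pos' l).ne'
    have h2 : (P.j (l + 1) : ℝ) ≠ 0 := by
      have := P.two_le_j (l + 1) (by omega)
      exact_mod_cast (by omega : P.j (l + 1) ≠ 0)
    simp only [J_succ]
    push_cast
    congr 1
    field_simp

/-- The function `η ↦ sin (J_l η)` on the circle; its zeros are the angles in `grid l`. -/
def gridSin (l : ℕ) (η : Circ) : ℝ := Real.Angle.sin (P.J l • (η : Real.Angle))

theorem gridSin_coe (l : ℕ) (a : ℝ) : P.gridSin l (a : Circ) = Real.sin (P.J l * a) := by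
  have : P.J l • ((a : Circ) : Real.Angle) = ((P.J l * a : ℝ) : Real.Angle) :=
    (Real.Angle.natCast_mul_eq_nsmul a (P.J l)).symm
  rw [gridSin, this, Real.Angle.sin_coe]

theorem continuous_gridSin (l : ℕ) : Continuous (P.gridSin l) :=
  Real.Angle.continuous_sin.comp (continuous_nsmul (M := Circ) (P.J l))

theorem gridSin_eq_zero_iff (l : ℕ) (η : Circ) : P.gridSin l η = 0 ↔ η ∈ P.grid l := by
  have hJ := (P.J_pos' l).ne'
  constructor
  · induction η using QuotientAddGroup.induction_on with
    | H a =>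
      intro h
      rw [show ((QuotientAddGroup.mk a : Circ)) = (a : Circ) from rfl, gridSin_coe,
        Real.sin_eq_zero_iff] at h
      obtain ⟨k, hk⟩ := h
      refine ⟨k, congrArg (fun x : ℝ => (x : Circ)) ?_⟩
      field_simp
      linarith
  · rintro ⟨k, rfl⟩
    rw [gridSin_coe, Real.sin_eq_zero_iff]
    exact ⟨k, by field_simp⟩

theorem coe_mem_grid_iff (l : ℕ) (a : ℝ) :
    (a : Circ) ∈ P.grid l ↔ ∃ k : ℤ, k * Real.pi = P.J l * a := by
  rw [← gridSin_eq_zero_iff, gridSin_coe, Real.sin_eq_zero_iff]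

end Params
namespace Params

variable {P : Params}

/-! ### Topology of the levels and of the limit space -/

theorem continuous_ofFiniteWord {i : ℕ} :
    Continuous (ofFiniteWord : Circ × P.Word i → P.Level i) :=
  continuous_quotient_mk'

theorem ofFiniteWord_surjective {i : ℕ} :
    Function.Surjective (ofFiniteWord : Circ × P.Word i → P.Level i) :=
  Quotient.mk_surjective

@[simp]
theorem angle_ofFiniteWord {i : ℕ} (p : Circ × P.Word i) : angle (ofFiniteWord p) = p.1 := rfl

theorem ofFiniteWord_eq_iff {i : ℕ} {p q : Circ × P.Word i} :
    ofFiniteWord p = ofFiniteWord q ↔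
      p.1 = q.1 ∧ ∀ l : Fin i, p.1 ∉ P.grid ((l : ℕ) + 1) → p.2 l = q.2 l :=
  ⟨fun h => Quotient.exact h, fun h => Quotient.sound h⟩

theorem continuous_proj {k i : ℕ} (h : k ≤ i) :
    Continuous (proj h : P.Level i → P.Level k) := by
  refine Continuous.quotient_lift (continuous_ofFiniteWord.comp ?_) _
  fun_prop

instance (i : ℕ) : CompactSpace (P.Level i) :=
  inferInstanceAs (CompactSpace (Quotient (P.levelSetoid i)))

/-- An injective continuous map from `F_i` to a metrizable space: a point with word `η w_1 … w_i`
is mapped to the angle `η` and, for each letter, the vector `sin (J_l η)` times the `w_l`-th unit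
vector. -/
def separate {i : ℕ} (x : P.Level i) : Circ × (∀ l : Fin i, Fin (P.n ((l : ℕ) + 1)) → ℝ) :=
  Quotient.lift (s := P.levelSetoid i)
    (fun p : Circ × P.Word i =>
      (p.1, fun l c => (if p.2 l = c then 1 else 0) * P.gridSin ((l : ℕ) + 1) p.1))
    (by
      rintro ⟨η, w⟩ ⟨η', w'⟩ ⟨h1, h2⟩
      simp only at h1 h2
      subst h1
      refine Prod.ext rfl ?_
      funext l c
      by_cases h : η ∈ P.grid ((l : ℕ) + 1)
      · simp [(P.gridSin_eq_zero_iff _ _).2 h]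
      · simp [h2 l h]) x

theorem continuous_separate {i : ℕ} : Continuous (separate : P.Level i → _) := by
  refine Continuous.quotient_lift ?_ _
  refine continuous_fst.prodMk (continuous_pi fun l => continuous_pi fun c => ?_)
  refine Continuous.mul ?_ ((P.continuous_gridSin _).comp continuous_fst)
  have : Continuous fun d : Fin (P.n ((l : ℕ) + 1)) => if d = c then (1 : ℝ) else 0 :=
    continuous_of_discreteTopology
  exact this.comp (by fun_prop)

theorem separate_injective {i : ℕ} : Function.Injective (separate : P.Level i → _) := by
  intro x y h
  obtain ⟨⟨η, w⟩, rfl⟩ := ofFiniteWord_surjective x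
  obtain ⟨⟨ζ, v⟩, rfl⟩ := ofFiniteWord_surjective y
  have h1 : η = ζ := congrArg Prod.fst h
  subst h1
  refine ofFiniteWord_eq_iff.2 ⟨rfl, fun l hl => ?_⟩
  have h2 := congrFun (congrFun (congrArg Prod.snd h) l) (w l)
  simp only [separate, ofFiniteWord, Quotient.lift_mk] at h2
  by_contra hne
  rw [if_pos trivial, if_neg (fun h => hne h.symm), zero_mul, one_mul,
    P.gridSin_eq_zero_iff] at h2
  exact hl h2

instance (i : ℕ) : T2Space (P.Level i) :=
  T2Space.of_injective_continuous separate_injective continuous_separate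

instance (i : ℕ) : SecondCountableTopology (P.Level i) :=
  (continuous_separate.isClosedEmbedding separate_injective).isEmbedding.secondCountableTopology

theorem continuous_toLevel (i : ℕ) : Continuous (toLevel i : P.Limit → P.Level i) :=
  (continuous_apply i).comp continuous_subtype_val

instance : SecondCountableTopology P.Limit :=
  Topology.IsEmbedding.secondCountableTopology (β := ∀ i, P.Level i)
    (f := fun x : P.Limit => x.1) Topology.IsEmbedding.subtypeVal

instance : CompactSpace P.Limit := by
  have : IsClosed {x : ∀ i, P.Level i | ∀ (k i : ℕ) (h : k ≤ i), proj h (x i) = x k} := by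
    simp only [Set.ofPred_forall]
    refine isClosed_iInter fun k => isClosed_iInter fun i => isClosed_iInter fun h => ?_
    exact isClosed_eq ((continuous_proj h).comp (continuous_apply i)) (continuous_apply k)
  exact isCompact_iff_compactSpace.1 this.isCompact

theorem proj_toLevel {k i : ℕ} (h : k ≤ i) (x : P.Limit) :
    proj h (toLevel i x) = toLevel k x := x.2 k i h

theorem proj_proj {k j i : ℕ} (h : k ≤ j) (h' : j ≤ i) (x : P.Level i) :
    proj h (proj h' x) = proj (h.trans h') x := by
  obtain ⟨p, rfl⟩ := ofFiniteWord_surjective x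
  rfl

theorem angle_proj {k i : ℕ} (h : k ≤ i) (x : P.Level i) : angle (proj h x) = angle x := by
  obtain ⟨p, rfl⟩ := ofFiniteWord_surjective x
  rfl

theorem continuous_ofWord : Continuous P.ofWord := by
  refine Continuous.subtype_mk (continuous_pi fun i => continuous_ofFiniteWord.comp ?_) _
  fun_prop

theorem ofWord_surjective : Function.Surjective P.ofWord := by
  intro x
  choose q hq using fun i => ofFiniteWord_surjective (toLevel i x)
  have hη : ∀ i, (q i).1 = angle (toLevel 0 x) := fun i => by
    rw [← proj_toLevel (Nat.zero_le i) x, angle_proj, ← hq i, angle_ofFiniteWord]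
  refine ⟨(angle (toLevel 0 x), fun l => (q (l + 1)).2 (Fin.last l)), ?_⟩
  refine Subtype.ext (funext fun i => ?_)
  change ofFiniteWord _ = toLevel i x
  rw [← hq i]
  refine ofFiniteWord_eq_iff.2 ⟨(hη i).symm, fun l hl => ?_⟩
  have h1 := proj_toLevel (P := P) (k := (l : ℕ) + 1) l.2 x
  rw [← hq i, ← hq ((l : ℕ) + 1)] at h1
  have h2 := (ofFiniteWord_eq_iff.1 h1.symm).2 (Fin.last l)
  exact h2 (by simpa [hη] using hl)

/-! ### The measures -/

variable (P)

theorem sum_restrict_Ioc (L : ℝ) (hL : 0 < L) (k : ℕ) :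
    ∑ m ∈ Finset.range k, (volume : Measure ℝ).restrict (Set.Ioc (m * L) ((m + 1) * L)) =
      volume.restrict (Set.Ioc 0 (k * L)) := by
  induction k with
  | zero => simp
  | succ k ih =>
    have h0 : (0 : ℝ) ≤ k * L := by positivity
    have h1 : (k : ℝ) * L ≤ (k + 1) * L := by nlinarith
    rw [Finset.sum_range_succ, ih, ← Measure.restrict_union
      (Set.Ioc_disjoint_Ioc_of_le le_rfl) measurableSet_Ioc, Set.Ioc_union_Ioc_eq_Ioc h0 h1]
    push_cast; rfl

/-- The arcs of a level tile the circle. -/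
theorem sum_map_arcs (i : ℕ) :
    ∑ m : Fin (P.arcs i), ((volume : Measure ℝ).restrict (Set.Icc 0 (P.L i))).map
      (fun θ : ℝ => (((m : ℕ) * P.L i + θ : ℝ) : Circ)) = volume := by
  have hmk : Measurable (fun a : ℝ => (a : Circ)) := (AddCircle.continuous_mk' _).measurable
  have h1 : ∀ m : ℕ, ((volume : Measure ℝ).restrict (Set.Icc 0 (P.L i))).map
      (fun θ : ℝ => ((m * P.L i + θ : ℝ) : Circ)) =
      (volume.restrict (Set.Ioc (m * P.L i) ((m + 1) * P.L i))).map (fun a : ℝ => (a : Circ)) := by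
    intro m
    rw [← restrict_Ioc_eq_restrict_Icc]
    have e := (measurePreserving_add_left (volume : Measure ℝ) (m * P.L i)).restrict_preimage
      (s := Set.Ioc (m * P.L i) ((m + 1) * P.L i)) measurableSet_Ioc
    have e2 : (fun θ => m * P.L i + θ) ⁻¹' Set.Ioc (m * P.L i) ((m + 1) * P.L i) =
        Set.Ioc 0 (P.L i) := by
      ext θ; simp only [Set.mem_preimage, Set.mem_Ioc]
      constructor <;> rintro ⟨h, h'⟩ <;> constructor <;> linarith
    rw [e2] at e
    rw [← e.map_eq, Measure.map_map hmk e.measurable]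
    rfl
  simp only [h1]
  rw [Fin.sum_univ_eq_sum_range (fun m : ℕ =>
      (volume.restrict (Set.Ioc (m * P.L i) ((m + 1) * P.L i))).map (fun a : ℝ => (a : Circ))),
    ← Measure.map_finset_sum hmk.aemeasurable,
    sum_restrict_Ioc (P.L i) (P.L_pos i), P.arcs_mul_L]
  have := (AddCircle.measurePreserving_mk (2 * Real.pi) 0).map_eq
  rwa [zero_add] at this

/-- The measure on `F_i` is the image of arc length on the circle times the uniform distribution
of the words. -/
theorem levelMeasure_eq (i : ℕ) : P.levelMeasure i = ((P.N i : ENNReal))⁻¹ •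
    ∑ w : P.Word i, (volume : Measure Circ).map fun ζ => ofFiniteWord (ζ, w) := by
  rw [levelMeasure, Fintype.sum_prod_type_right]
  congr 1
  refine Finset.sum_congr rfl fun w _ => ?_
  have hc : Continuous fun ζ : Circ => (ofFiniteWord (ζ, w) : P.Level i) :=
    continuous_ofFiniteWord.comp (by fun_prop)
  conv_rhs => rw [← P.sum_map_arcs i]
  rw [Measure.map_finset_sum hc.measurable.aemeasurable]
  refine Finset.sum_congr rfl fun m _ => ?_
  have hs : Continuous fun θ : ℝ => (((m : ℕ) * P.L i + θ : ℝ) : Circ) :=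
    (AddCircle.continuous_mk' _).comp (by fun_prop : Continuous fun θ : ℝ => (m : ℕ) * P.L i + θ)
  rw [Measure.map_map hc.measurable hs.measurable]
  rfl

theorem integral_levelMeasure (i : ℕ) {f : P.Level i → ℝ} (hf : Continuous f) :
    ∫ x, f x ∂P.levelMeasure i =
      (P.N i : ℝ)⁻¹ * ∑ w : P.Word i, ∫ ζ : Circ, f (ofFiniteWord (ζ, w)) := by
  have hc : ∀ w, Continuous fun ζ : Circ => (ofFiniteWord (ζ, w) : P.Level i) := fun w =>
    continuous_ofFiniteWord.comp (by fun_prop)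
  rw [levelMeasure_eq, integral_smul_measure, integral_finsetSum_measure]
  · simp only [ENNReal.toReal_inv, ENNReal.toReal_natCast, smul_eq_mul]
    congr 1
    refine Finset.sum_congr rfl fun w _ => ?_
    exact integral_map (hc w).measurable.aemeasurable hf.aestronglyMeasurable
  · intro w _
    exact integrable_of_continuous hf

instance (i : ℕ) : IsFiniteMeasure (P.levelMeasure i) := by
  rw [levelMeasure_eq]
  refine Measure.smul_finite _ ?_
  simpa using (P.N_pos i).ne'

instance (i : ℕ) : (P.levelMeasure i).IsOpenPosMeasure := by
  refine ⟨fun U hU hne h0 => ?_⟩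
  obtain ⟨x, hx⟩ := hne
  obtain ⟨⟨η, w⟩, rfl⟩ := ofFiniteWord_surjective x
  have hc : Continuous fun ζ : Circ => (ofFiniteWord (ζ, w) : P.Level i) :=
    continuous_ofFiniteWord.comp (by fun_prop)
  rw [levelMeasure_eq, Measure.smul_apply, smul_eq_mul, mul_eq_zero, Measure.finsetSum_apply,
    Finset.sum_eq_zero_iff] at h0
  rcases h0 with h0 | h0
  · simp at h0
  · have h1 := h0 w (Finset.mem_univ _)
    rw [Measure.map_apply hc.measurable hU.measurableSet] at h1
    exact ((hU.preimage hc).measure_pos volume ⟨η, hx⟩).ne' h1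

instance (l : ℕ) : IsProbabilityMeasure
    ((PMF.uniformOfFintype (Fin (P.n (l + 1)))).toMeasure) :=
  PMF.toMeasure.isProbabilityMeasure _

/-- The first `i` letters of a uniformly distributed infinite word are uniformly distributed. -/
theorem map_infinitePi_restrict (i : ℕ) :
    (Measure.infinitePi fun l : ℕ =>
      (PMF.uniformOfFintype (Fin (P.n (l + 1)))).toMeasure).map
      (fun v (l : Fin i) => v (l : ℕ)) =
    (P.N i : ENNReal)⁻¹ • Measure.sum fun w : P.Word i => Measure.dirac w := by
  have hm : Measurable fun (v : ∀ l : ℕ, Fin (P.n (l + 1))) (l : Fin i) => v (l : ℕ) :=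
    measurable_pi_lambda _ fun l => measurable_pi_apply _
  refine Measure.ext_of_singleton fun w => ?_
  rw [Measure.map_apply hm (measurableSet_singleton w)]
  have e : (fun (v : ∀ l : ℕ, Fin (P.n (l + 1))) (l : Fin i) => v (l : ℕ)) ⁻¹' {w} =
      (↑(Finset.range i) : Set ℕ).pi fun l => (if h : l < i then {w ⟨l, h⟩} else Set.univ :
        Set (Fin (P.n (l + 1)))) := by
    ext v
    simp only [Set.mem_preimage, Set.mem_singleton_iff, Set.mem_pi, Finset.coe_range, Set.mem_Iio]
    constructor
    · rintro rfl l hl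
      simp [hl]
    · intro h
      funext l
      simpa using h l l.2
  rw [e, Measure.infinitePi_pi _ (fun l _ => by measurability)]
  have h1 : ∀ l ∈ Finset.range i, (PMF.uniformOfFintype (Fin (P.n (l + 1)))).toMeasure
      (if h : l < i then {w ⟨l, h⟩} else Set.univ : Set (Fin (P.n (l + 1)))) =
        (P.n (l + 1) : ENNReal)⁻¹ := by
    intro l hl
    rw [dif_pos (Finset.mem_range.1 hl),
      PMF.toMeasure_apply_singleton _ _ (measurableSet_singleton _)]
    simp
  rw [Finset.prod_congr rfl h1]
  have h2 : ∏ l ∈ Finset.range i, (P.n (l + 1) : ENNReal)⁻¹ = (P.N i : ENNReal)⁻¹ := by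
    clear h1 e hm w
    induction i with
    | zero => simp [N_zero]
    | succ i ih =>
      rw [Finset.prod_range_succ, ih, N_succ]
      push_cast
      rw [ENNReal.mul_inv] <;> simp
  rw [h2, Measure.smul_apply, Measure.sum_apply _ (measurableSet_singleton w)]
  simp [Set.indicator_apply]

theorem map_toLevel_limitMeasure (i : ℕ) :
    P.limitMeasure.map (toLevel i) = P.levelMeasure i := by
  have hm : Measurable fun (v : ∀ l : ℕ, Fin (P.n (l + 1))) (l : Fin i) => v (l : ℕ) :=
    measurable_pi_lambda _ fun l => measurable_pi_apply _
  have hmk : Measurable (ofFiniteWord : Circ × P.Word i → P.Level i) :=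
    continuous_ofFiniteWord.measurable
  rw [limitMeasure, Measure.map_map (continuous_toLevel i).measurable
    continuous_ofWord.measurable]
  have e : (toLevel i ∘ P.ofWord) =
      ofFiniteWord ∘ Prod.map id (fun v (l : Fin i) => v (l : ℕ)) := rfl
  rw [e, ← Measure.map_map hmk (measurable_id.prodMap hm),
    ← Measure.map_prod_map _ _ measurable_id hm, map_infinitePi_restrict, Measure.map_id,
    Measure.prod_smul_right, Measure.prod_sum_right, Measure.sum_fintype, Measure.map_smul,
    Measure.map_finset_sum hmk.aemeasurable, levelMeasure_eq]
  congr 1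
  refine Finset.sum_congr rfl fun w _ => ?_
  rw [Measure.prod_dirac, Measure.map_map hmk (by fun_prop)]
  rfl

theorem integral_limitMeasure_comp (i : ℕ) {f : P.Level i → ℝ} (hf : Continuous f) :
    ∫ x, f (toLevel i x) ∂P.limitMeasure = ∫ x, f x ∂P.levelMeasure i := by
  rw [← map_toLevel_limitMeasure,
    integral_map (continuous_toLevel i).measurable.aemeasurable hf.aestronglyMeasurable]

instance : IsFiniteMeasure P.limitMeasure := by
  rw [limitMeasure]; infer_instance

/-- Every open set of `F_∞` contains a nonempty cylinder set. -/
theorem exists_cylinder_subset {U : Set P.Limit} (hU : IsOpen U) {x : P.Limit} (hx : x ∈ U) :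
    ∃ (i : ℕ) (V : Set (P.Level i)), IsOpen V ∧ toLevel i x ∈ V ∧ toLevel i ⁻¹' V ⊆ U := by
  obtain ⟨W, hW, rfl⟩ := isOpen_induced_iff.1 hU
  obtain ⟨I, u, hu, hsub⟩ := isOpen_pi_iff.1 hW x.1 hx
  let m := I.sup id
  have hm : ∀ k ∈ I, k ≤ m := fun k hk => Finset.le_sup (f := id) hk
  refine ⟨m, {y | ∀ k (hk : k ∈ I), proj (hm k hk) y ∈ u k}, ?_, fun k hk => ?_, fun y hy => ?_⟩
  · have : {y : P.Level m | ∀ k (hk : k ∈ I), proj (hm k hk) y ∈ u k} =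
        ⋂ k : I, proj (hm k k.2) ⁻¹' u k := by
      ext y; simp
    rw [this]
    exact isOpen_iInter_of_finite fun k => (hu k k.2).1.preimage (continuous_proj _)
  · rw [proj_toLevel]; exact (hu k hk).2
  · refine hsub fun k hk => ?_
    have := hy k hk
    rw [proj_toLevel] at this
    exact this

instance : P.limitMeasure.IsOpenPosMeasure := by
  refine ⟨fun U hU hne h0 => ?_⟩
  obtain ⟨x, hx⟩ := hne
  obtain ⟨i, V, hV, hxV, hsub⟩ := P.exists_cylinder_subset hU hx
  have h1 : P.limitMeasure (toLevel i ⁻¹' V) = 0 := measure_mono_null hsub h0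
  rw [← Measure.map_apply (continuous_toLevel i).measurable hV.measurableSet,
    map_toLevel_limitMeasure] at h1
  exact (hV.measure_pos _ ⟨_, hxV⟩).ne' h1

end Params

/-! ### The maximum principle on the metric graphs -/

/-- The first-order condition at a minimum on an interval, endpoints included. -/
theorem mul_deriv_nonneg_of_isMinOn {g : ℝ → ℝ} {a b θ d : ℝ} (hθ : θ ∈ Set.Icc a b)
    (hmin : IsMinOn g (Set.Icc a b) θ) (hd : HasDerivWithinAt g d (Set.Icc a b) θ) {y : ℝ}
    (hy : y ∈ Set.Icc a b) : 0 ≤ (y - θ) * d := by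
  have h1 : y - θ ∈ posTangentConeAt (Set.Icc a b) θ := by
    refine mem_posTangentConeAt_of_segment_subset ?_
    rw [add_sub_cancel]
    exact (convex_Icc a b).segment_subset hθ hy
  simpa using (hmin.localize).hasFDerivWithinAt_nonneg hd.hasFDerivWithinAt h1

/-- The second-order condition at a minimum on an interval, valid at the endpoints if the first
derivative vanishes. -/
theorem iteratedDerivWithin_two_nonneg_of_isMinOn {g : ℝ → ℝ} {a b θ : ℝ} (hab : a < b)
    (hg : ContDiffOn ℝ 2 g (Set.Icc a b)) (hθ : θ ∈ Set.Icc a b)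
    (hmin : IsMinOn g (Set.Icc a b) θ) (hd : derivWithin g (Set.Icc a b) θ = 0) :
    0 ≤ iteratedDerivWithin 2 g (Set.Icc a b) θ := by
  by_contra! hneg
  set c := iteratedDerivWithin 2 g (Set.Icc a b) θ with hc
  have ht := taylor_isLittleO (n := 2) (convex_Icc a b) hθ (by exact_mod_cast hg)
  have hev := ht.def (c := -c / 4) (by linarith)
  have hacc : (𝓝[Set.Icc a b \ {θ}] θ).NeBot :=
    accPt_principal_iff_nhdsWithin.1 (uniqueDiffWithinAt_iff_accPt.1 (uniqueDiffOn_Icc hab θ hθ))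
  have hev2 := hev.filter_mono
    (nhdsWithin_mono θ (Set.sdiff_subset : Set.Icc a b \ {θ} ⊆ Set.Icc a b))
  obtain ⟨x, hx1, hx2⟩ := (hev2.and (self_mem_nhdsWithin)).exists
  have hgx : g θ ≤ g x := hmin hx2.1
  have hne : x - θ ≠ 0 := sub_ne_zero.2 hx2.2
  have hT : taylorWithinEval g 2 (Set.Icc a b) θ x = g θ + c / 2 * (x - θ) ^ 2 := by
    rw [taylorWithinEval_succ, taylorWithinEval_succ, taylor_within_zero_eval,
      iteratedDerivWithin_one, hd, ← hc]
    simp [Nat.factorial]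
    ring
  rw [hT, Real.norm_eq_abs, Real.norm_eq_abs, abs_of_nonneg (sq_nonneg (x - θ))] at hx1
  have h3 := (abs_le.1 hx1).2
  have h4 : 0 < (x - θ) ^ 2 := by positivity
  nlinarith

namespace Params

variable {P : Params}

theorem exists_cellMap_eq {i : ℕ} (x : P.Level i) :
    ∃ α : P.Cell i, ∃ θ ∈ Set.Icc 0 (P.L i), cellMap α θ = x := by
  obtain ⟨⟨η, w⟩, rfl⟩ := ofFiniteWord_surjective x
  obtain ⟨a, ha, rfl⟩ := AddCircle.eq_coe_Ico η
  have hL := P.L_pos i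
  have h0 : 0 ≤ a / P.L i := div_nonneg ha.1 hL.le
  have hm : ⌊a / P.L i⌋₊ < P.arcs i := by
    rw [Nat.floor_lt h0, div_lt_iff₀ hL, P.arcs_mul_L]
    exact ha.2
  have h1 := Nat.floor_le h0
  have h2 := Nat.lt_floor_add_one (a / P.L i)
  rw [le_div_iff₀ hL] at h1
  rw [div_lt_iff₀ hL] at h2
  refine ⟨(⟨_, hm⟩, w), a - ⌊a / P.L i⌋₊ * P.L i, ⟨by linarith, by linarith⟩, ?_⟩
  simp [cellMap]

/-- The (weak) maximum principle: a solution of the heat equation on `F_i` whose initial values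
are nonnegative is nonnegative. -/
theorem SolvesHeatEquation.nonneg {i : ℕ} {u : ℝ → P.Level i → ℝ}
    (hu : P.SolvesHeatEquation i u)
    (h0 : ∀ c, 0 < c → ∀ᶠ t in 𝓝[>] (0 : ℝ), ∀ x, -c ≤ u t x) {T : ℝ} (hT : 0 < T)
    (x₁ : P.Level i) : 0 ≤ u T x₁ := by
  classical
  by_contra! hneg
  set c := -u T x₁ / 3 with hc
  have hc0 : 0 < c := by linarith
  obtain ⟨t₀, ht₀, hpos, hlt⟩ : ∃ t₀, (∀ x, -c ≤ u t₀ x) ∧ 0 < t₀ ∧ t₀ < T :=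
    ((h0 c hc0).and (Ioo_mem_nhdsGT hT)).exists
  -- The perturbation `u + (c / T) t` still has a negative minimum, which lies after time `t₀`.
  have hcont : ContinuousOn (fun z : ℝ × P.Level i => u z.1 z.2 + c / T * z.1)
      (Set.Icc t₀ T ×ˢ Set.univ) :=
    (hu.continuousOn.mono (Set.prod_mono (fun s hs => lt_of_lt_of_le hpos hs.1) le_rfl)).add
      (Continuous.continuousOn (by fun_prop))
  obtain ⟨⟨s, x⟩, ⟨hs, -⟩, hmin⟩ := (isCompact_Icc.prod isCompact_univ).exists_isMinOn
    ⟨(T, x₁), ⟨hlt.le, le_rfl⟩, trivial⟩ hcont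
  simp only at hs
  have hmin' : ∀ s' ∈ Set.Icc t₀ T, ∀ y, u s x + c / T * s ≤ u s' y + c / T * s' :=
    fun s' hs' y => hmin (show (s', y) ∈ Set.Icc t₀ T ×ˢ Set.univ from ⟨hs', trivial⟩)
  have hval : u s x + c / T * s ≤ -2 * c := by
    have := hmin' T ⟨hlt.le, le_rfl⟩ x₁
    have e : c / T * T = c := by field_simp
    rw [e] at this
    linarith
  have hcT : 0 < c / T := by positivity
  have hs0 : t₀ < s := by
    rcases hs.1.lt_or_eq with h | h
    · exact h
    · subst h
      have := ht₀ x
      have : 0 < c / T * t₀ := by positivity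
      linarith
  have hsp : 0 < s := hpos.trans hs0
  have hspace : ∀ y, u s x ≤ u s y := fun y => by linarith [hmin' s hs y]
  -- Hence `∂²u/∂θ² = ∂ₜ u < 0` along every cell through the minimum,
  have hneg2 : ∀ (α : P.Cell i) (θ : ℝ), θ ∈ Set.Icc 0 (P.L i) → cellMap α θ = x →
      iteratedDerivWithin 2 (fun θ' => u s (cellMap α θ')) (Set.Icc 0 (P.L i)) θ < 0 := by
    intro α θ hθ hx
    have hd := hu.equation s hsp α θ hθ
    rw [hx] at hd
    have hl : HasDerivAt (fun s : ℝ => c / T * s) (c / T) s := by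
      simpa using (hasDerivAt_id s).const_mul (c / T)
    have := mul_deriv_nonneg_of_isMinOn (a := t₀) (b := s) ⟨hs0.le, le_rfl⟩
      (g := fun s' => u s' x + c / T * s')
      (fun s' hs' => hmin' s' ⟨hs'.1, hs'.2.trans hs.2⟩ x) (hd.add hl).hasDerivWithinAt
      (y := t₀) ⟨le_rfl, hs0.le⟩
    nlinarith
  have hminα : ∀ (α : P.Cell i) (θ : ℝ), θ ∈ Set.Icc 0 (P.L i) → cellMap α θ = x →
      IsMinOn (fun θ' => u s (cellMap α θ')) (Set.Icc 0 (P.L i)) θ := by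
    intro α θ hθ hx θ' _
    simp only [Set.mem_ofPred_eq, hx]
    exact hspace _
  have hdα : ∀ (α : P.Cell i) (θ : ℝ), θ ∈ Set.Icc 0 (P.L i) →
      HasDerivWithinAt (fun θ' => u s (cellMap α θ'))
        (derivWithin (fun θ' => u s (cellMap α θ')) (Set.Icc 0 (P.L i)) θ)
        (Set.Icc 0 (P.L i)) θ := fun α θ hθ =>
    (((hu.smooth s hsp α).differentiableOn two_ne_zero) θ hθ).hasDerivWithinAt
  have hL := P.L_pos i
  have hzero : (0 : ℝ) ∈ Set.Icc 0 (P.L i) := ⟨le_rfl, hL.le⟩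
  have hone : P.L i ∈ Set.Icc 0 (P.L i) := ⟨hL.le, le_rfl⟩
  -- so that the derivative along these cells cannot vanish.
  have hcontra : ∀ (α : P.Cell i) (θ : ℝ), θ ∈ Set.Icc 0 (P.L i) → cellMap α θ = x →
      derivWithin (fun θ' => u s (cellMap α θ')) (Set.Icc 0 (P.L i)) θ ≠ 0 :=
    fun α θ hθ hx hd => absurd (hneg2 α θ hθ hx) (not_lt.2
      (iteratedDerivWithin_two_nonneg_of_isMinOn hL (hu.smooth s hsp α) hθ (hminα α θ hθ hx) hd))
  have hstart : ∀ α : P.Cell i, cellMap α 0 = x →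
      0 < derivWithin (fun θ' => u s (cellMap α θ')) (Set.Icc 0 (P.L i)) 0 := by
    intro α hα
    have := mul_deriv_nonneg_of_isMinOn hzero (hminα α 0 hzero hα) (hdα α 0 hzero) hone
    rw [sub_zero] at this
    exact lt_of_le_of_ne (nonneg_of_mul_nonneg_right this hL) (hcontra α 0 hzero hα).symm
  have hend : ∀ α : P.Cell i, cellMap α (P.L i) = x →
      derivWithin (fun θ' => u s (cellMap α θ')) (Set.Icc 0 (P.L i)) (P.L i) < 0 := by
    intro α hα
    have := mul_deriv_nonneg_of_isMinOn hone (hminα α _ hone hα) (hdα α _ hone) hzero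
    refine lt_of_le_of_ne ?_ (hcontra α _ hone hα)
    by_contra! h
    nlinarith
  -- At a vertex the Kirchhoff condition equates a sum of positive and a sum of negative numbers.
  have hK := hu.kirchhoff s hsp x
  have hA : ∀ α : P.Cell i, 0 ≤ if cellMap α 0 = x then
      derivWithin (fun θ => u s (cellMap α θ)) (Set.Icc 0 (P.L i)) 0 else 0 := by
    intro α; split_ifs with h
    · exact (hstart α h).le
    · exact le_rfl
  have hB : ∀ α : P.Cell i, (if cellMap α (P.L i) = x then
      derivWithin (fun θ => u s (cellMap α θ)) (Set.Icc 0 (P.L i)) (P.L i) else 0) ≤ 0 := by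
    intro α; split_ifs with h
    · exact (hend α h).le
    · exact le_rfl
  have hA0 := Finset.sum_nonneg fun α (_ : α ∈ Finset.univ) => hA α
  have hB0 := Finset.sum_nonpos fun α (_ : α ∈ Finset.univ) => hB α
  obtain ⟨α, θ, hθ, hx⟩ := exists_cellMap_eq x
  rcases hθ.1.eq_or_lt with h | h
  · subst h
    have := (Finset.sum_eq_zero_iff_of_nonneg fun α _ => hA α).1
      (le_antisymm (hK.trans_le hB0) hA0) α (Finset.mem_univ _)
    rw [if_pos hx] at this
    exact (hstart α hx).ne' this
  rcases hθ.2.eq_or_lt with h' | h'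
  · subst h'
    have := (Finset.sum_eq_zero_iff_of_nonpos fun α _ => hB α).1
      (le_antisymm hB0 (hA0.trans_eq hK)) α (Finset.mem_univ _)
    rw [if_pos hx] at this
    exact (hend α hx).ne this
  · refine hcontra α θ hθ hx ?_
    have h1 := mul_deriv_nonneg_of_isMinOn hθ (hminα α _ hθ hx) (hdα α _ hθ) hzero
    have h2 := mul_deriv_nonneg_of_isMinOn hθ (hminα α _ hθ hx) (hdα α _ hθ) hone
    nlinarith

theorem SolvesHeatEquation.sub {i : ℕ} {u v : ℝ → P.Level i → ℝ}
    (hu : P.SolvesHeatEquation i u) (hv : P.SolvesHeatEquation i v) :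
    P.SolvesHeatEquation i fun t x => u t x - v t x where
  continuousOn := hu.continuousOn.sub hv.continuousOn
  smooth t ht α := (hu.smooth t ht α).sub (hv.smooth t ht α)
  equation t ht α θ hθ := by
    have hL := uniqueDiffOn_Icc (P.L_pos i)
    have := iteratedDerivWithin_sub (n := 2) hθ hL
      (f := fun θ' => u t (cellMap α θ')) (g := fun θ' => v t (cellMap α θ'))
      ((hu.smooth t ht α) θ hθ) ((hv.smooth t ht α) θ hθ)
    exact ((hu.equation t ht α θ hθ).sub (hv.equation t ht α θ hθ)).congr_deriv this.symm
  kirchhoff t ht x := by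
    have hd : ∀ α : P.Cell i, ∀ θ ∈ Set.Icc 0 (P.L i),
        derivWithin (fun θ => u t (cellMap α θ) - v t (cellMap α θ)) (Set.Icc 0 (P.L i)) θ =
        derivWithin (fun θ => u t (cellMap α θ)) (Set.Icc 0 (P.L i)) θ -
        derivWithin (fun θ => v t (cellMap α θ)) (Set.Icc 0 (P.L i)) θ := fun α θ hθ =>
      derivWithin_fun_sub (((hu.smooth t ht α).differentiableOn two_ne_zero) θ hθ)
        (((hv.smooth t ht α).differentiableOn two_ne_zero) θ hθ)
    have hL := (P.L_pos i).le
    have hite : ∀ (p : Prop) [Decidable p] (a b : ℝ),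
        (if p then a - b else 0) = (if p then a else 0) - if p then b else 0 := by
      intro p _ a b; split_ifs <;> simp
    simp only [hd _ 0 ⟨le_rfl, hL⟩, hd _ (P.L i) ⟨hL, le_rfl⟩, hite, Finset.sum_sub_distrib]
    rw [hu.kirchhoff t ht x, hv.kirchhoff t ht x]

theorem SolvesHeatEquation.shift {i : ℕ} {u : ℝ → P.Level i → ℝ}
    (hu : P.SolvesHeatEquation i u) {r : ℝ} (hr : 0 < r) :
    P.SolvesHeatEquation i fun t x => u (t + r) x where
  continuousOn := hu.continuousOn.comp
    (f := fun z : ℝ × P.Level i => (z.1 + r, z.2)) (Continuous.continuousOn (by fun_prop))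
    fun z hz => ⟨add_pos hz.1 hr, trivial⟩
  smooth t ht α := hu.smooth (t + r) (by linarith) α
  equation t ht α θ hθ := by
    have := (hu.equation (t + r) (by linarith) α θ hθ).comp_add_const t r
    exact this
  kirchhoff t ht x := hu.kirchhoff (t + r) (by linarith) x

end Params

/-! ### Odd extensions -/

/-- The odd `2π`-periodic extension of the restriction of `G` to `[0, π]`. -/
def oddExt (G : ℝ → ℝ) (φ : ℝ) : ℝ :=
  if 0 ≤ Real.sin φ then G (Real.arccos (Real.cos φ)) else -G (Real.arccos (Real.cos φ))

theorem oddExt_periodic (G : ℝ → ℝ) : Function.Periodic (oddExt G) (2 * Real.pi) := by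
  intro φ
  simp only [oddExt, Real.sin_add_two_pi, Real.cos_add_two_pi]

theorem oddExt_of_mem {G : ℝ → ℝ} {φ : ℝ} (h : φ ∈ Set.Icc 0 Real.pi) : oddExt G φ = G φ := by
  rw [oddExt, if_pos (Real.sin_nonneg_of_mem_Icc h), Real.arccos_cos h.1 h.2]

theorem apply_arccos_cos_of_sin_eq_zero {G : ℝ → ℝ} (h0 : G 0 = 0) (hpi : G Real.pi = 0) {φ : ℝ}
    (h : Real.sin φ = 0) : G (Real.arccos (Real.cos φ)) = 0 := by
  rcases Real.sin_eq_zero_iff_cos_eq.1 h with h | h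
  · rw [h, Real.arccos_one, h0]
  · rw [h, Real.arccos_neg_one, hpi]

theorem oddExt_neg {G : ℝ → ℝ} (h0 : G 0 = 0) (hpi : G Real.pi = 0) (φ : ℝ) :
    oddExt G (-φ) = -oddExt G φ := by
  simp only [oddExt, Real.sin_neg, Real.cos_neg]
  rcases lt_trichotomy (Real.sin φ) 0 with h | h | h
  · rw [if_pos (by linarith), if_neg (by linarith), neg_neg]
  · simp [h, apply_arccos_cos_of_sin_eq_zero h0 hpi h]
  · rw [if_neg (by linarith), if_pos h.le]

theorem continuous_oddExt {G : ℝ → ℝ} (hG : Continuous G) (h0 : G 0 = 0) (hpi : G Real.pi = 0) :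
    Continuous (oddExt G) := by
  have hc : Continuous fun φ => G (Real.arccos (Real.cos φ)) :=
    hG.comp (Real.continuous_arccos.comp Real.continuous_cos)
  refine Continuous.if_le hc hc.neg continuous_const Real.continuous_sin fun φ hφ => ?_
  simp [apply_arccos_cos_of_sin_eq_zero h0 hpi hφ.symm]

/-- On odd functions, the heat semigroup of the circle acts through the Dirichlet heat kernel of
`[0, π]`. -/
theorem circOp_oddExt {t : ℝ} (ht : 0 < t) {G : ℝ → ℝ} (hG : Continuous G) (h0 : G 0 = 0)
    (hpi : G Real.pi = 0) (x : ℝ) : circOp t (oddExt G) x =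
      ∫ b in (0 : ℝ)..Real.pi, (theta t (b - x) - theta t (b + x)) * G b := by
  have hO := continuous_oddExt hG h0 hpi
  have hθ := continuous_theta ht
  have hper : Function.Periodic (fun b => theta t (b - x) * oddExt G b) (2 * Real.pi) := by
    intro b
    have : b + 2 * Real.pi - x = b - x + 2 * Real.pi := by ring
    simp only [this, theta_periodic t (b - x), oddExt_periodic G b]
  have h1 := hper.intervalIntegral_add_eq 0 (-Real.pi)
  have e : -Real.pi + 2 * Real.pi = Real.pi := by ring
  rw [zero_add, e] at h1
  have hi : ∀ a b : ℝ, IntervalIntegrable (fun b => theta t (b - x) * oddExt G b) volume a b :=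
    fun a b => Continuous.intervalIntegrable (by fun_prop) _ _
  rw [circOp, h1, ← intervalIntegral.integral_add_adjacent_intervals (hi _ 0) (hi 0 _)]
  have h2 : ∫ b in (-Real.pi)..0, theta t (b - x) * oddExt G b =
      ∫ b in (0 : ℝ)..Real.pi, -(theta t (b + x) * oddExt G b) := by
    have := intervalIntegral.integral_comp_neg (a := 0) (b := Real.pi)
      (fun b => theta t (b - x) * oddExt G b)
    rw [neg_zero] at this
    rw [← this]
    refine intervalIntegral.integral_congr fun b _ => ?_
    have e2 : -b - x = -(b + x) := by ring
    simp only [oddExt_neg h0 hpi, e2, theta_neg]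
    ring
  rw [h2, ← intervalIntegral.integral_add]
  · refine intervalIntegral.integral_congr fun b hb => ?_
    rw [Set.uIcc_of_le Real.pi_pos.le] at hb
    simp only [oddExt_of_mem hb]
    ring
  · exact Continuous.intervalIntegrable (by fun_prop) _ _
  · exact hi _ _

/-! ### The Dirichlet heat kernel of the arcs of a level -/

/-- The heat kernel of the circle as a function on the circle. -/
def thetaC (t : ℝ) : Circ → ℝ := (theta_periodic t).lift

theorem thetaC_coe (t a : ℝ) : thetaC t (a : Circ) = theta t a :=
  (theta_periodic t).lift_coe a

theorem thetaC_neg (t : ℝ) (z : Circ) : thetaC t (-z) = thetaC t z := by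
  induction z using QuotientAddGroup.induction_on with
  | H a => rw [← QuotientAddGroup.mk_neg]; exact (thetaC_coe t (-a)).trans
            ((theta_neg t a).trans (thetaC_coe t a).symm)

theorem continuousOn_thetaC :
    ContinuousOn (fun z : ℝ × Circ => thetaC z.1 z.2) (Set.Ioi 0 ×ˢ Set.univ) := by
  rintro ⟨t, z⟩ ⟨ht, -⟩
  induction z using QuotientAddGroup.induction_on with
  | H a =>
    have hq : IsOpenQuotientMap (Prod.map id (fun a : ℝ => (a : Circ)) : ℝ × ℝ → ℝ × Circ) :=
      IsOpenQuotientMap.id.prodMap QuotientAddGroup.isOpenQuotientMap_mk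
    refine ContinuousAt.continuousWithinAt ?_
    refine (hq.continuousAt_comp_iff (x := (t, a))).1 ?_
    have : ContinuousAt (fun z : ℝ × ℝ => theta z.1 z.2) (t, a) :=
      continuousOn_theta.continuousAt ((isOpen_Ioi.prod isOpen_univ).mem_nhds ⟨ht, trivial⟩)
    exact this

/-- The representative in `[0, 2π)` of an angle. -/
def carg (η : Circ) : ℝ := (AddCircle.equivIco (2 * Real.pi) 0 η : ℝ)

theorem coe_carg (η : Circ) : ((carg η : ℝ) : Circ) = η := AddCircle.coe_equivIco

theorem carg_mem (η : Circ) : carg η ∈ Set.Ico 0 (2 * Real.pi) := by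
  have := (AddCircle.equivIco (2 * Real.pi) 0 η).2
  exact ⟨this.1, this.2.trans_eq (zero_add _)⟩

theorem carg_coe {a : ℝ} (ha : a ∈ Set.Ico 0 (2 * Real.pi)) : carg (a : Circ) = a := by
  rw [carg, AddCircle.equivIco_coe_of_mem]
  rwa [zero_add]

namespace Params

variable (P : Params)

/-- The index of the half-open arc `[m L_l, (m + 1) L_l)` of level `l` that contains an angle. -/
def arcIdx (l : ℕ) (η : Circ) : ℤ := ⌊carg η / P.L l⌋

theorem arcIdx_bounds (l : ℕ) (η : Circ) :
    P.arcIdx l η * P.L l ≤ carg η ∧ carg η < (P.arcIdx l η + 1) * P.L l :=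
  ⟨(le_div_iff₀ (P.L_pos l)).1 (Int.floor_le _),
    (div_lt_iff₀ (P.L_pos l)).1 (Int.lt_floor_add_one _)⟩

theorem arcIdx_coe (l : ℕ) {a : ℝ} (ha : a ∈ Set.Ico 0 (2 * Real.pi)) (m : ℤ) :
    P.arcIdx l (a : Circ) = m ↔ a ∈ Set.Ico (m * P.L l) ((m + 1) * P.L l) := by
  rw [arcIdx, carg_coe ha, Int.floor_eq_iff, le_div_iff₀ (P.L_pos l), div_lt_iff₀ (P.L_pos l)]
  rfl

theorem coe_mul_L_mem_grid (i : ℕ) (m : ℤ) :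
    ((m * P.L (i + 1) : ℝ) : Circ) ∈ P.grid (i + 1) := by
  refine ⟨m, ?_⟩
  simp only [L]
  congr 1
  ring

theorem arcIdx_eventuallyEq (i : ℕ) {η : Circ} (hη : η ∉ P.grid (i + 1)) :
    ∀ᶠ ζ in 𝓝 η, P.arcIdx (i + 1) ζ = P.arcIdx (i + 1) η := by
  have h0 : η ≠ ((0 : ℝ) : Circ) := by
    rintro rfl
    exact hη (by simpa using P.coe_mul_L_mem_grid i 0)
  have hc : ContinuousAt (fun ζ => carg ζ / P.L (i + 1)) η :=
    ((continuous_subtype_val.continuousAt).comp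
      (AddCircle.continuousAt_equivIco (2 * Real.pi) 0 h0)).div_const _
  have h1 : carg η / P.L (i + 1) ∈ Set.Ioo (P.arcIdx (i + 1) η : ℝ) (P.arcIdx (i + 1) η + 1) := by
    refine ⟨lt_of_le_of_ne (Int.floor_le _) fun h => hη ?_, Int.lt_floor_add_one _⟩
    rw [eq_div_iff (P.L_pos _).ne'] at h
    have := P.coe_mul_L_mem_grid i (P.arcIdx (i + 1) η)
    rwa [h, coe_carg] at this
  filter_upwards [hc.eventually (isOpen_Ioo.mem_nhds h1)] with ζ hζ
  exact Int.floor_eq_iff.2 ⟨hζ.1.le, hζ.2⟩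

/-- The Dirichlet heat kernel of the arcs of level `l`, before it is restricted to pairs of angles
in the same arc. It is defined on the whole circle and vanishes if one of the angles is in `grid l`,
so that the restriction preserves continuity. -/
def reflKernel (l : ℕ) (t : ℝ) (η ζ : Circ) : ℝ :=
  P.J l * (thetaC ((P.J l : ℝ) ^ 2 * t) (P.J l • (ζ - η)) -
    thetaC ((P.J l : ℝ) ^ 2 * t) (P.J l • (ζ + η)))

theorem reflKernel_coe (l : ℕ) (t a b : ℝ) : P.reflKernel l t (a : Circ) (b : Circ) =
    P.J l * (theta ((P.J l : ℝ) ^ 2 * t) (P.J l * (b - a)) -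
      theta ((P.J l : ℝ) ^ 2 * t) (P.J l * (b + a))) := by
  rw [reflKernel, ← AddCircle.coe_sub, ← AddCircle.coe_add, ← AddCircle.coe_nsmul,
    ← AddCircle.coe_nsmul, thetaC_coe, thetaC_coe, nsmul_eq_mul, nsmul_eq_mul]

theorem reflKernel_symm (l : ℕ) (t : ℝ) (η ζ : Circ) :
    P.reflKernel l t η ζ = P.reflKernel l t ζ η := by
  rw [reflKernel, reflKernel, ← neg_sub η ζ, smul_neg, thetaC_neg, add_comm ζ η]

theorem nsmul_eq_neg_of_mem_grid {l : ℕ} {η : Circ} (h : η ∈ P.grid l) :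
    P.J l • η = -(P.J l • η) := by
  obtain ⟨k, rfl⟩ := h
  rw [eq_neg_iff_add_eq_zero, ← AddCircle.coe_nsmul, ← AddCircle.coe_add, AddCircle.coe_eq_zero_iff]
  refine ⟨k, ?_⟩
  have := (P.J_pos' l).ne'
  rw [nsmul_eq_mul, zsmul_eq_mul]
  field_simp
  ring

theorem reflKernel_of_mem_left {l : ℕ} (t : ℝ) {η : Circ} (h : η ∈ P.grid l) (ζ : Circ) :
    P.reflKernel l t η ζ = 0 := by
  rw [reflKernel, smul_sub, smul_add, sub_eq_add_neg (P.J l • ζ),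
    ← P.nsmul_eq_neg_of_mem_grid h, sub_self, mul_zero]

theorem reflKernel_of_mem_right {l : ℕ} (t : ℝ) (η : Circ) {ζ : Circ} (h : ζ ∈ P.grid l) :
    P.reflKernel l t η ζ = 0 := by
  rw [reflKernel_symm, P.reflKernel_of_mem_left t h]

theorem continuousOn_reflKernel (l : ℕ) :
    ContinuousOn (fun z : ℝ × Circ × Circ => P.reflKernel l z.1 z.2.1 z.2.2)
      (Set.Ioi 0 ×ˢ Set.univ) := by
  have hJ := P.J_pos' l
  have h : ∀ F : Circ × Circ → Circ, Continuous F → ContinuousOn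
      (fun z : ℝ × Circ × Circ => thetaC ((P.J l : ℝ) ^ 2 * z.1) (F z.2))
      (Set.Ioi 0 ×ˢ Set.univ) := by
    intro F hF
    refine continuousOn_thetaC.comp
      (f := fun z : ℝ × Circ × Circ => ((P.J l : ℝ) ^ 2 * z.1, F z.2))
      (Continuous.continuousOn (by fun_prop)) fun z hz => ⟨?_, trivial⟩
    have : (0 : ℝ) < z.1 := hz.1
    exact Set.mem_Ioi.2 (by positivity)
  exact continuousOn_const.mul ((h (fun z => P.J l • (z.2 - z.1)) (by fun_prop)).sub
    (h (fun z => P.J l • (z.2 + z.1)) (by fun_prop)))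

/-- The Dirichlet heat kernel of the arcs of level `l`, extended by `0` to pairs of angles in
different arcs. -/
def arcKernel (l : ℕ) (t : ℝ) (η ζ : Circ) : ℝ :=
  if P.arcIdx l η = P.arcIdx l ζ then P.reflKernel l t η ζ else 0

theorem arcKernel_symm (l : ℕ) (t : ℝ) (η ζ : Circ) :
    P.arcKernel l t η ζ = P.arcKernel l t ζ η := by
  rw [arcKernel, arcKernel, reflKernel_symm]
  exact if_congr eq_comm rfl rfl

theorem arcKernel_of_mem_left {l : ℕ} (t : ℝ) {η : Circ} (h : η ∈ P.grid l) (ζ : Circ) :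
    P.arcKernel l t η ζ = 0 := by
  rw [arcKernel, P.reflKernel_of_mem_left t h, ite_self]

theorem arcKernel_of_mem_right {l : ℕ} (t : ℝ) (η : Circ) {ζ : Circ} (h : ζ ∈ P.grid l) :
    P.arcKernel l t η ζ = 0 := by
  rw [arcKernel, P.reflKernel_of_mem_right t η h, ite_self]

theorem abs_arcKernel_le_abs_reflKernel (l : ℕ) (t : ℝ) (η ζ : Circ) :
    |P.arcKernel l t η ζ| ≤ |P.reflKernel l t η ζ| := by
  rw [arcKernel]
  split_ifs
  · exact le_rfl
  · simp

theorem continuousOn_arcKernel (i : ℕ) :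
    ContinuousOn (fun z : ℝ × Circ × Circ => P.arcKernel (i + 1) z.1 z.2.1 z.2.2)
      (Set.Ioi 0 ×ˢ Set.univ) := by
  rintro ⟨t, η, ζ⟩ ⟨ht, -⟩
  have hc : ContinuousAt (fun z : ℝ × Circ × Circ => P.reflKernel (i + 1) z.1 z.2.1 z.2.2)
      (t, η, ζ) :=
    (P.continuousOn_reflKernel (i + 1)).continuousAt
      ((isOpen_Ioi.prod isOpen_univ).mem_nhds ⟨ht, trivial⟩)
  refine ContinuousAt.continuousWithinAt ?_
  by_cases h : η ∉ P.grid (i + 1) ∧ ζ ∉ P.grid (i + 1)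
  · -- Away from the grid, the arcs that contain the two angles do not change locally.
    have h1 : ∀ᶠ z : ℝ × Circ × Circ in 𝓝 (t, η, ζ),
        P.arcIdx (i + 1) z.2.1 = P.arcIdx (i + 1) η :=
      (show ContinuousAt (fun z : ℝ × Circ × Circ => z.2.1) (t, η, ζ) by
        fun_prop).eventually (P.arcIdx_eventuallyEq i h.1)
    have h2 : ∀ᶠ z : ℝ × Circ × Circ in 𝓝 (t, η, ζ),
        P.arcIdx (i + 1) z.2.2 = P.arcIdx (i + 1) ζ :=
      (show ContinuousAt (fun z : ℝ × Circ × Circ => z.2.2) (t, η, ζ) by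
        fun_prop).eventually (P.arcIdx_eventuallyEq i h.2)
    by_cases he : P.arcIdx (i + 1) η = P.arcIdx (i + 1) ζ
    · refine hc.congr ?_
      filter_upwards [h1, h2] with z hz1 hz2
      rw [arcKernel, if_pos (by rw [hz1, hz2, he])]
    · refine (continuousAt_const (y := (0 : ℝ))).congr ?_
      filter_upwards [h1, h2] with z hz1 hz2
      rw [arcKernel, if_neg (by rw [hz1, hz2]; exact he)]
  · -- On the grid, the kernel is squeezed by a continuous function that vanishes there.
    have h0 : P.reflKernel (i + 1) t η ζ = 0 := by
      by_cases hη : η ∈ P.grid (i + 1)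
      · exact P.reflKernel_of_mem_left t hη ζ
      · exact P.reflKernel_of_mem_right t η (by tauto)
    have h0' : P.arcKernel (i + 1) t η ζ = 0 := by rw [arcKernel, h0, ite_self]
    have h1 := hc.abs.tendsto
    simp only [h0, abs_zero] at h1
    rw [ContinuousAt, h0']
    exact squeeze_zero_norm (fun z => P.abs_arcKernel_le_abs_reflKernel (i + 1) z.1 z.2.1 z.2.2) h1

theorem continuous_arcKernel_section (i : ℕ) {t : ℝ} (ht : 0 < t) (η : Circ) :
    Continuous (P.arcKernel (i + 1) t η) :=
  (P.continuousOn_arcKernel i).comp_continuous (f := fun ζ : Circ => (t, η, ζ)) (by fun_prop)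
    fun _ => ⟨ht, trivial⟩

/-- For two angles in the same arc, the Dirichlet kernel of `[0, L_l]` at their positions on the
arc is `reflKernel`: the starting point of the arc enters only through multiples of `2π`. -/
theorem dirichletKernel_eq_reflKernel (i : ℕ) (t : ℝ) {η ζ : Circ}
    (h : P.arcIdx (i + 1) η = P.arcIdx (i + 1) ζ) :
    P.dirichletKernel (i + 1) t (P.L (i + 1) * Int.fract (carg η / P.L (i + 1)))
      (P.L (i + 1) * Int.fract (carg ζ / P.L (i + 1))) = P.reflKernel (i + 1) t η ζ := by
  have hL := (P.L_pos (i + 1)).ne'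
  have hJL := P.J_mul_L i
  have e : ∀ ξ : Circ, (P.J (i + 1) : ℝ) * (P.L (i + 1) * Int.fract (carg ξ / P.L (i + 1))) =
      P.J (i + 1) * carg ξ - P.arcIdx (i + 1) ξ * Real.pi := by
    intro ξ
    rw [← hJL, Int.fract, arcIdx]
    field_simp
  rw [← coe_carg η, ← coe_carg ζ, reflKernel_coe, coe_carg, coe_carg, dirichletKernel,
    circleKernel_eq, circleKernel_eq, e, e, h]
  congr 2
  · congr 1; ring
  · rw [← theta_neg]
    have := ((theta_periodic ((P.J (i + 1) : ℝ) ^ 2 * t)).int_mul (P.arcIdx (i + 1) ζ))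
      (-(-(P.J (i + 1) * carg ζ - P.arcIdx (i + 1) ζ * Real.pi) -
        (P.J (i + 1) * carg η - P.arcIdx (i + 1) ζ * Real.pi)))
    rw [← this]
    congr 1; ring

/-- The heat kernel of `[0, L_l]` satisfies the Dirichlet condition. -/
theorem dirichletKernel_zero_left (l : ℕ) (t θ : ℝ) : P.dirichletKernel l t 0 θ = 0 := by
  rw [dirichletKernel, circleKernel_eq, circleKernel_eq]
  simp [theta_neg]

theorem dirichletKernel_zero_right (l : ℕ) (t θ : ℝ) : P.dirichletKernel l t θ 0 = 0 := by
  simp [dirichletKernel]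

theorem fract_eq_zero_of_mem_grid (i : ℕ) {η : Circ} (h : η ∈ P.grid (i + 1)) :
    Int.fract (carg η / P.L (i + 1)) = 0 := by
  have hL := (P.L_pos (i + 1)).ne'
  rw [← coe_carg η, coe_mem_grid_iff] at h
  obtain ⟨k, hk⟩ := h
  rw [Int.fract_eq_zero_iff]
  refine ⟨k, ?_⟩
  rw [eq_div_iff hL]
  have := (P.J_pos' (i + 1)).ne'
  simp only [L]
  field_simp
  linarith

end Params
namespace Params

variable (P : Params)

/-! ### The Dirichlet heat semigroup of the arcs of a level -/

/-- The semigroup of Brownian motion killed at the end points of the arcs of level `l`. -/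
def arcOp (l : ℕ) (t : ℝ) (g : Circ → ℝ) (η : Circ) : ℝ :=
  ∫ ζ : Circ, P.arcKernel l t η ζ * g ζ

/-- The restriction of `g` to the `m`-th arc of level `l`, on the scale of `[0, π]`. -/
def arcFun (l : ℕ) (g : Circ → ℝ) (m : ℤ) (β : ℝ) : ℝ := g ((m * P.L l + β / P.J l : ℝ) : Circ)

section

variable {P} {i : ℕ} {g : Circ → ℝ} (hg : Continuous g) (hg0 : ∀ η ∈ P.grid (i + 1), g η = 0)

include hg in
theorem continuous_arcFun (l : ℕ) (m : ℤ) : Continuous (P.arcFun l g m) :=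
  hg.comp ((AddCircle.continuous_mk' _).comp
    (by fun_prop : Continuous fun β : ℝ => m * P.L l + β / P.J l))

include hg0 in
theorem arcFun_zero (m : ℤ) : P.arcFun (i + 1) g m 0 = 0 := by
  rw [arcFun, zero_div, add_zero]
  exact hg0 _ (P.coe_mul_L_mem_grid i m)

include hg0 in
theorem arcFun_pi (m : ℤ) : P.arcFun (i + 1) g m Real.pi = 0 := by
  have := P.coe_mul_L_mem_grid i (m + 1)
  rw [arcFun]
  refine hg0 _ ?_
  convert this using 2
  simp only [L]; push_cast; ring

include hg hg0 in
/-- On each arc, the Dirichlet semigroup is the heat semigroup of the circle acting on odd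
functions. -/
theorem arcOp_eq_circOp {t : ℝ} (ht : 0 < t) {m : ℤ} (hm : 0 ≤ m) (hm' : m < 2 * P.J (i + 1))
    {a : ℝ} (ha : a ∈ Set.Icc (m * P.L (i + 1)) ((m + 1) * P.L (i + 1))) :
    P.arcOp (i + 1) t g (a : Circ) = circOp ((P.J (i + 1) : ℝ) ^ 2 * t)
      (oddExt (P.arcFun (i + 1) g m)) (P.J (i + 1) * (a - m * P.L (i + 1))) := by
  have hL := P.L_pos (i + 1)
  have hJ := P.J_pos' (i + 1)
  have hJL := P.J_mul_L i
  have hs : 0 < (P.J (i + 1) : ℝ) ^ 2 * t := by positivity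
  have hm0 : (0 : ℝ) ≤ m := by exact_mod_cast hm
  have hm1 : (m : ℝ) + 1 ≤ 2 * P.J (i + 1) := by exact_mod_cast hm'
  have htop : ((m : ℝ) + 1) * P.L (i + 1) ≤ 2 * Real.pi := by
    have := mul_le_mul_of_nonneg_right hm1 hL.le
    rwa [mul_assoc, hJL] at this
  have hbot : (0 : ℝ) ≤ m * P.L (i + 1) := by positivity
  have hle : (m : ℝ) * P.L (i + 1) ≤ (m + 1) * P.L (i + 1) := by nlinarith
  -- The kernel selects the `m`-th arc.
  have hker : ∀ b ∈ Set.Ico 0 (2 * Real.pi), P.arcKernel (i + 1) t (a : Circ) (b : Circ) =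
      (Set.Ico (m * P.L (i + 1)) ((m + 1) * P.L (i + 1))).indicator
        (fun b : ℝ => P.reflKernel (i + 1) t (a : Circ) (b : Circ)) b := by
    intro b hb
    by_cases hga : (a : Circ) ∈ P.grid (i + 1)
    · rw [P.arcKernel_of_mem_left t hga]
      simp [P.reflKernel_of_mem_left t hga]
    · have hne : a ≠ (m + 1) * P.L (i + 1) := by
        rintro rfl
        exact hga (by exact_mod_cast P.coe_mul_L_mem_grid i (m + 1))
      have ham : a ∈ Set.Ico (m * P.L (i + 1)) ((m + 1) * P.L (i + 1)) :=
        ⟨ha.1, lt_of_le_of_ne ha.2 hne⟩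
      rw [arcKernel, (P.arcIdx_coe (i + 1) ⟨hbot.trans ham.1, ham.2.trans_le htop⟩ m).2 ham,
        Set.indicator_apply]
      refine if_congr ?_ rfl rfl
      rw [eq_comm, P.arcIdx_coe (i + 1) hb m]
  have h1 : P.arcOp (i + 1) t g (a : Circ) =
      ∫ b in (m * P.L (i + 1))..((m + 1) * P.L (i + 1)),
        P.reflKernel (i + 1) t (a : Circ) (b : Circ) * g (b : Circ) := by
    rw [arcOp, ← AddCircle.intervalIntegral_preimage (2 * Real.pi) 0, zero_add,
      intervalIntegral.integral_of_le Real.two_pi_pos.le, intervalIntegral.integral_of_le hle,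
      ← integral_Ico_eq_integral_Ioc, ← integral_Ico_eq_integral_Ioc]
    have e : ∀ b ∈ Set.Ico 0 (2 * Real.pi), P.arcKernel (i + 1) t (a : Circ) (b : Circ) *
        g (b : Circ) = (Set.Ico (m * P.L (i + 1)) ((m + 1) * P.L (i + 1))).indicator
        (fun b : ℝ => P.reflKernel (i + 1) t (a : Circ) (b : Circ) * g (b : Circ)) b := by
      intro b hb
      rw [hker b hb]
      simp only [Set.indicator_apply]
      split_ifs <;> simp
    rw [setIntegral_congr_fun measurableSet_Ico e, setIntegral_indicator measurableSet_Ico,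
      Set.inter_eq_self_of_subset_right (Set.Ico_subset_Ico hbot htop)]
  rw [h1, circOp_oddExt hs (continuous_arcFun hg _ m) (arcFun_zero hg0 m) (arcFun_pi hg0 m)]
  have h2 := intervalIntegral.integral_comp_div_add (a := 0) (b := Real.pi)
    (fun b : ℝ => P.reflKernel (i + 1) t (a : Circ) (b : Circ) * g (b : Circ)) hJ.ne'
    (m * P.L (i + 1))
  have e1 : 0 / (P.J (i + 1) : ℝ) + m * P.L (i + 1) = m * P.L (i + 1) := by simp
  have e2 : Real.pi / (P.J (i + 1) : ℝ) + m * P.L (i + 1) = (m + 1) * P.L (i + 1) := by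
    simp only [L]; ring
  rw [e1, e2, smul_eq_mul] at h2
  have h3 : (P.J (i + 1) : ℝ)⁻¹ * (P.J (i + 1) *
      ∫ b in (m * P.L (i + 1))..((m + 1) * P.L (i + 1)),
        P.reflKernel (i + 1) t (a : Circ) (b : Circ) * g (b : Circ)) = _ :=
    congrArg _ h2.symm
  rw [inv_mul_cancel_left₀ hJ.ne'] at h3
  rw [h3, ← intervalIntegral.integral_const_mul]
  refine intervalIntegral.integral_congr fun β _ => ?_
  have e3 : (P.J (i + 1) : ℝ) * (β / P.J (i + 1) + m * P.L (i + 1) - a) =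
      β - P.J (i + 1) * (a - m * P.L (i + 1)) := by
    field_simp; ring
  have e4 : (P.J (i + 1) : ℝ) * (β / P.J (i + 1) + m * P.L (i + 1) + a) =
      β + P.J (i + 1) * (a - m * P.L (i + 1)) + m * (2 * Real.pi) := by
    rw [← hJL]; field_simp; ring
  simp only [reflKernel_coe, e3, e4]
  rw [((theta_periodic _).int_mul m) _, arcFun, add_comm (β / _)]
  field_simp

theorem exists_arc (η : Circ) : ∃ m : ℤ, 0 ≤ m ∧ m < 2 * P.J (i + 1) ∧
    carg η ∈ Set.Ico (m * P.L (i + 1)) ((m + 1) * P.L (i + 1)) := by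
  have hL := P.L_pos (i + 1)
  have hc := carg_mem η
  refine ⟨P.arcIdx (i + 1) η, Int.floor_nonneg.2 (div_nonneg hc.1 hL.le), ?_, P.arcIdx_bounds _ _⟩
  rw [arcIdx, Int.floor_lt, div_lt_iff₀ hL]
  push_cast
  rw [mul_assoc, P.J_mul_L]
  exact hc.2

include hg hg0 in
theorem eventually_abs_arcOp_sub_le {ε : ℝ} (hε : 0 < ε) :
    ∀ᶠ t in 𝓝[>] (0 : ℝ), ∀ η, |P.arcOp (i + 1) t g η - g η| ≤ ε := by
  have hJ := P.J_pos' (i + 1)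
  have hlim : Tendsto (fun t : ℝ => (P.J (i + 1) : ℝ) ^ 2 * t) (𝓝[>] 0) (𝓝[>] 0) := by
    refine tendsto_nhdsWithin_iff.2 ⟨?_, ?_⟩
    · have : Continuous fun t : ℝ => (P.J (i + 1) : ℝ) ^ 2 * t := by fun_prop
      have h := this.tendsto 0
      rw [mul_zero] at h
      exact h.mono_left nhdsWithin_le_nhds
    · filter_upwards [self_mem_nhdsWithin] with t ht
      have : (0 : ℝ) < t := ht
      exact Set.mem_Ioi.2 (by positivity)
  have hall : ∀ᶠ t in 𝓝[>] (0 : ℝ), ∀ m ∈ Finset.Ico (0 : ℤ) (2 * P.J (i + 1)), ∀ x,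
      |circOp ((P.J (i + 1) : ℝ) ^ 2 * t) (oddExt (P.arcFun (i + 1) g m)) x -
        oddExt (P.arcFun (i + 1) g m) x| ≤ ε := by
    rw [Finset.eventually_all]
    exact fun m _ => hlim.eventually (eventually_abs_circOp_sub_le
      (continuous_oddExt (continuous_arcFun hg _ m) (arcFun_zero hg0 m) (arcFun_pi hg0 m))
      (oddExt_periodic _) hε)
  filter_upwards [hall, self_mem_nhdsWithin] with t h ht η
  obtain ⟨m, hm, hm', hc⟩ := exists_arc (P := P) (i := i) η
  have h1 := h m (Finset.mem_Ico.2 ⟨hm, hm'⟩) (P.J (i + 1) * (carg η - m * P.L (i + 1)))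
  rw [← arcOp_eq_circOp hg hg0 ht hm hm' ⟨hc.1, hc.2.le⟩, oddExt_of_mem, arcFun, coe_carg] at h1
  · have e : (m * P.L (i + 1) + P.J (i + 1) * (carg η - m * P.L (i + 1)) / P.J (i + 1) : ℝ) =
        carg η := by field_simp; ring
    rwa [e, coe_carg] at h1
  · have hJL := P.J_mul_L i
    constructor
    · exact mul_nonneg hJ.le (by linarith [hc.1])
    · rw [← hJL]
      exact mul_le_mul_of_nonneg_left (by linarith [hc.2]) hJ.le

include hg hg0 in
/-- Along an interval without grid points, the Dirichlet semigroup agrees with a solution of the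
heat equation on the line. -/
theorem exists_isHeatSol_arcOp (η : Circ) {δ : ℝ}
    (hfree : ∀ s ∈ Set.Ioo 0 δ, η + (s : Circ) ∉ P.grid (i + 1)) :
    ∃ V, IsHeatSol V ∧ ∀ t, 0 < t → ∀ s ∈ Set.Icc 0 δ,
      P.arcOp (i + 1) t g (η + (s : Circ)) = V t s := by
  have hJ := P.J_pos' (i + 1)
  obtain ⟨m, hm, hm', hc⟩ := exists_arc (P := P) (i := i) η
  have hδ : carg η + δ ≤ (m + 1) * P.L (i + 1) := by
    by_contra! hlt
    refine hfree ((m + 1) * P.L (i + 1) - carg η) ⟨by linarith [hc.2], by linarith⟩ ?_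
    have := P.coe_mul_L_mem_grid i (m + 1)
    push_cast at this
    rwa [AddCircle.coe_sub, coe_carg, add_sub_cancel]
  have hO := continuous_oddExt (continuous_arcFun hg (i + 1) m) (arcFun_zero hg0 m)
    (arcFun_pi hg0 m)
  refine ⟨_, (isHeatSol_circOp hO).comp_affine hJ (P.J (i + 1) * (carg η - m * P.L (i + 1))), ?_⟩
  intro t ht s hs
  have h1 := arcOp_eq_circOp hg hg0 ht hm hm' (a := carg η + s)
    ⟨by linarith [hc.1, hs.1], by linarith [hs.2]⟩
  rw [AddCircle.coe_add, coe_carg] at h1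
  rw [h1]
  congr 1; ring

end

end Params
namespace Params

variable {P : Params}

/-! ### The recursion for the kernels in terms of words -/

/-- A point whose angle is not in `grid (i + 1)` lies in exactly one cell of level `i + 1`. -/
theorem mem_cellSet_iff {i : ℕ} {η : Circ} (hη : η ∉ P.grid (i + 1)) (w : P.Word (i + 1))
    (α : P.Cell (i + 1)) : ofFiniteWord (η, w) ∈ cellSet α ↔
      ((α.1 : ℕ) : ℤ) = P.arcIdx (i + 1) η ∧ α.2 = w := by
  have hL := P.L_pos (i + 1)
  constructor
  · rintro ⟨θ, hθ, h⟩
    obtain ⟨h1, h2⟩ := ofFiniteWord_eq_iff.1 h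
    simp only at h1 h2
    refine ⟨?_, funext fun l => h2 l fun hl => hη ?_⟩
    · have hne : θ ≠ P.L (i + 1) := by
        rintro rfl
        have := P.coe_mul_L_mem_grid i ((α.1 : ℕ) + 1)
        push_cast at this
        rw [add_mul, one_mul, h1] at this
        exact hη this
      have hθ' := lt_of_le_of_ne hθ.2 hne
      have htop : (((α.1 : ℕ) : ℝ) + 1) * P.L (i + 1) ≤ 2 * Real.pi := by
        rw [← P.arcs_mul_L (i + 1)]
        refine mul_le_mul_of_nonneg_right ?_ hL.le
        exact_mod_cast α.1.2
      have hb : (0 : ℝ) ≤ ((α.1 : ℕ) : ℝ) * P.L (i + 1) := by positivity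
      rw [← h1, eq_comm, P.arcIdx_coe]
      · push_cast
        constructor <;> linarith [hθ.1]
      · constructor <;> linarith [hθ.1]
    · rw [← h1]
      exact P.grid_mono (by omega) hl
  · rintro ⟨h1, rfl⟩
    have hb := P.arcIdx_bounds (i + 1) η
    rw [← h1] at hb
    push_cast at hb
    refine ⟨carg η - (α.1 : ℕ) * P.L (i + 1), ⟨by linarith, by linarith⟩, ?_⟩
    rw [cellMap, add_sub_cancel, coe_carg]

theorem exists_fin_arc (i : ℕ) (η : Circ) :
    ∃ m : Fin (P.arcs (i + 1)), ((m : ℕ) : ℤ) = P.arcIdx (i + 1) η := by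
  obtain ⟨m, h0, h1, hm⟩ := exists_arc (P := P) (i := i) η
  have e : P.arcIdx (i + 1) η = m := by
    rw [← P.arcIdx_coe (i + 1) (carg_mem η), coe_carg] at hm
    exact hm
  refine ⟨⟨m.toNat, ?_⟩, ?_⟩
  · simp only [arcs]; omega
  · rw [e]; simp [h0]

theorem sameCell_iff {i : ℕ} {η ζ : Circ} (hη : η ∉ P.grid (i + 1)) (hζ : ζ ∉ P.grid (i + 1))
    (w v : P.Word (i + 1)) : SameCell (ofFiniteWord (η, w)) (ofFiniteWord (ζ, v)) ↔
      P.arcIdx (i + 1) η = P.arcIdx (i + 1) ζ ∧ w = v := by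
  simp only [SameCell, mem_cellSet_iff hη, mem_cellSet_iff hζ]
  constructor
  · rintro ⟨α, ⟨h1, h2⟩, h3, h4⟩
    exact ⟨h1.symm.trans h3, h2.symm.trans h4⟩
  · rintro ⟨h, rfl⟩
    obtain ⟨m, hm⟩ := exists_fin_arc (P := P) i η
    exact ⟨(m, w), ⟨hm, rfl⟩, hm.trans h, rfl⟩

/-- The words agree except possibly for the last letter. -/
def SameInit {i : ℕ} (w v : P.Word i) : Prop := ∀ l : Fin i, (l : ℕ) + 1 < i → w l = v l

theorem sameBundle_iff {i : ℕ} {η ζ : Circ} (hη : η ∉ P.grid (i + 1)) (hζ : ζ ∉ P.grid (i + 1))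
    (w v : P.Word (i + 1)) : SameBundle (ofFiniteWord (η, w)) (ofFiniteWord (ζ, v)) ↔
      P.arcIdx (i + 1) η = P.arcIdx (i + 1) ζ ∧ SameInit w v := by
  simp only [SameBundle, SameBundleCell, mem_cellSet_iff hη, mem_cellSet_iff hζ]
  constructor
  · rintro ⟨α, β, ⟨h, h'⟩, ⟨h1, rfl⟩, h3, rfl⟩
    exact ⟨by rw [← h1, ← h3, h], h'⟩
  · rintro ⟨h, h'⟩
    obtain ⟨m, hm⟩ := exists_fin_arc (P := P) i η
    exact ⟨(m, w), (m, v), ⟨rfl, h'⟩, ⟨hm, rfl⟩, hm.trans h, rfl⟩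

open Classical in
/-- The coefficient of the Dirichlet kernel in the recursion for the heat kernels. -/
def coupling {i : ℕ} (w v : P.Word (i + 1)) : ℝ :=
  if w = v then (P.n (i + 1) : ℝ) - 1 else if SameInit w v then -1 else 0

/-- The recursion for the heat kernels in terms of words. At the points that lie in several
cells, the Dirichlet kernel vanishes. -/
theorem kernel_succ (i : ℕ) (t : ℝ) (p q : Circ × P.Word (i + 1)) :
    P.kernel (i + 1) t (ofFiniteWord p) (ofFiniteWord q) =
      P.kernel i t (proj (Nat.le_succ i) (ofFiniteWord p))
        (proj (Nat.le_succ i) (ofFiniteWord q)) +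
      P.N i * coupling p.2 q.2 * P.arcKernel (i + 1) t p.1 q.1 := by
  obtain ⟨η, w⟩ := p
  obtain ⟨ζ, v⟩ := q
  rw [kernel]
  congr 1
  have hpos : ∀ (ξ : Circ) (u : P.Word (i + 1)), pos (ofFiniteWord (ξ, u)) =
      P.L (i + 1) * Int.fract (carg ξ / P.L (i + 1)) := fun _ _ => rfl
  rw [hpos, hpos]
  by_cases hη : η ∈ P.grid (i + 1)
  · simp only [P.fract_eq_zero_of_mem_grid i hη, P.arcKernel_of_mem_left t hη, mul_zero,
      dirichletKernel_zero_left, neg_zero, ite_self]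
  by_cases hζ : ζ ∈ P.grid (i + 1)
  · simp only [P.fract_eq_zero_of_mem_grid i hζ, P.arcKernel_of_mem_right t η hζ, mul_zero,
      dirichletKernel_zero_right, neg_zero, ite_self]
  rw [sameCell_iff hη hζ, sameBundle_iff hη hζ, arcKernel]
  by_cases h : P.arcIdx (i + 1) η = P.arcIdx (i + 1) ζ
  · rw [P.dirichletKernel_eq_reflKernel i t h]
    by_cases hw : w = v
    · simp [h, hw, coupling]
    · by_cases hs : SameInit w v <;> simp [h, hw, hs, coupling]
  · simp [h]

theorem kernel_zero (t : ℝ) (x y : P.Level 0) :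
    P.kernel 0 t x y = thetaC t (angle y - angle x) := by
  have e : ∀ x : P.Level 0, arg x = carg (angle x) := fun _ => rfl
  rw [kernel, circleKernel_eq, e, e, ← thetaC_coe, AddCircle.coe_sub, coe_carg, coe_carg]

theorem continuous_angle {i : ℕ} : Continuous (angle : P.Level i → Circ) :=
  Continuous.quotient_lift continuous_fst _

theorem continuousOn_kernel (i : ℕ) :
    ContinuousOn (fun z : ℝ × P.Level i × P.Level i => P.kernel i z.1 z.2.1 z.2.2)
      (Set.Ioi 0 ×ˢ Set.univ) := by
  induction i with
  | zero =>
    simp only [kernel_zero]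
    have h : Continuous fun z : ℝ × P.Level 0 × P.Level 0 =>
        (z.1, angle z.2.2 - angle z.2.1) := by
      refine continuous_fst.prodMk (Continuous.sub ?_ ?_)
      · exact continuous_angle.comp (by fun_prop)
      · exact continuous_angle.comp (by fun_prop)
    exact continuousOn_thetaC.comp h.continuousOn fun z hz => ⟨hz.1, trivial⟩
  | succ i ih =>
    -- Continuity may be checked on words, since words map properly to the points of the level.
    have hp : IsProperMap (ofFiniteWord : Circ × P.Word (i + 1) → P.Level (i + 1)) :=
      continuous_ofFiniteWord.isProperMap
    let Q : ℝ × (Circ × P.Word (i + 1)) × (Circ × P.Word (i + 1)) →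
        ℝ × P.Level (i + 1) × P.Level (i + 1) :=
      Prod.map id (Prod.map ofFiniteWord ofFiniteWord)
    have hQp : IsProperMap Q := isProperMap_id.prodMap (hp.prodMap hp)
    have hQs : Function.Surjective Q := Function.surjective_id.prodMap
      (ofFiniteWord_surjective.prodMap ofFiniteWord_surjective)
    have hQ : IsQuotientMap Q := hQp.isClosedMap.isQuotientMap hQp.continuous hQs
    refine (hQ.continuousOn_isOpen_iff (isOpen_Ioi.prod isOpen_univ)).2 ?_
    have e : (fun z : ℝ × P.Level (i + 1) × P.Level (i + 1) =>
        P.kernel (i + 1) z.1 z.2.1 z.2.2) ∘ Q = fun z =>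
        P.kernel i z.1 (proj (Nat.le_succ i) (ofFiniteWord z.2.1))
          (proj (Nat.le_succ i) (ofFiniteWord z.2.2)) +
        P.N i * coupling z.2.1.2 z.2.2.2 * P.arcKernel (i + 1) z.1 z.2.1.1 z.2.2.1 :=
      funext fun z => kernel_succ i z.1 z.2.1 z.2.2
    rw [e]
    have hproj : Continuous fun p : Circ × P.Word (i + 1) =>
        proj (Nat.le_succ i) (ofFiniteWord p) := (continuous_proj _).comp continuous_ofFiniteWord
    refine ContinuousOn.add ?_ (ContinuousOn.mul (Continuous.continuousOn ?_) ?_)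
    · exact ih.comp (f := fun z : ℝ × (Circ × P.Word (i + 1)) × (Circ × P.Word (i + 1)) =>
        (z.1, proj (Nat.le_succ i) (ofFiniteWord z.2.1), proj (Nat.le_succ i)
          (ofFiniteWord z.2.2))) (Continuous.continuousOn (continuous_fst.prodMk
        ((hproj.comp (by fun_prop)).prodMk (hproj.comp (by fun_prop)))))
        fun z hz => ⟨hz.1, trivial⟩
    · have hc : Continuous fun u : P.Word (i + 1) × P.Word (i + 1) => coupling u.1 u.2 :=
        continuous_of_discreteTopology
      exact continuous_const.mul (hc.comp (by fun_prop : Continuous fun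
        z : ℝ × (Circ × P.Word (i + 1)) × (Circ × P.Word (i + 1)) => (z.2.1.2, z.2.2.2)))
    · exact (P.continuousOn_arcKernel i).comp
        (f := fun z : ℝ × (Circ × P.Word (i + 1)) × (Circ × P.Word (i + 1)) =>
          (z.1, z.2.1.1, z.2.2.1)) (Continuous.continuousOn (by fun_prop))
        fun z hz => ⟨hz.1, trivial⟩

open Classical in
theorem coupling_symm {i : ℕ} (w v : P.Word (i + 1)) : coupling w v = coupling v w := by
  have h : SameInit w v ↔ SameInit v w := by
    constructor <;> exact fun h l hl => (h l hl).symm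
  simp only [coupling]
  refine if_congr eq_comm rfl (if_congr h rfl rfl)

theorem kernel_symm (i : ℕ) (t : ℝ) (x y : P.Level i) : P.kernel i t x y = P.kernel i t y x := by
  induction i with
  | zero => rw [kernel_zero, kernel_zero, ← thetaC_neg, neg_sub]
  | succ i ih =>
    obtain ⟨p, rfl⟩ := ofFiniteWord_surjective x
    obtain ⟨q, rfl⟩ := ofFiniteWord_surjective y
    rw [kernel_succ, kernel_succ, ih, coupling_symm, arcKernel_symm]

/-! ### Words with one more letter -/

/-- The word `w_1 … w_i a`. -/
def snocWord {i : ℕ} (w : P.Word i) (a : Fin (P.n (i + 1))) : P.Word (i + 1) :=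
  Fin.snoc (α := fun l : Fin (i + 1) => Fin (P.n ((l : ℕ) + 1))) w a

theorem snocWord_castSucc {i : ℕ} (w : P.Word i) (a : Fin (P.n (i + 1))) (l : Fin i) :
    snocWord w a l.castSucc = w l := Fin.snoc_castSucc ..

theorem snocWord_last {i : ℕ} (w : P.Word i) (a : Fin (P.n (i + 1))) :
    snocWord w a (Fin.last i) = a := Fin.snoc_last ..

theorem exists_eq_snocWord {i : ℕ} (v : P.Word (i + 1)) :
    ∃ w a, v = snocWord w a := by
  refine ⟨fun l => v l.castSucc, v (Fin.last i), funext fun l => ?_⟩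
  induction l using Fin.lastCases with
  | last => rw [snocWord_last]
  | cast l => rw [snocWord_castSucc]

theorem sum_word_succ {i : ℕ} (F : P.Word (i + 1) → ℝ) :
    ∑ v, F v = ∑ w : P.Word i, ∑ a, F (snocWord w a) := by
  rw [← (Fin.snocEquiv fun l : Fin (i + 1) => Fin (P.n ((l : ℕ) + 1))).sum_comp,
    Fintype.sum_prod_type_right]
  rfl

theorem snocWord_eq_iff {i : ℕ} {w v : P.Word i} {a b : Fin (P.n (i + 1))} :
    snocWord w a = snocWord v b ↔ w = v ∧ a = b := by
  constructor
  · intro h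
    refine ⟨funext fun l => ?_, ?_⟩
    · rw [← snocWord_castSucc w a l, h, snocWord_castSucc]
    · rw [← snocWord_last w a, h, snocWord_last]
  · rintro ⟨rfl, rfl⟩; rfl

theorem sameInit_snocWord {i : ℕ} {w v : P.Word i} {a b : Fin (P.n (i + 1))} :
    SameInit (snocWord w a) (snocWord v b) ↔ w = v := by
  constructor
  · intro h
    funext l
    have := h l.castSucc (by simp)
    rwa [snocWord_castSucc, snocWord_castSucc] at this
  · rintro rfl l hl
    induction l using Fin.lastCases with
    | last => simp at hl
    | cast l => rw [snocWord_castSucc, snocWord_castSucc]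

open Classical in
theorem coupling_snocWord {i : ℕ} (w v : P.Word i) (a b : Fin (P.n (i + 1))) :
    coupling (snocWord w a) (snocWord v b) =
      if w = v then (if a = b then (P.n (i + 1) : ℝ) else 0) - 1 else 0 := by
  simp only [coupling, snocWord_eq_iff, sameInit_snocWord]
  by_cases h : w = v <;> by_cases h' : a = b <;> simp [h, h']

theorem proj_snocWord {i : ℕ} (η : Circ) (w : P.Word i) (a : Fin (P.n (i + 1))) :
    proj (Nat.le_succ i) (ofFiniteWord (η, snocWord w a)) = ofFiniteWord (η, w) := by
  change ofFiniteWord (η, fun l : Fin i => snocWord w a l.castSucc) = _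
  simp only [snocWord_castSucc]

/-- The map `F_i → F_{i+1}` that appends the letter `a`. -/
def addLetter {i : ℕ} (a : Fin (P.n (i + 1))) (x : P.Level i) : P.Level (i + 1) :=
  Quotient.map (sa := P.levelSetoid i) (sb := P.levelSetoid (i + 1))
    (fun p : Circ × P.Word i => ((p.1, snocWord p.2 a) : Circ × P.Word (i + 1)))
    (fun p q h => ⟨h.1, fun l hl => by
      induction l using Fin.lastCases with
      | last => simp only [snocWord_last]
      | cast l => simp only [snocWord_castSucc]; exact h.2 l hl⟩) x

theorem addLetter_ofFiniteWord {i : ℕ} (a : Fin (P.n (i + 1))) (η : Circ) (w : P.Word i) :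
    addLetter a (ofFiniteWord (η, w)) = ofFiniteWord (η, snocWord w a) := rfl

theorem continuous_snocWord {i : ℕ} (a : Fin (P.n (i + 1))) :
    Continuous fun w : P.Word i => snocWord w a := continuous_of_discreteTopology

theorem continuous_addLetter {i : ℕ} (a : Fin (P.n (i + 1))) :
    Continuous (addLetter a : P.Level i → _) := by
  refine Continuous.quotient_lift (continuous_ofFiniteWord.comp ?_) _
  exact continuous_fst.prodMk ((continuous_snocWord a).comp continuous_snd)

theorem proj_addLetter {i : ℕ} (a : Fin (P.n (i + 1))) (x : P.Level i) :
    proj (Nat.le_succ i) (addLetter a x) = x := by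
  obtain ⟨p, rfl⟩ := ofFiniteWord_surjective x
  exact proj_snocWord p.1 p.2 a

/-- The average of a function on `F_{i+1}` over the last letter, as a function on `F_i`. -/
def fiberAvg {i : ℕ} (f : P.Level (i + 1) → ℝ) (x : P.Level i) : ℝ :=
  (P.n (i + 1) : ℝ)⁻¹ * ∑ a, f (addLetter a x)

theorem continuous_fiberAvg {i : ℕ} {f : P.Level (i + 1) → ℝ} (hf : Continuous f) :
    Continuous (fiberAvg f) :=
  continuous_const.mul (continuous_finsetSum _ fun a _ => hf.comp (continuous_addLetter a))

theorem fiberAvg_comp_proj {i : ℕ} (h : P.Level i → ℝ) :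
    fiberAvg (fun x => h (proj (Nat.le_succ i) x)) = h := by
  funext x
  have := (P.n_pos' i).ne'
  simp [fiberAvg, proj_addLetter, this]

/-- The fluctuation of `f` about its average over the last letter. -/
def fluct {i : ℕ} (f : P.Level (i + 1) → ℝ) (w : P.Word i) (a : Fin (P.n (i + 1)))
    (ζ : Circ) : ℝ :=
  f (ofFiniteWord (ζ, snocWord w a)) - fiberAvg f (ofFiniteWord (ζ, w))

theorem continuous_word_section {i : ℕ} (w : P.Word i) :
    Continuous fun ζ : Circ => (ofFiniteWord (ζ, w) : P.Level i) :=
  continuous_ofFiniteWord.comp (by fun_prop)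

theorem continuous_fluct {i : ℕ} {f : P.Level (i + 1) → ℝ} (hf : Continuous f) (w : P.Word i)
    (a : Fin (P.n (i + 1))) : Continuous (fluct f w a) :=
  (hf.comp (continuous_word_section _)).sub
    ((continuous_fiberAvg hf).comp (continuous_word_section _))

theorem fluct_of_mem_grid {i : ℕ} (f : P.Level (i + 1) → ℝ) (w : P.Word i)
    (a : Fin (P.n (i + 1))) {ζ : Circ} (h : ζ ∈ P.grid (i + 1)) : fluct f w a ζ = 0 := by
  have e : ∀ b, (ofFiniteWord (ζ, snocWord w b) : P.Level (i + 1)) =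
      ofFiniteWord (ζ, snocWord w a) := by
    intro b
    refine ofFiniteWord_eq_iff.2 ⟨rfl, fun l hl => ?_⟩
    induction l using Fin.lastCases with
    | last => exact absurd h hl
    | cast l => simp only [snocWord_castSucc]
  have := (P.n_pos' i).ne'
  simp [fluct, fiberAvg, addLetter_ofFiniteWord, e, this]

theorem sum_fluct {i : ℕ} (f : P.Level (i + 1) → ℝ) (w : P.Word i) (ζ : Circ) :
    ∑ a, fluct f w a ζ = 0 := by
  have := (P.n_pos' i).ne'
  simp [fluct, fiberAvg, addLetter_ofFiniteWord, this]

/-- The heat operator of `F_{i+1}` acts on the average over the last letter as that of `F_i`,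
and on the fluctuation about the average as the Dirichlet semigroup of the arcs. -/
theorem heatOp_succ {i : ℕ} {t : ℝ} (ht : 0 < t) {f : P.Level (i + 1) → ℝ} (hf : Continuous f)
    (η : Circ) (w : P.Word i) (a : Fin (P.n (i + 1))) :
    heatOp (P.levelMeasure (i + 1)) (P.kernel (i + 1)) t f (ofFiniteWord (η, snocWord w a)) =
      heatOp (P.levelMeasure i) (P.kernel i) t (fiberAvg f) (ofFiniteWord (η, w)) +
      P.arcOp (i + 1) t (fluct f w a) η := by
  classical
  have hN := (P.N_pos' i).ne'
  have hn := (P.n_pos' i).ne'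
  have hk1 := continuous_kernel_section (continuousOn_kernel (P := P) (i + 1)) ht
    (ofFiniteWord (η, snocWord w a))
  have hk := continuous_kernel_section (continuousOn_kernel (P := P) i) ht (ofFiniteWord (η, w))
  have hK := P.continuous_arcKernel_section i ht η
  have hfs : ∀ v b, Continuous fun ζ : Circ => f (ofFiniteWord (ζ, snocWord v b)) := fun v b =>
    hf.comp (continuous_word_section _)
  have hks : ∀ v, Continuous fun ζ : Circ => P.kernel i t (ofFiniteWord (η, w))
      (ofFiniteWord (ζ, v)) := fun v => hk.comp (continuous_word_section _)
  have hkf : ∀ v b, Continuous fun ζ : Circ => P.kernel i t (ofFiniteWord (η, w))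
      (ofFiniteWord (ζ, v)) * f (ofFiniteWord (ζ, snocWord v b)) := fun v b =>
    (hks v).mul (hfs v b)
  have hKf : ∀ v b, Continuous fun ζ : Circ => P.arcKernel (i + 1) t η ζ *
      f (ofFiniteWord (ζ, snocWord v b)) := fun v b => hK.mul (hfs v b)
  set A : P.Word i → Fin (P.n (i + 1)) → ℝ := fun v b =>
    ∫ ζ : Circ, P.kernel i t (ofFiniteWord (η, w)) (ofFiniteWord (ζ, v)) *
      f (ofFiniteWord (ζ, snocWord v b)) with hA
  set B : P.Word i → Fin (P.n (i + 1)) → ℝ := fun v b =>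
    ∫ ζ : Circ, P.arcKernel (i + 1) t η ζ * f (ofFiniteWord (ζ, snocWord v b)) with hB
  have h1 : heatOp (P.levelMeasure (i + 1)) (P.kernel (i + 1)) t f
      (ofFiniteWord (η, snocWord w a)) = (P.N i * P.n (i + 1) : ℝ)⁻¹ *
        ∑ v : P.Word i, ∑ b, (A v b + P.N i *
          (if w = v then (if a = b then (P.n (i + 1) : ℝ) else 0) - 1 else 0) * B v b) := by
    have hc : Continuous fun y => P.kernel (i + 1) t (ofFiniteWord (η, snocWord w a)) y * f y :=
      hk1.mul hf
    rw [heatOp, integral_levelMeasure _ _ hc, N_succ, sum_word_succ]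
    push_cast
    congr 1
    refine Finset.sum_congr rfl fun v _ => Finset.sum_congr rfl fun b _ => ?_
    simp only [kernel_succ, proj_snocWord, coupling_snocWord, add_mul, hA, hB]
    rw [← integral_const_mul, ← integral_add (integrable_of_continuous (hkf v b))
      ((integrable_of_continuous (hKf v b)).const_mul _)]
    simp only [mul_assoc]
  have h2 : heatOp (P.levelMeasure i) (P.kernel i) t (fiberAvg f) (ofFiniteWord (η, w)) =
      (P.N i : ℝ)⁻¹ * ∑ v : P.Word i, (P.n (i + 1) : ℝ)⁻¹ * ∑ b, A v b := by
    have hc : Continuous fun y => P.kernel i t (ofFiniteWord (η, w)) y * fiberAvg f y :=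
      hk.mul (continuous_fiberAvg hf)
    rw [heatOp, integral_levelMeasure _ _ hc]
    congr 1
    refine Finset.sum_congr rfl fun v _ => ?_
    rw [← integral_finsetSum _ fun b _ => integrable_of_continuous (hkf v b), ← integral_const_mul]
    congr 1
    funext ζ
    rw [fiberAvg, ← Finset.mul_sum]
    simp only [addLetter_ofFiniteWord]
    ring
  have h3 : P.arcOp (i + 1) t (fluct f w a) η =
      B w a - (P.n (i + 1) : ℝ)⁻¹ * ∑ b, B w b := by
    rw [← integral_finsetSum _ fun b _ => integrable_of_continuous (hKf w b),
      ← integral_const_mul, ← integral_sub (integrable_of_continuous (hKf w a))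
      ((integrable_of_continuous (continuous_finsetSum _ fun b _ => hKf w b)).const_mul _), arcOp]
    congr 1
    funext ζ
    rw [fluct, fiberAvg, ← Finset.mul_sum]
    simp only [addLetter_ofFiniteWord]
    ring
  have h4 : ∀ v : P.Word i, ∑ b, P.N i *
      (if w = v then (if a = b then (P.n (i + 1) : ℝ) else 0) - 1 else 0) * B v b =
      if w = v then P.N i * (P.n (i + 1) * B v a - ∑ b, B v b) else 0 := by
    intro v
    split_ifs with h
    · simp [mul_assoc, sub_mul, ite_mul, Finset.sum_sub_distrib, ← Finset.mul_sum]
    · simp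
  rw [h1, h2, h3]
  simp only [Finset.sum_add_distrib, h4, Finset.sum_ite_eq, Finset.mem_univ, if_true,
    ← Finset.mul_sum]
  field_simp

end Params
namespace Params

variable {P : Params}

/-! ### Conservativeness, compatibility and strong continuity on the levels -/

/-- On `F_0` the heat semigroup is that of the circle. -/
theorem heatOp_zero (t : ℝ) (f : P.Level 0 → ℝ) (hf : Continuous f) (ht : 0 < t) (a : ℝ)
    (w : P.Word 0) : heatOp (P.levelMeasure 0) (P.kernel 0) t f (ofFiniteWord ((a : Circ), w)) =
      circOp t (fun b : ℝ => f (ofFiniteWord ((b : Circ), w))) a := by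
  have hc : Continuous fun y => P.kernel 0 t (ofFiniteWord ((a : Circ), w)) y * f y :=
    (continuous_kernel_section (continuousOn_kernel (P := P) 0) ht _).mul hf
  rw [heatOp, integral_levelMeasure _ _ hc, N_zero, Fintype.sum_subsingleton _ w, circOp,
    ← AddCircle.intervalIntegral_preimage (2 * Real.pi) 0, zero_add]
  simp only [Nat.cast_one, inv_one, one_mul, kernel_zero, angle_ofFiniteWord,
    ← AddCircle.coe_sub, thetaC_coe]

theorem continuous_circ_section {i : ℕ} {f : P.Level i → ℝ} (hf : Continuous f) (w : P.Word i) :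
    Continuous fun b : ℝ => f (ofFiniteWord ((b : Circ), w)) :=
  (hf.comp (continuous_word_section w)).comp (AddCircle.continuous_mk' _)

theorem periodic_circ_section {i : ℕ} (f : P.Level i → ℝ) (w : P.Word i) :
    Function.Periodic (fun b : ℝ => f (ofFiniteWord ((b : Circ), w))) (2 * Real.pi) := by
  intro b
  simp only [AddCircle.coe_add_period]

theorem level_succ_cases {i : ℕ} {p : P.Level (i + 1) → Prop}
    (h : ∀ η w a, p (ofFiniteWord (η, snocWord w a))) (x : P.Level (i + 1)) : p x := by
  obtain ⟨⟨η, v⟩, rfl⟩ := ofFiniteWord_surjective x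
  obtain ⟨w, a, rfl⟩ := exists_eq_snocWord v
  exact h η w a

theorem arcOp_zero (l : ℕ) (t : ℝ) (η : Circ) : P.arcOp l t (fun _ => 0) η = 0 := by
  simp [arcOp]

theorem heatOp_comp_proj_succ {i : ℕ} {t : ℝ} (ht : 0 < t) {h : P.Level i → ℝ}
    (hh : Continuous h) (x : P.Level (i + 1)) :
    heatOp (P.levelMeasure (i + 1)) (P.kernel (i + 1)) t
      (fun y => h (proj (Nat.le_succ i) y)) x =
    heatOp (P.levelMeasure i) (P.kernel i) t h (proj (Nat.le_succ i) x) := by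
  obtain ⟨⟨η, v⟩, rfl⟩ := ofFiniteWord_surjective x
  obtain ⟨w, a, rfl⟩ := exists_eq_snocWord v
  have hz : fluct (fun y => h (proj (Nat.le_succ i) y)) w a = fun _ => 0 := by
    funext ζ
    rw [fluct, fiberAvg_comp_proj, proj_snocWord, sub_self]
  have hc : Continuous fun y : P.Level (i + 1) => h (proj (Nat.le_succ i) y) :=
    hh.comp (continuous_proj _)
  rw [heatOp_succ ht hc, fiberAvg_comp_proj, proj_snocWord, hz,
    arcOp_zero, add_zero]

theorem proj_rfl {i : ℕ} (x : P.Level i) : proj le_rfl x = x := by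
  obtain ⟨p, rfl⟩ := ofFiniteWord_surjective x
  rfl

/-- The heat semigroups of the levels are compatible with the projections. -/
theorem heatOp_comp_proj {k i : ℕ} (hki : k ≤ i) {t : ℝ} (ht : 0 < t) {h : P.Level k → ℝ}
    (hh : Continuous h) (x : P.Level i) :
    heatOp (P.levelMeasure i) (P.kernel i) t (fun y => h (proj hki y)) x =
    heatOp (P.levelMeasure k) (P.kernel k) t h (proj hki x) := by
  induction i, hki using Nat.le_induction with
  | base => simp only [proj_rfl]
  | succ i hki ih =>
    have := heatOp_comp_proj_succ ht (hh.comp (continuous_proj hki)) x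
    simp only [Function.comp_apply, proj_proj] at this
    rw [this]
    exact (ih (proj (Nat.le_succ i) x)).trans (by rw [proj_proj])

theorem integral_kernel (i : ℕ) {t : ℝ} (ht : 0 < t) (x : P.Level i) :
    ∫ y, P.kernel i t x y ∂P.levelMeasure i = 1 := by
  have h := heatOp_comp_proj (Nat.zero_le i) ht
    (continuous_const : Continuous fun _ : P.Level 0 => (1 : ℝ)) x
  obtain ⟨⟨η, w⟩, hx⟩ := ofFiniteWord_surjective (proj (Nat.zero_le i) x)
  obtain ⟨a, -, rfl⟩ := AddCircle.eq_coe_Ico η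
  rw [← hx, heatOp_zero t _ continuous_const ht, circOp_const ht] at h
  simpa [heatOp] using h

theorem eventually_abs_heatOp_sub_le (i : ℕ) {f : P.Level i → ℝ} (hf : Continuous f) {ε : ℝ}
    (hε : 0 < ε) : ∀ᶠ t in 𝓝[>] (0 : ℝ), ∀ x,
      |heatOp (P.levelMeasure i) (P.kernel i) t f x - f x| ≤ ε := by
  induction i generalizing ε with
  | zero =>
    have w : P.Word 0 := fun l => l.elim0
    filter_upwards [eventually_abs_circOp_sub_le (continuous_circ_section hf w)
      (periodic_circ_section f w) hε, self_mem_nhdsWithin] with t h ht x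
    obtain ⟨⟨η, w'⟩, rfl⟩ := ofFiniteWord_surjective x
    obtain ⟨a, -, rfl⟩ := AddCircle.eq_coe_Ico η
    obtain rfl := Subsingleton.elim w' w
    rw [heatOp_zero t f hf ht]
    exact h a
  | succ i ih =>
    have h2 : ∀ᶠ t in 𝓝[>] (0 : ℝ), ∀ (w : P.Word i) (a : Fin (P.n (i + 1))), ∀ η,
        |P.arcOp (i + 1) t (fluct f w a) η - fluct f w a η| ≤ ε / 2 := by
      rw [eventually_all]
      intro w
      rw [eventually_all]
      exact fun a => eventually_abs_arcOp_sub_le (continuous_fluct hf w a)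
        (fun _ h => fluct_of_mem_grid f w a h) (half_pos hε)
    filter_upwards [ih (continuous_fiberAvg hf) (half_pos hε), h2, self_mem_nhdsWithin]
      with t h1 h2 ht
    refine level_succ_cases fun η w a => ?_
    rw [heatOp_succ ht hf]
    have h3 := abs_le.1 (h1 (ofFiniteWord (η, w)))
    have h4 := abs_le.1 (h2 w a η)
    rw [fluct] at h4
    rw [abs_le]
    constructor <;> linarith [h3.1, h3.2, h4.1, h4.2]

/-! ### Piecewise differentiable functions on the circle -/

/-- On every closed arc whose interior contains no point of `S`, the function agrees with a
differentiable function. -/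
def PiecewiseDiff (S : Set Circ) (u : Circ → ℝ) : Prop :=
  ∀ (η : Circ) (δ : ℝ), (∀ s ∈ Set.Ioo 0 δ, η + (s : Circ) ∉ S) →
    ∃ V : ℝ → ℝ, Differentiable ℝ V ∧ ∀ s ∈ Set.Icc 0 δ, u (η + (s : Circ)) = V s

/-- The right derivative of a function on the circle. -/
def rightDeriv (u : Circ → ℝ) (η : Circ) : ℝ :=
  derivWithin (fun s : ℝ => u (η + (s : Circ))) (Set.Ici 0) 0

/-- The left derivative of a function on the circle. -/
def leftDeriv (u : Circ → ℝ) (η : Circ) : ℝ :=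
  derivWithin (fun s : ℝ => u (η + (s : Circ))) (Set.Iic 0) 0

/-- Every point of the circle has a punctured neighbourhood that avoids `S`. -/
def Isolated (S : Set Circ) : Prop := ∀ η : Circ, ∀ᶠ s : ℝ in 𝓝[≠] 0, η + (s : Circ) ∉ S

section

variable {S : Set Circ} {u : Circ → ℝ}

theorem Isolated.exists_pos (hS : Isolated S) (η : Circ) :
    ∃ δ > 0, ∀ s : ℝ, s ≠ 0 → |s| < δ → η + (s : Circ) ∉ S := by
  obtain ⟨δ, hδ, h⟩ := Metric.mem_nhdsWithin_iff.1 (hS η)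
  exact ⟨δ, hδ, fun s hs hs' => h ⟨by simpa using hs', hs⟩⟩

theorem PiecewiseDiff.right (hu : PiecewiseDiff S u) (hS : Isolated S) (η : Circ) :
    DifferentiableWithinAt ℝ (fun s : ℝ => u (η + (s : Circ))) (Set.Ici 0) 0 := by
  obtain ⟨δ, hδ, h⟩ := hS.exists_pos η
  obtain ⟨V, hV, hVu⟩ := hu η δ fun s hs => h s hs.1.ne' (by rw [abs_of_pos hs.1]; exact hs.2)
  refine (hV 0).differentiableWithinAt.congr_of_eventuallyEq ?_ (hVu 0 ⟨le_rfl, hδ.le⟩)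
  filter_upwards [Icc_mem_nhdsGE hδ] with s hs using hVu s hs

theorem PiecewiseDiff.left (hu : PiecewiseDiff S u) (hS : Isolated S) (η : Circ) :
    DifferentiableWithinAt ℝ (fun s : ℝ => u (η + (s : Circ))) (Set.Iic 0) 0 := by
  obtain ⟨δ, hδ, h⟩ := hS.exists_pos η
  have e : ∀ s : ℝ, η + ((-δ : ℝ) : Circ) + ((s + δ : ℝ) : Circ) = η + (s : Circ) := by
    intro s; rw [add_assoc, ← AddCircle.coe_add]; congr 2; ring
  obtain ⟨V, hV, hVu⟩ := hu (η + ((-δ : ℝ) : Circ)) δ fun s hs => by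
    have := h (s - δ) (by linarith [hs.2]) (by rw [abs_lt]; constructor <;> linarith [hs.1, hs.2])
    rwa [← e, sub_add_cancel] at this
  have hVu' : ∀ s ∈ Set.Icc (-δ) 0, u (η + (s : Circ)) = V (s + δ) := fun s hs => by
    rw [← e]; exact hVu _ ⟨by linarith [hs.1], by linarith [hs.2]⟩
  have hV' : Differentiable ℝ fun s => V (s + δ) := hV.comp (by fun_prop)
  refine (hV' 0).differentiableWithinAt.congr_of_eventuallyEq ?_ (hVu' 0 ⟨by linarith, le_rfl⟩)
  filter_upwards [Icc_mem_nhdsLE (neg_lt_zero.2 hδ)] with s hs using hVu' s hs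

theorem PiecewiseDiff.rightDeriv_eq_leftDeriv (hu : PiecewiseDiff S u) (hS : Isolated S) {η : Circ}
    (hη : η ∉ S) : rightDeriv u η = leftDeriv u η := by
  obtain ⟨δ, hδ, h⟩ := hS.exists_pos η
  have e : ∀ s : ℝ, η + ((-δ : ℝ) : Circ) + ((s + δ : ℝ) : Circ) = η + (s : Circ) := by
    intro s; rw [add_assoc, ← AddCircle.coe_add]; congr 2; ring
  obtain ⟨V, hV, hVu⟩ := hu (η + ((-δ : ℝ) : Circ)) (2 * δ) fun s hs => by
    rw [show s = (s - δ) + δ by ring, e]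
    by_cases h0 : s - δ = 0
    · rw [h0, AddCircle.coe_zero, add_zero]; exact hη
    · exact h (s - δ) h0 (by rw [abs_lt]; constructor <;> linarith [hs.1, hs.2])
  have hVu' : ∀ s ∈ Set.Icc (-δ) δ, u (η + (s : Circ)) = V (s + δ) := fun s hs => by
    rw [← e]; exact hVu _ ⟨by linarith [hs.1], by linarith [hs.2]⟩
  have hV' : Differentiable ℝ fun s => V (s + δ) := hV.comp (by fun_prop)
  have hd : DifferentiableAt ℝ (fun s : ℝ => u (η + (s : Circ))) 0 := by
    refine (hV' 0).congr_of_eventuallyEq ?_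
    filter_upwards [Icc_mem_nhds (neg_lt_zero.2 hδ) hδ] with s hs using hVu' s hs
  rw [rightDeriv, leftDeriv, hd.derivWithin (uniqueDiffWithinAt_Ici 0),
    hd.derivWithin (uniqueDiffWithinAt_Iic 0)]

end

/-! ### Local solutions of the heat equation on the levels -/

variable (P) in
/-- The angles of the end points of the `i`-cells, except that the circle `F_0` is not cut. -/
def vertexSet : ℕ → Set Circ
  | 0 => ∅
  | i + 1 => P.grid (i + 1)

theorem vertexSet_subset (i : ℕ) : P.vertexSet i ⊆ P.grid (i + 1) := by
  cases i with
  | zero => exact Set.empty_subset _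
  | succ i => exact P.grid_mono (by omega)

theorem isolated_grid (l : ℕ) : Isolated (P.grid l) := by
  intro η
  have hJ := P.J_pos' l
  obtain ⟨a, -, rfl⟩ := AddCircle.eq_coe_Ico η
  have hd : HasDerivAt (fun s : ℝ => Real.sin (P.J l * (a + s)))
      (Real.cos (P.J l * (a + 0)) * (P.J l * 1)) 0 :=
    (((hasDerivAt_id (0 : ℝ)).const_add a).const_mul (P.J l : ℝ)).sin
  have h : ∀ᶠ s : ℝ in 𝓝[≠] 0, Real.sin (P.J l * (a + s)) ≠ 0 := by
    by_cases h0 : Real.sin (P.J l * (a + 0)) = 0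
    · refine hd.eventually_ne (mul_ne_zero (fun hc => ?_) (by simpa using hJ.ne'))
      have := Real.sin_sq_add_cos_sq (P.J l * (a + 0))
      rw [h0, hc] at this
      norm_num at this
    · exact (hd.continuousAt.eventually_ne h0).filter_mono nhdsWithin_le_nhds
  filter_upwards [h] with s hs hmem
  rw [← AddCircle.coe_add] at hmem
  have := (P.gridSin_eq_zero_iff l _).2 hmem
  rw [gridSin_coe] at this
  exact hs this

theorem isolated_vertexSet (i : ℕ) : Isolated (P.vertexSet i) := fun η =>
  (isolated_grid (i + 1) η).mono fun _ h h' => h (vertexSet_subset i h')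

/-- On every closed arc without vertices in its interior, and for every word, `T_t f` is the
restriction of a solution of the heat equation on the line. -/
theorem exists_isHeatSol (i : ℕ) {f : P.Level i → ℝ} (hf : Continuous f) (w : P.Word i)
    (η : Circ) {δ : ℝ} (hfree : ∀ s ∈ Set.Ioo 0 δ, η + (s : Circ) ∉ P.vertexSet i) :
    ∃ V, IsHeatSol V ∧ ∀ t, 0 < t → ∀ s ∈ Set.Icc 0 δ,
      heatOp (P.levelMeasure i) (P.kernel i) t f (ofFiniteWord (η + (s : Circ), w)) = V t s := by
  induction i with
  | zero =>
    have h := (isHeatSol_circOp (continuous_circ_section hf w)).comp_affine one_pos (carg η)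
    refine ⟨_, h, fun t ht s _ => ?_⟩
    rw [← coe_carg η, ← AddCircle.coe_add, heatOp_zero t f hf ht]
    rw [coe_carg]
    congr 1
    · ring
    · ring
  | succ i ih =>
    obtain ⟨w, a, rfl⟩ := exists_eq_snocWord w
    obtain ⟨V, hV, hVu⟩ := ih (continuous_fiberAvg hf) w
      fun s hs h => hfree s hs (vertexSet_subset i h)
    obtain ⟨W, hW, hWu⟩ := exists_isHeatSol_arcOp (continuous_fluct hf w a)
      (fun _ h => fluct_of_mem_grid f w a h) η hfree
    refine ⟨_, hV.add hW, fun t ht s hs => ?_⟩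
    rw [heatOp_succ ht hf, hVu t ht s hs, hWu t ht s hs]

theorem piecewiseDiff_heatOp (i : ℕ) {f : P.Level i → ℝ} (hf : Continuous f) {t : ℝ} (ht : 0 < t)
    (w : P.Word i) : PiecewiseDiff (P.vertexSet i) fun ζ =>
      heatOp (P.levelMeasure i) (P.kernel i) t f (ofFiniteWord (ζ, w)) := by
  intro η δ h
  obtain ⟨V, hV, hVu⟩ := exists_isHeatSol i hf w η h
  exact ⟨V t, (hV.smooth t ht).differentiable two_ne_zero, hVu t ht⟩

theorem piecewiseDiff_arcOp {i : ℕ} {g : Circ → ℝ} (hg : Continuous g)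
    (hg0 : ∀ η ∈ P.grid (i + 1), g η = 0) {t : ℝ} (ht : 0 < t) :
    PiecewiseDiff (P.grid (i + 1)) (P.arcOp (i + 1) t g) := by
  intro η δ h
  obtain ⟨V, hV, hVu⟩ := exists_isHeatSol_arcOp hg hg0 η h
  exact ⟨V t, (hV.smooth t ht).differentiable two_ne_zero, hVu t ht⟩

/-! ### The Kirchhoff condition -/

/-- The fluctuations cancel when summed over the last letter, and so do their images under the
Dirichlet semigroup. -/
theorem sum_arcOp_fluct {i : ℕ} {f : P.Level (i + 1) → ℝ} (hf : Continuous f) (w : P.Word i)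
    {t : ℝ} (ht : 0 < t) (η : Circ) : ∑ a, P.arcOp (i + 1) t (fluct f w a) η = 0 := by
  have hc : ∀ a, Continuous fun ζ => P.arcKernel (i + 1) t η ζ * fluct f w a ζ := fun a =>
    (P.continuous_arcKernel_section i ht η).mul (continuous_fluct hf w a)
  simp only [arcOp]
  rw [← integral_finsetSum _ fun a _ => integrable_of_continuous (hc a)]
  simp only [← Finset.mul_sum, sum_fluct, mul_zero, integral_zero]

open Classical in
/-- The Kirchhoff condition in terms of words: at each point, the right derivatives along the words
of the point and the left derivatives along these words have the same sum. -/
theorem sum_rightDeriv_eq_sum_leftDeriv (i : ℕ) {f : P.Level i → ℝ} (hf : Continuous f) {t : ℝ}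
    (ht : 0 < t) (η : Circ) (w₀ : P.Word i) :
    (∑ w : P.Word i, if ofFiniteWord (η, w) = ofFiniteWord (η, w₀) then
      rightDeriv (fun ζ => heatOp (P.levelMeasure i) (P.kernel i) t f (ofFiniteWord (ζ, w))) η
      else 0) =
    ∑ w : P.Word i, if ofFiniteWord (η, w) = ofFiniteWord (η, w₀) then
      leftDeriv (fun ζ => heatOp (P.levelMeasure i) (P.kernel i) t f (ofFiniteWord (ζ, w))) η
      else 0 := by
  induction i with
  | zero =>
    refine Finset.sum_congr rfl fun w _ => ?_
    rw [(piecewiseDiff_heatOp 0 hf ht w).rightDeriv_eq_leftDeriv (isolated_vertexSet 0)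
      (Set.notMem_empty η)]
  | succ i ih =>
    obtain ⟨w₀, a₀, rfl⟩ := exists_eq_snocWord w₀
    set U : P.Word i → Circ → ℝ := fun w ζ =>
      heatOp (P.levelMeasure i) (P.kernel i) t (fiberAvg f) (ofFiniteWord (ζ, w)) with hU
    have IH : (∑ w : P.Word i, if ofFiniteWord (η, w) = ofFiniteWord (η, w₀) then
        rightDeriv (U w) η else 0) = ∑ w : P.Word i,
          if ofFiniteWord (η, w) = ofFiniteWord (η, w₀) then leftDeriv (U w) η else 0 :=
      ih (continuous_fiberAvg hf) w₀
    set A : P.Word i → Fin (P.n (i + 1)) → Circ → ℝ := fun w a =>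
      P.arcOp (i + 1) t (fluct f w a) with hA
    have hUd : ∀ w, PiecewiseDiff (P.vertexSet i) (U w) := fun w =>
      piecewiseDiff_heatOp i (continuous_fiberAvg hf) ht w
    have hAd : ∀ w a, PiecewiseDiff (P.grid (i + 1)) (A w a) := fun w a =>
      piecewiseDiff_arcOp (continuous_fluct hf w a) (fun _ h => fluct_of_mem_grid f w a h) ht
    have e : ∀ w a, (fun ζ => heatOp (P.levelMeasure (i + 1)) (P.kernel (i + 1)) t f
        (ofFiniteWord (ζ, snocWord w a))) = fun ζ => U w ζ + A w a ζ := fun w a =>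
      funext fun ζ => heatOp_succ ht hf ζ w a
    have hR : ∀ w a, rightDeriv (fun ζ => U w ζ + A w a ζ) η =
        rightDeriv (U w) η + rightDeriv (A w a) η := fun w a =>
      derivWithin_fun_add ((hUd w).right (isolated_vertexSet i) η)
        ((hAd w a).right (isolated_grid (i + 1)) η)
    have hL : ∀ w a, leftDeriv (fun ζ => U w ζ + A w a ζ) η =
        leftDeriv (U w) η + leftDeriv (A w a) η := fun w a =>
      derivWithin_fun_add ((hUd w).left (isolated_vertexSet i) η)
        ((hAd w a).left (isolated_grid (i + 1)) η)
    have hcond : ∀ w a, ofFiniteWord (η, snocWord w a) = ofFiniteWord (η, snocWord w₀ a₀) ↔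
        ofFiniteWord (η, w) = ofFiniteWord (η, w₀) ∧ (η ∉ P.grid (i + 1) → a = a₀) := by
      intro w a
      simp only [ofFiniteWord_succ_eq_iff, proj_snocWord, angle_ofFiniteWord, snocWord_last]
    rw [sum_word_succ, sum_word_succ]
    simp only [e, hR, hL, hcond]
    by_cases hη : η ∈ P.grid (i + 1)
    · -- All last letters occur, and the contributions of the fluctuations cancel.
      have hA0 : ∀ w, (fun s : ℝ => ∑ a, A w a (η + (s : Circ))) = fun _ => 0 := fun w =>
        funext fun s => sum_arcOp_fluct hf w ht _
      have hAR : ∀ w, ∑ a, rightDeriv (A w a) η = 0 := by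
        intro w
        have := derivWithin_fun_sum (u := Finset.univ)
          (A := fun a (s : ℝ) => A w a (η + (s : Circ))) (s := Set.Ici (0 : ℝ)) (x := 0)
          fun a _ => (hAd w a).right (isolated_grid (i + 1)) η
        rw [hA0] at this
        simpa [rightDeriv] using this.symm
      have hAL : ∀ w, ∑ a, leftDeriv (A w a) η = 0 := by
        intro w
        have := derivWithin_fun_sum (u := Finset.univ)
          (A := fun a (s : ℝ) => A w a (η + (s : Circ))) (s := Set.Iic (0 : ℝ)) (x := 0)
          fun a _ => (hAd w a).left (isolated_grid (i + 1)) η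
        rw [hA0] at this
        simpa [leftDeriv] using this.symm
      have hsum : ∀ (p : Prop) [Decidable p] (c : ℝ) (b : Fin (P.n (i + 1)) → ℝ), ∑ a, b a = 0 →
          (∑ a, if p then c + b a else 0) = P.n (i + 1) * if p then c else 0 := by
        intro p _ c b hb
        split_ifs <;> simp [Finset.sum_add_distrib, hb]
      simp only [hη, not_true_eq_false, false_imp_iff, and_true]
      simp only [hsum _ _ _ (hAR _), hsum _ _ _ (hAL _), ← Finset.mul_sum, IH]
    · -- The last letter is determined, and the fluctuation is differentiable.
      have hAe : ∀ w a, rightDeriv (A w a) η = leftDeriv (A w a) η := fun w a =>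
        (hAd w a).rightDeriv_eq_leftDeriv (isolated_grid (i + 1)) hη
      have hsum : ∀ (p : Prop) [Decidable p] (c : ℝ) (b : Fin (P.n (i + 1)) → ℝ),
          (∑ a, if p ∧ a = a₀ then c + b a else 0) =
            (if p then c else 0) + if p then b a₀ else 0 := by
        intro p _ c b
        by_cases hp : p <;> simp [hp]
      simp only [hη, not_false_eq_true, forall_true_left]
      simp only [hsum, Finset.sum_add_distrib, hAe, IH]

end Params
namespace Params

variable {P : Params}

/-! ### The heat equation on the levels -/

theorem cellMap_eq {i : ℕ} (α : P.Cell i) (θ : ℝ) : cellMap α θ =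
    ofFiniteWord ((((α.1 : ℕ) * P.L i : ℝ) : Circ) + (θ : Circ), α.2) := by
  rw [cellMap, AddCircle.coe_add]

/-- The interior of a cell contains no vertex. -/
theorem coe_add_notMem_vertexSet (i : ℕ) (m : ℕ) {s : ℝ} (hs : s ∈ Set.Ioo 0 (P.L i)) :
    ((m * P.L i : ℝ) : Circ) + (s : Circ) ∉ P.vertexSet i := by
  cases i with
  | zero => exact Set.notMem_empty _
  | succ i =>
    rw [← AddCircle.coe_add]
    intro h
    obtain ⟨k, hk⟩ := (P.coe_mem_grid_iff (i + 1) _).1 h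
    have hJ := P.J_pos' (i + 1)
    have hL := P.J_mul_L i
    have hpi := Real.pi_pos
    have h1 : ((k : ℝ) - m) * Real.pi = P.J (i + 1) * s := by
      linear_combination hk + (m : ℝ) * hL
    have h2 : 0 < (P.J (i + 1) : ℝ) * s := mul_pos hJ hs.1
    have h3 : (P.J (i + 1) : ℝ) * s < Real.pi := by
      rw [← hL]; exact mul_lt_mul_of_pos_left hs.2 hJ
    have h4 : (0 : ℝ) < (k : ℝ) - m := by
      by_contra! hneg
      nlinarith
    have h5 : (k : ℝ) - m < 1 := by
      by_contra! hneg
      nlinarith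
    have h6 : (0 : ℤ) < k - m := by exact_mod_cast h4
    have h7 : k - (m : ℤ) < 1 := by exact_mod_cast h5
    omega

theorem exists_isHeatSol_cellMap (i : ℕ) {f : P.Level i → ℝ} (hf : Continuous f) (α : P.Cell i) :
    ∃ V, IsHeatSol V ∧ ∀ t, 0 < t → ∀ θ ∈ Set.Icc 0 (P.L i),
      heatOp (P.levelMeasure i) (P.kernel i) t f (cellMap α θ) = V t θ := by
  obtain ⟨V, hV, h⟩ := exists_isHeatSol i hf α.2 (((α.1 : ℕ) * P.L i : ℝ) : Circ)
    fun s hs => coe_add_notMem_vertexSet i α.1 hs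
  exact ⟨V, hV, fun t ht θ hθ => by rw [cellMap_eq, h t ht θ hθ]⟩

theorem derivWithin_cellMap_zero {i : ℕ} {u : P.Level i → ℝ} (α : P.Cell i)
    (hu : PiecewiseDiff (P.vertexSet i) fun ζ => u (ofFiniteWord (ζ, α.2))) :
    derivWithin (fun θ => u (cellMap α θ)) (Set.Icc 0 (P.L i)) 0 =
      rightDeriv (fun ζ => u (ofFiniteWord (ζ, α.2))) (((α.1 : ℕ) * P.L i : ℝ) : Circ) := by
  have h := (hu.right (isolated_vertexSet i) (((α.1 : ℕ) * P.L i : ℝ) : Circ)).hasDerivWithinAt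
  have h' := (h.mono Set.Icc_subset_Ici_self).derivWithin
    (uniqueDiffOn_Icc (P.L_pos i) 0 ⟨le_rfl, (P.L_pos i).le⟩)
  rw [rightDeriv]
  simpa only [cellMap_eq] using h'

theorem derivWithin_cellMap_L {i : ℕ} {u : P.Level i → ℝ} (α : P.Cell i)
    (hu : PiecewiseDiff (P.vertexSet i) fun ζ => u (ofFiniteWord (ζ, α.2))) :
    derivWithin (fun θ => u (cellMap α θ)) (Set.Icc 0 (P.L i)) (P.L i) =
      leftDeriv (fun ζ => u (ofFiniteWord (ζ, α.2)))
        (((((α.1 : ℕ) + 1 : ℕ) : ℝ) * P.L i : ℝ) : Circ) := by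
  set η := (((((α.1 : ℕ) + 1 : ℕ) : ℝ) * P.L i : ℝ) : Circ) with hη
  have h : HasDerivWithinAt (fun s : ℝ => u (ofFiniteWord (η + (s : Circ), α.2)))
      (leftDeriv (fun ζ => u (ofFiniteWord (ζ, α.2))) η) (Set.Iic 0) (P.L i - P.L i) := by
    rw [sub_self]
    exact (hu.left (isolated_vertexSet i) η).hasDerivWithinAt
  have hs : HasDerivWithinAt (fun θ : ℝ => θ - P.L i) 1 (Set.Icc 0 (P.L i)) (P.L i) :=
    (hasDerivWithinAt_id _ _).sub_const _
  have h2 := (HasDerivWithinAt.comp (h := fun θ : ℝ => θ - P.L i) (P.L i) h hs fun θ hθ => by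
    simpa using hθ.2).derivWithin
    (uniqueDiffOn_Icc (P.L_pos i) (P.L i) ⟨(P.L_pos i).le, le_rfl⟩)
  rw [mul_one] at h2
  rw [← h2]
  congr 1
  funext θ
  simp only [Function.comp_apply, cellMap, hη, ← AddCircle.coe_add]
  congr 4
  push_cast
  ring

theorem coe_fin_add_one_mul_L (i : ℕ) (m : Fin (P.arcs i)) :
    ((((m + 1 : Fin (P.arcs i)) : ℕ) * P.L i : ℝ) : Circ) =
      (((((m : ℕ) + 1 : ℕ) : ℝ) * P.L i : ℝ) : Circ) := by
  have h1 : ((m + 1 : Fin (P.arcs i)) : ℕ) = ((m : ℕ) + 1) % P.arcs i := by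
    rw [Fin.val_add, Fin.val_one', Nat.add_mod_mod]
  have h2 : (((m : ℕ) + 1 : ℕ) : ℝ) = (((m : ℕ) + 1) % P.arcs i : ℕ) +
      (P.arcs i : ℝ) * (((m : ℕ) + 1) / P.arcs i : ℕ) := by
    exact_mod_cast (Nat.mod_add_div _ _).symm
  rw [h1, h2, show ((((m : ℕ) + 1) % P.arcs i : ℕ) + (P.arcs i : ℝ) *
    (((m : ℕ) + 1) / P.arcs i : ℕ)) * P.L i = (((m : ℕ) + 1) % P.arcs i : ℕ) * P.L i +
      (((m : ℕ) + 1) / P.arcs i) • (2 * Real.pi) by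
        rw [← P.arcs_mul_L i, nsmul_eq_mul]; ring,
    AddCircle.coe_add, AddCircle.coe_nsmul, AddCircle.coe_period, smul_zero, add_zero]

open Classical in
/-- Passing from the cells that start at a point to those that end there is the rotation
`m ↦ m + 1` of the arcs, so that the Kirchhoff condition becomes an identity over words. -/
theorem kirchhoff_heatOp (i : ℕ) {f : P.Level i → ℝ} (hf : Continuous f) {t : ℝ} (ht : 0 < t)
    (x : P.Level i) :
    (∑ α : P.Cell i, if cellMap α 0 = x then
      derivWithin (fun θ => heatOp (P.levelMeasure i) (P.kernel i) t f (cellMap α θ))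
        (Set.Icc 0 (P.L i)) 0 else 0) =
    ∑ α : P.Cell i, if cellMap α (P.L i) = x then
      derivWithin (fun θ => heatOp (P.levelMeasure i) (P.kernel i) t f (cellMap α θ))
        (Set.Icc 0 (P.L i)) (P.L i) else 0 := by
  obtain ⟨⟨η, w₀⟩, rfl⟩ := ofFiniteWord_surjective x
  have hd := piecewiseDiff_heatOp i hf ht
  have hiff : ∀ (ζ : Circ) (w : P.Word i), ofFiniteWord (ζ, w) = ofFiniteWord (η, w₀) ↔
      ζ = η ∧ ofFiniteWord (η, w) = ofFiniteWord (η, w₀) := by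
    intro ζ w
    constructor
    · intro h
      have h1 : ζ = η := (ofFiniteWord_eq_iff.1 h).1
      exact ⟨h1, h1 ▸ h⟩
    · rintro ⟨rfl, h⟩
      exact h
  have h0 : ∀ α : P.Cell i, cellMap α 0 = ofFiniteWord (η, w₀) ↔
      (((α.1 : ℕ) * P.L i : ℝ) : Circ) = η ∧
        ofFiniteWord (η, α.2) = ofFiniteWord (η, w₀) := fun α => by
    rw [← hiff, cellMap, add_zero]
  have hL : ∀ α : P.Cell i, cellMap α (P.L i) = ofFiniteWord (η, w₀) ↔
      (((((α.1 : ℕ) + 1 : ℕ) : ℝ) * P.L i : ℝ) : Circ) = η ∧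
        ofFiniteWord (η, α.2) = ofFiniteWord (η, w₀) := fun α => by
    rw [← hiff, cellMap, show ((α.1 : ℕ) : ℝ) * P.L i + P.L i =
      (((α.1 : ℕ) + 1 : ℕ) : ℝ) * P.L i by push_cast; ring]
  have key : ∀ (ζ : Circ) (D : P.Word i → Circ → ℝ),
      (∑ w, if ζ = η ∧ ofFiniteWord (η, w) = ofFiniteWord (η, w₀) then D w ζ else 0) =
      if ζ = η then ∑ w, if ofFiniteWord (η, w) = ofFiniteWord (η, w₀) then D w η else 0
        else 0 := by
    intro ζ D
    by_cases h : ζ = η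
    · subst h; simp
    · simp [h]
  simp only [derivWithin_cellMap_zero _ (hd _), derivWithin_cellMap_L _ (hd _), h0, hL]
  rw [Fintype.sum_prod_type, Fintype.sum_prod_type]
  simp only [key _ fun w ζ => rightDeriv (fun ζ => heatOp (P.levelMeasure i) (P.kernel i) t f
      (ofFiniteWord (ζ, w))) ζ, key _ fun w ζ => leftDeriv (fun ζ => heatOp (P.levelMeasure i)
      (P.kernel i) t f (ofFiniteWord (ζ, w))) ζ, sum_rightDeriv_eq_sum_leftDeriv i hf ht]
  rw [← Equiv.sum_comp (Equiv.addRight (1 : Fin (P.arcs i)))]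
  simp only [Equiv.coe_addRight, coe_fin_add_one_mul_L]

theorem solvesHeatEquation_heatOp (i : ℕ) {f : P.Level i → ℝ} (hf : Continuous f) :
    P.SolvesHeatEquation i fun t => heatOp (P.levelMeasure i) (P.kernel i) t f where
  continuousOn := continuousOn_heatOp_of_continuous (continuousOn_kernel i) hf
  smooth t ht α := by
    obtain ⟨V, hV, h⟩ := exists_isHeatSol_cellMap i hf α
    exact (hV.smooth t ht).contDiffOn.congr (h t ht)
  equation t ht α θ hθ := by
    obtain ⟨V, hV, h⟩ := exists_isHeatSol_cellMap i hf α
    have h2 := iteratedDerivWithin_congr (n := 2) (h t ht) hθ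
    have h3 := iteratedDerivWithin_eq_iteratedDeriv (uniqueDiffOn_Icc (P.L_pos i))
      (hV.smooth t ht).contDiffAt hθ
    have h4 : iteratedDeriv 2 (V t) θ = deriv (deriv (V t)) θ := by
      rw [iteratedDeriv_succ, iteratedDeriv_one]
    refine ((hV.equation t ht θ).congr_of_eventuallyEq ?_).congr_deriv ?_
    · filter_upwards [lt_mem_nhds ht] with s hs using h s hs θ hθ
    · exact (h2.trans (h3.trans h4)).symm
  kirchhoff t ht x := by
    convert kirchhoff_heatOp i hf ht x

/-! ### The Markov property on the levels -/

theorem heatOp_nonneg (i : ℕ) {f : P.Level i → ℝ} (hf : Continuous f) (h0 : ∀ x, 0 ≤ f x)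
    {t : ℝ} (ht : 0 < t) (x : P.Level i) :
    0 ≤ heatOp (P.levelMeasure i) (P.kernel i) t f x := by
  refine (solvesHeatEquation_heatOp i hf).nonneg (fun c hc => ?_) ht x
  filter_upwards [eventually_abs_heatOp_sub_le i hf hc] with s hs y
  linarith [(abs_le.1 (hs y)).1, h0 y]

theorem kernel_nonneg (i : ℕ) {t : ℝ} (ht : 0 < t) (x y : P.Level i) : 0 ≤ P.kernel i t x y :=
  nonneg_of_integral_mul_nonneg (μ := P.levelMeasure i)
    (continuous_kernel_section (continuousOn_kernel i) ht x)
    (fun _ hf h0 => heatOp_nonneg i hf h0 ht x) y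

/-- Solutions of the heat equation with the same initial values agree: both differences are
nonnegative. -/
theorem SolvesHeatEquation.eq {i : ℕ} {u v : ℝ → P.Level i → ℝ}
    (hu : P.SolvesHeatEquation i u) (hv : P.SolvesHeatEquation i v)
    (h0 : ∀ c, 0 < c → ∀ᶠ t in 𝓝[>] (0 : ℝ), ∀ x, |u t x - v t x| ≤ c) {t : ℝ} (ht : 0 < t)
    (x : P.Level i) : u t x = v t x := by
  have h1 := (hu.sub hv).nonneg (fun c hc => by
    filter_upwards [h0 c hc] with s hs y using (abs_le.1 (hs y)).1) ht x
  have h2 := (hv.sub hu).nonneg (fun c hc => by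
    filter_upwards [h0 c hc] with s hs y
    linarith [(abs_le.1 (hs y)).2]) ht x
  linarith

theorem heatOp_add (i : ℕ) {f : P.Level i → ℝ} (hf : Continuous f) {s t : ℝ} (hs : 0 < s)
    (ht : 0 < t) (x : P.Level i) : heatOp (P.levelMeasure i) (P.kernel i) (s + t) f x =
      heatOp (P.levelMeasure i) (P.kernel i) s
        (heatOp (P.levelMeasure i) (P.kernel i) t f) x := by
  have hg : Continuous (heatOp (P.levelMeasure i) (P.kernel i) t f) :=
    continuous_heatOp_of_continuous (continuousOn_kernel i) ht hf
  have hu := solvesHeatEquation_heatOp i hf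
  refine (hu.shift ht).eq (solvesHeatEquation_heatOp i hg) (fun c hc => ?_) hs x
  -- Joint continuity and compactness make the map `s ↦ u (s + t)` continuous in the uniform norm.
  have hunif : ∀ᶠ r in 𝓝[>] (0 : ℝ), ∀ y,
      |heatOp (P.levelMeasure i) (P.kernel i) (r + t) f y -
        heatOp (P.levelMeasure i) (P.kernel i) t f y| ≤ c / 2 := by
    have hc' : ContinuousOn (fun z : ℝ × P.Level i =>
        |heatOp (P.levelMeasure i) (P.kernel i) (z.1 + t) f z.2 -
          heatOp (P.levelMeasure i) (P.kernel i) t f z.2|) (Set.Ioi (-t) ×ˢ Set.univ) := by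
      refine ((hu.continuousOn.comp (f := fun z : ℝ × P.Level i => (z.1 + t, z.2))
        (Continuous.continuousOn (by fun_prop)) fun z hz => ⟨?_, trivial⟩).sub
        (hg.comp continuous_snd).continuousOn).abs
      have : -t < z.1 := hz.1
      show 0 < z.1 + t
      linarith
    have hev : ∀ y : P.Level i, ∀ᶠ z : ℝ × P.Level i in 𝓝 0 ×ˢ 𝓝 y,
        |heatOp (P.levelMeasure i) (P.kernel i) (z.1 + t) f z.2 -
          heatOp (P.levelMeasure i) (P.kernel i) t f z.2| < c / 2 := by
      intro y
      rw [← nhds_prod_eq]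
      have hat := hc'.continuousAt (x := ((0 : ℝ), y))
        (prod_mem_nhds (Ioi_mem_nhds (by linarith)) univ_mem)
      refine hat.eventually_lt continuousAt_const ?_
      simp [half_pos hc]
    have hall : ∀ᶠ r in 𝓝 (0 : ℝ), ∀ y ∈ (Set.univ : Set (P.Level i)),
        |heatOp (P.levelMeasure i) (P.kernel i) (r + t) f y -
          heatOp (P.levelMeasure i) (P.kernel i) t f y| < c / 2 :=
      isCompact_univ.eventually_forall_of_forall_eventually fun y _ => by
        rw [nhds_prod_eq]; exact hev y
    filter_upwards [hall.filter_mono nhdsWithin_le_nhds] with r hr y using (hr y trivial).le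
  filter_upwards [hunif, eventually_abs_heatOp_sub_le i hg (half_pos hc)] with r h1 h2 y
  have h3 := abs_le.1 (h1 y)
  have h4 := abs_le.1 (h2 y)
  rw [abs_le]
  constructor <;> linarith [h3.1, h3.2, h4.1, h4.2]

theorem isMarkovKernel_kernel (i : ℕ) : IsMarkovKernel (P.levelMeasure i) (P.kernel i) where
  continuousOn := continuousOn_kernel i
  symm t _ x y := kernel_symm i t x y
  nonneg t ht x y := kernel_nonneg i ht x y
  conservative t ht x := integral_kernel i ht x
  semigroup s t hs ht f hf x := heatOp_add i hf hs ht x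
  strongContinuity f hf := by
    rw [Metric.tendstoUniformly_iff]
    intro ε hε
    filter_upwards [eventually_abs_heatOp_sub_le i hf (half_pos hε)] with t h x
    rw [dist_comm, Real.dist_eq]
    exact (h x).trans_lt (half_lt_self hε)
  strongFeller t ht f hf := fun ⟨_, hC⟩ => continuous_heatOp (continuousOn_kernel i) ht hf hC

theorem isLevelHeatKernel_kernel (i : ℕ) : P.IsLevelHeatKernel i (P.kernel i) where
  markov := isMarkovKernel_kernel i
  heat _ hf := solvesHeatEquation_heatOp i hf

end Params
namespace Params

variable {P : Params}

/-! ### Uniform convergence of the kernels -/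

theorem abs_coupling_le {i : ℕ} (w v : P.Word (i + 1)) : |coupling w v| ≤ P.n (i + 1) := by
  have h2 : (2 : ℝ) ≤ P.n (i + 1) := by exact_mod_cast P.two_le_n (i + 1) (by omega)
  rw [coupling, abs_le]
  split_ifs <;> constructor <;> linarith

theorem abs_reflKernel_le (l : ℕ) {t₀ t : ℝ} (h₀ : 0 < t₀) (ht : t₀ ≤ t) (η ζ : Circ) :
    |P.reflKernel l t η ζ| ≤ P.J l * (2 / Real.pi *
      (Real.exp (-((P.J l : ℝ) ^ 2 * t₀)) / (1 - Real.exp (-t₀)))) := by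
  have hJ := P.J_pos' l
  have hJ1 : (1 : ℝ) ≤ P.J l := by exact_mod_cast P.J_pos l
  have hpi := Real.pi_pos
  have hle : t₀ ≤ (P.J l : ℝ) ^ 2 * t₀ :=
    le_mul_of_one_le_left h₀.le (one_le_pow₀ hJ1)
  have hle' : (P.J l : ℝ) ^ 2 * t₀ ≤ (P.J l : ℝ) ^ 2 * t :=
    mul_le_mul_of_nonneg_left ht (by positivity)
  have hd : 0 < 1 - Real.exp (-t₀) := by simpa using h₀
  rw [← coe_carg η, ← coe_carg ζ, reflKernel_coe, abs_mul, abs_of_pos hJ]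
  refine mul_le_mul_of_nonneg_left ?_ hJ.le
  have h1 := abs_theta_sub_le h₀ (hle.trans hle') (P.J l * (carg ζ - carg η))
  have h2 := abs_theta_sub_le h₀ (hle.trans hle') (P.J l * (carg ζ + carg η))
  have h3 : 1 / Real.pi * (Real.exp (-((P.J l : ℝ) ^ 2 * t)) / (1 - Real.exp (-t₀))) ≤
      1 / Real.pi * (Real.exp (-((P.J l : ℝ) ^ 2 * t₀)) / (1 - Real.exp (-t₀))) := by
    gcongr
  have h4 : 2 / Real.pi * (Real.exp (-((P.J l : ℝ) ^ 2 * t₀)) / (1 - Real.exp (-t₀))) =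
      2 * (1 / Real.pi * (Real.exp (-((P.J l : ℝ) ^ 2 * t₀)) / (1 - Real.exp (-t₀)))) := by ring
  rw [h4, abs_le]
  have h5 := abs_le.1 h1
  have h6 := abs_le.1 h2
  constructor <;> linarith [h5.1, h5.2, h6.1, h6.2]

variable (P) in
/-- A bound for the difference of the kernels of the levels `i` and `i + 1` at times `≥ t₀`. -/
def incrementBound (t₀ : ℝ) (i : ℕ) : ℝ :=
  P.N (i + 1) * (P.J (i + 1) * (2 / Real.pi *
    (Real.exp (-((P.J (i + 1) : ℝ) ^ 2 * t₀)) / (1 - Real.exp (-t₀)))))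

/-- The two levels differ by a multiple of the Dirichlet kernel of the arcs, which is of the order of
its first exponential term. -/
theorem abs_kernel_succ_sub_le (i : ℕ) {t₀ t : ℝ} (h₀ : 0 < t₀) (ht : t₀ ≤ t)
    (x y : P.Level (i + 1)) : |P.kernel (i + 1) t x y -
      P.kernel i t (proj (Nat.le_succ i) x) (proj (Nat.le_succ i) y)| ≤
        P.incrementBound t₀ i := by
  obtain ⟨p, rfl⟩ := ofFiniteWord_surjective x
  obtain ⟨q, rfl⟩ := ofFiniteWord_surjective y
  rw [kernel_succ, add_sub_cancel_left, abs_mul, abs_mul, abs_of_pos (P.N_pos' i),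
    incrementBound, N_succ]
  push_cast
  gcongr
  · exact abs_coupling_le _ _
  · exact (P.abs_arcKernel_le_abs_reflKernel _ _ _ _).trans (abs_reflKernel_le _ h₀ ht _ _)

/-- Half of the exponential factor keeps `N_i` bounded, the other half yields geometric decay. -/
theorem summable_incrementBound (hP : ∃ ε : ℝ, 0 < ε ∧ ∀ t ∈ Set.Ioo (0 : ℝ) ε, ∃ c : ℝ,
      Tendsto (fun i : ℕ => (P.N i : ℝ) * Real.exp (-(P.J i : ℝ) ^ 2 * t)) atTop (𝓝 c))
    {t₀ : ℝ} (h₀ : 0 < t₀) : Summable (P.incrementBound t₀) := by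
  obtain ⟨ε, hε, h⟩ := hP
  set δ := min (t₀ / 2) (ε / 2) with hδ
  have hδ0 : 0 < δ := lt_min (half_pos h₀) (half_pos hε)
  have hδt : δ ≤ t₀ / 2 := min_le_left _ _
  obtain ⟨c, hc⟩ := h δ ⟨hδ0, (min_le_right _ _).trans_lt (half_lt_self hε)⟩
  obtain ⟨B, hB⟩ := hc.bddAbove_range
  have hd : 0 < 1 - Real.exp (-t₀) := by simpa using h₀
  have hpi := Real.pi_pos
  have hB0 : 0 ≤ B := le_trans (by positivity) (hB ⟨0, rfl⟩)
  refine Summable.of_nonneg_of_le (fun i => by rw [incrementBound]; positivity) (fun i => ?_)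
    ((summable_geometric_two).mul_left (B * (2 / t₀) * (2 / Real.pi) / (1 - Real.exp (-t₀))))
  have hJ := P.J_pos' (i + 1)
  set J : ℝ := (P.J (i + 1) : ℝ) with hJdef
  have h1 : (P.N (i + 1) : ℝ) * Real.exp (-J ^ 2 * δ) ≤ B := hB ⟨i + 1, rfl⟩
  have h2 : J * Real.exp (-(J ^ 2 * (t₀ / 2))) ≤ 2 / t₀ * (1 / 2) ^ i := by
    have h3 : J ^ 2 * (t₀ / 2) ≤ Real.exp (J ^ 2 * (t₀ / 2)) := by
      linarith [Real.add_one_le_exp (J ^ 2 * (t₀ / 2))]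
    have h4 : (2 : ℝ) ^ i ≤ J := by
      have : (2 : ℝ) ^ (i + 1) ≤ J := by
        rw [hJdef]
        exact_mod_cast P.two_pow_le_J (i + 1)
      refine le_trans ?_ this
      exact pow_le_pow_right₀ one_le_two (Nat.le_succ i)
    rw [Real.exp_neg, ← div_eq_mul_inv, div_le_iff₀ (Real.exp_pos _), one_div_pow]
    calc J = 2 / t₀ * (1 / J) * (J ^ 2 * (t₀ / 2)) := by field_simp
      _ ≤ 2 / t₀ * (1 / 2 ^ i) * Real.exp (J ^ 2 * (t₀ / 2)) := by gcongr
  have h5 : Real.exp (-(J ^ 2 * t₀)) ≤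
      Real.exp (-J ^ 2 * δ) * Real.exp (-(J ^ 2 * (t₀ / 2))) := by
    rw [← Real.exp_add]
    refine Real.exp_le_exp.2 ?_
    nlinarith [sq_nonneg J]
  calc P.incrementBound t₀ i
      ≤ P.N (i + 1) * (J * (2 / Real.pi * ((Real.exp (-J ^ 2 * δ) *
          Real.exp (-(J ^ 2 * (t₀ / 2)))) / (1 - Real.exp (-t₀))))) := by
        rw [incrementBound]; gcongr
    _ = (P.N (i + 1) * Real.exp (-J ^ 2 * δ)) * (J * Real.exp (-(J ^ 2 * (t₀ / 2)))) *
          (2 / Real.pi) / (1 - Real.exp (-t₀)) := by ring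
    _ ≤ B * (2 / t₀ * (1 / 2) ^ i) * (2 / Real.pi) / (1 - Real.exp (-t₀)) := by gcongr
    _ = _ := by ring

theorem tendsto_kernel (hs : ∀ t₀, 0 < t₀ → Summable (P.incrementBound t₀))
    {t : ℝ} (ht : 0 < t) (x y : P.Limit) :
    Tendsto (fun i => P.kernel i t (toLevel i x) (toLevel i y)) atTop
      (𝓝 (P.limitKernel t x y)) := by
  refine tendsto_nhds_limUnder (cauchySeq_tendsto_of_complete ?_)
  refine cauchySeq_of_dist_le_of_summable _ (fun i => ?_) (hs t ht)
  rw [dist_comm, Real.dist_eq, ← proj_toLevel (Nat.le_succ i) x, ← proj_toLevel (Nat.le_succ i) y]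
  exact abs_kernel_succ_sub_le i ht le_rfl _ _

theorem tendstoUniformlyOn_kernel
    (hs : ∀ t₀, 0 < t₀ → Summable (P.incrementBound t₀)) {t₀ : ℝ} (h₀ : 0 < t₀) :
    TendstoUniformlyOn (fun (i : ℕ) (z : ℝ × P.Limit × P.Limit) =>
      P.kernel i z.1 (toLevel i z.2.1) (toLevel i z.2.2))
      (fun z => P.limitKernel z.1 z.2.1 z.2.2) atTop (Set.Ici t₀ ×ˢ Set.univ) := by
  rw [Metric.tendstoUniformlyOn_iff]
  intro ε hε
  filter_upwards [(tendsto_sum_nat_add (P.incrementBound t₀)).eventually_lt_const hε]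
    with i hi z hz
  have hz1 : t₀ ≤ z.1 := hz.1
  have := dist_le_tsum_of_dist_le_of_tendsto (P.incrementBound t₀) (fun k => by
    rw [dist_comm, Real.dist_eq, ← proj_toLevel (Nat.le_succ k) z.2.1,
      ← proj_toLevel (Nat.le_succ k) z.2.2]
    exact abs_kernel_succ_sub_le k h₀ hz1 _ _) (hs t₀ h₀)
    (tendsto_kernel hs (h₀.trans_le hz1) z.2.1 z.2.2) i
  rw [dist_comm]
  refine this.trans_lt ?_
  simpa only [add_comm] using hi

theorem tendstoUniformly_kernel
    (hs : ∀ t₀, 0 < t₀ → Summable (P.incrementBound t₀)) {t : ℝ} (ht : 0 < t) :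
    TendstoUniformly (fun (i : ℕ) (z : P.Limit × P.Limit) =>
      P.kernel i t (toLevel i z.1) (toLevel i z.2))
      (fun z => P.limitKernel t z.1 z.2) atTop := by
  have h := tendstoUniformlyOn_kernel hs ht
  rw [Metric.tendstoUniformlyOn_iff] at h
  rw [Metric.tendstoUniformly_iff]
  intro ε hε
  filter_upwards [h ε hε] with i hi z
  exact hi (t, z) ⟨Set.self_mem_Ici, trivial⟩

theorem continuousOn_limitKernel
    (hs : ∀ t₀, 0 < t₀ → Summable (P.incrementBound t₀)) :
    ContinuousOn (fun z : ℝ × P.Limit × P.Limit => P.limitKernel z.1 z.2.1 z.2.2)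
      (Set.Ioi 0 ×ˢ Set.univ) := by
  rintro ⟨t, x, y⟩ ⟨ht, -⟩
  have ht : 0 < t := ht
  have h : ContinuousOn (fun z : ℝ × P.Limit × P.Limit => P.limitKernel z.1 z.2.1 z.2.2)
      (Set.Ici (t / 2) ×ˢ Set.univ) := by
    refine (tendstoUniformlyOn_kernel hs (half_pos ht)).continuousOn
      (Frequently.of_forall fun i => ?_)
    refine (continuousOn_kernel (P := P) i).comp
      (f := fun z : ℝ × P.Limit × P.Limit => (z.1, toLevel i z.2.1, toLevel i z.2.2)) ?_ ?_
    · have := continuous_toLevel (P := P) i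
      exact Continuous.continuousOn (by fun_prop)
    · rintro z ⟨hz, -⟩
      exact ⟨(half_pos ht).trans_le hz, trivial⟩
  exact (h.continuousAt (prod_mem_nhds (Ici_mem_nhds (half_lt_self ht))
    univ_mem)).continuousWithinAt

/-! ### Stabilization of the kernels off the diagonal -/

theorem SameCell.sameBundle {i : ℕ} {x y : P.Level i} (h : SameCell x y) : SameBundle x y := by
  obtain ⟨α, hx, hy⟩ := h
  exact ⟨α, α, ⟨rfl, fun _ _ => rfl⟩, hx, hy⟩

theorem kernel_succ_of_not_sameBundle {i : ℕ} (t : ℝ) {x y : P.Level (i + 1)}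
    (h : ¬SameBundle x y) : P.kernel (i + 1) t x y =
      P.kernel i t (proj (Nat.le_succ i) x) (proj (Nat.le_succ i) y) := by
  rw [kernel, if_neg fun hc => h hc.sameBundle, if_neg h, add_zero]

theorem sameBundle_zero (x y : P.Level 0) : SameBundle x y := by
  have h : ∀ z : P.Level 0, ∀ α : P.Cell 0, z ∈ cellSet α := by
    intro z α
    obtain ⟨⟨η, w⟩, rfl⟩ := ofFiniteWord_surjective z
    obtain ⟨a, ha, rfl⟩ := AddCircle.eq_coe_Ico η
    refine ⟨a, ⟨ha.1, ha.2.le⟩, ?_⟩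
    have h0 : ((α.1 : ℕ) : ℝ) = 0 := by
      have := α.1.2
      simp only [arcs] at this
      exact_mod_cast (by omega : (α.1 : ℕ) = 0)
    rw [cellMap, h0, zero_mul, zero_add, Subsingleton.elim α.2 w]
  exact ⟨(0, fun l => l.elim0), (0, fun l => l.elim0), ⟨rfl, fun _ _ => rfl⟩, h _ _, h _ _⟩

theorem letter_eq_of_mem_cellSet {i : ℕ} {p : Circ × P.Word i} {α : P.Cell i}
    (h : ofFiniteWord p ∈ cellSet α) {l : Fin i} (hl : p.1 ∉ P.grid ((l : ℕ) + 1)) :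
    α.2 l = p.2 l := by
  obtain ⟨θ, -, hθ⟩ := h
  exact ((ofFiniteWord_eq_iff.1 hθ.symm).2 l hl).symm

theorem SameBundle.norm_angle_sub_le {i : ℕ} {x y : P.Level i} (h : SameBundle x y) :
    ‖angle x - angle y‖ ≤ P.L i := by
  obtain ⟨α, β, ⟨hm, -⟩, ⟨θ, hθ, rfl⟩, ⟨θ', hθ', rfl⟩⟩ := h
  have e : angle (cellMap α θ) - angle (cellMap β θ') = ((θ - θ' : ℝ) : Circ) := by
    rw [cellMap, cellMap, angle_ofFiniteWord, angle_ofFiniteWord, hm, ← AddCircle.coe_sub]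
    congr 1
    ring
  rw [e]
  refine QuotientAddGroup.norm_mk_le_norm.trans ?_
  rw [Real.norm_eq_abs, abs_le]
  constructor <;> linarith [hθ.1, hθ.2, hθ'.1, hθ'.2]

theorem tendsto_L : Tendsto P.L atTop (𝓝 0) := by
  rw [← tendsto_add_atTop_iff_nat 1]
  refine squeeze_zero (fun i => (P.L_pos _).le) (fun i => ?_)
    (g := fun i => Real.pi * (1 / 2) ^ i) ?_
  · have h : (2 : ℝ) ^ i ≤ P.J (i + 1) := by
      have : (2 : ℝ) ^ (i + 1) ≤ P.J (i + 1) := by exact_mod_cast P.two_pow_le_J (i + 1)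
      exact le_trans (pow_le_pow_right₀ one_le_two (Nat.le_succ i)) this
    simp only [L]
    rw [one_div_pow, mul_one_div]
    have := Real.pi_pos
    gcongr
  · simpa using (tendsto_pow_atTop_nhds_zero_of_lt_one (r := (1 / 2 : ℝ)) (by norm_num)
      (by norm_num)).const_mul Real.pi

/-- Different points of the limit are in a common bundle on finitely many levels only: either their
angles differ, and the lengths of the cells tend to zero, or a relevant letter differs. -/
theorem bddAbove_sameBundle {x y : P.Limit} (h : x ≠ y) :
    BddAbove {i : ℕ | SameBundle (toLevel i x) (toLevel i y)} := by
  obtain ⟨⟨η, w⟩, rfl⟩ := ofWord_surjective x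
  obtain ⟨⟨ζ, v⟩, rfl⟩ := ofWord_surjective y
  by_cases hη : η = ζ
  · subst hη
    obtain ⟨l, hl, hlw⟩ : ∃ l, η ∉ P.grid (l + 1) ∧ w l ≠ v l := by
      by_contra! hcon
      exact h (Subtype.ext (funext fun i => ofFiniteWord_eq_iff.2 ⟨rfl, fun l hl => hcon l hl⟩))
    refine ⟨l + 1, fun i hi => ?_⟩
    by_contra! hlt
    obtain ⟨α, β, ⟨-, hb⟩, hα, hβ⟩ := hi
    have h1 := letter_eq_of_mem_cellSet (l := ⟨l, by omega⟩) hα hl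
    have h2 := letter_eq_of_mem_cellSet (l := ⟨l, by omega⟩) hβ hl
    exact hlw (h1.symm.trans ((hb ⟨l, by omega⟩ hlt).trans h2))
  · have hpos : 0 < ‖η - ζ‖ := norm_pos_iff.2 (sub_ne_zero.2 hη)
    obtain ⟨k, hk⟩ := eventually_atTop.1 ((tendsto_L (P := P)).eventually_lt_const hpos)
    refine ⟨k, fun i hi => ?_⟩
    by_contra! hlt
    have h1 := SameBundle.norm_angle_sub_le hi
    exact absurd (hk i hlt.le) (not_lt.2 h1)

theorem kernel_eq_of_isGreatest {x y : P.Limit} {m : ℕ}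
    (hm : IsGreatest {i : ℕ | SameBundle (toLevel i x) (toLevel i y)} m) (t : ℝ) {i : ℕ}
    (hi : m ≤ i) : P.kernel i t (toLevel i x) (toLevel i y) =
      P.kernel m t (toLevel m x) (toLevel m y) := by
  induction i, hi using Nat.le_induction with
  | base => rfl
  | succ i hi ih =>
    have hn : ¬SameBundle (toLevel (i + 1) x) (toLevel (i + 1) y) := fun hs => by
      have := hm.2 hs
      omega
    rw [kernel_succ_of_not_sameBundle t hn, proj_toLevel, proj_toLevel, ih]

theorem exists_isGreatest_sameBundle {x y : P.Limit} (h : x ≠ y) :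
    ∃ m, IsGreatest {i : ℕ | SameBundle (toLevel i x) (toLevel i y)} m ∧
      ∀ t, 0 < t → P.limitKernel t x y = P.kernel m t (toLevel m x) (toLevel m y) := by
  obtain ⟨m, hm⟩ := (bddAbove_sameBundle h).exists_isGreatest_of_nonempty
    ⟨0, sameBundle_zero _ _⟩
  refine ⟨m, hm, fun t _ => Tendsto.limUnder_eq (tendsto_const_nhds.congr' ?_)⟩
  filter_upwards [eventually_ge_atTop m] with i hi
  exact (kernel_eq_of_isGreatest hm t hi).symm

end Params
namespace Params

variable {P : Params}

/-! ### Density of the functions that depend on finitely many letters -/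

variable (P) in
/-- The continuous functions on `F_∞` that factor through some `F_i`. -/
def cylinderAlgebra : Subalgebra ℝ C(P.Limit, ℝ) where
  carrier := {g | ∃ (i : ℕ) (h : P.Level i → ℝ), Continuous h ∧ ∀ x, g x = h (toLevel i x)}
  mul_mem' := by
    rintro f g ⟨i, h, hh, hf⟩ ⟨k, h', hh', hg⟩
    refine ⟨max i k, fun y => h (proj (le_max_left i k) y) * h' (proj (le_max_right i k) y),
      (hh.comp (continuous_proj _)).mul (hh'.comp (continuous_proj _)), fun x => ?_⟩
    simp only [ContinuousMap.mul_apply, hf, hg, proj_toLevel]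
  add_mem' := by
    rintro f g ⟨i, h, hh, hf⟩ ⟨k, h', hh', hg⟩
    refine ⟨max i k, fun y => h (proj (le_max_left i k) y) + h' (proj (le_max_right i k) y),
      (hh.comp (continuous_proj _)).add (hh'.comp (continuous_proj _)), fun x => ?_⟩
    simp only [ContinuousMap.add_apply, hf, hg, proj_toLevel]
  algebraMap_mem' c := ⟨0, fun _ => c, continuous_const, fun _ => rfl⟩

theorem separatesPoints_cylinderAlgebra : (cylinderAlgebra P).SeparatesPoints := by
  intro x y hxy
  obtain ⟨i, hi⟩ : ∃ i, toLevel i x ≠ toLevel i y := by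
    by_contra! h
    exact hxy (Subtype.ext (funext h))
  obtain ⟨h, h0, h1, -⟩ := exists_continuous_zero_one_of_isClosed
    (isClosed_singleton (x := toLevel i x)) (isClosed_singleton (x := toLevel i y))
    (Set.disjoint_singleton.2 hi)
  refine ⟨_, ⟨⟨fun z => h (toLevel i z), h.continuous.comp (continuous_toLevel i)⟩,
    ⟨i, h, h.continuous, fun _ => rfl⟩, rfl⟩, ?_⟩
  have e0 : h (toLevel i x) = 0 := h0 rfl
  have e1 : h (toLevel i y) = 1 := h1 rfl
  simp [e0, e1]

theorem exists_abs_sub_comp_toLevel_le {f : P.Limit → ℝ} (hf : Continuous f) {ε : ℝ}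
    (hε : 0 < ε) : ∃ (i : ℕ) (h : P.Level i → ℝ), Continuous h ∧
      ∀ x, |f x - h (toLevel i x)| ≤ ε := by
  obtain ⟨⟨g, i, h, hh, hg⟩, hgf⟩ :=
    ContinuousMap.exists_mem_subalgebra_near_continuous_of_separatesPoints (cylinderAlgebra P)
      separatesPoints_cylinderAlgebra f hf ε hε
  refine ⟨i, h, hh, fun x => ?_⟩
  rw [← hg, abs_sub_comm, ← Real.norm_eq_abs]
  exact (hgf x).le

/-! ### The heat kernel of the limit -/

section

variable {p : ℝ → P.Limit → P.Limit → ℝ}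

/-- The semigroup property and strong continuity are inherited from the levels, by density and
contractivity. -/
theorem isLimitHeatKernel_of_compatible
    (hc : ContinuousOn (fun z : ℝ × P.Limit × P.Limit => p z.1 z.2.1 z.2.2)
      (Set.Ioi 0 ×ˢ Set.univ))
    (hsymm : ∀ t, 0 < t → ∀ x y, p t x y = p t y x)
    (h0 : ∀ t, 0 < t → ∀ x y, 0 ≤ p t x y)
    (hcomp : ∀ (i : ℕ) (t : ℝ), 0 < t → ∀ h : P.Level i → ℝ, Continuous h → ∀ x : P.Limit,
      heatOp P.limitMeasure p t (fun y => h (toLevel i y)) x =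
        heatOp (P.levelMeasure i) (P.kernel i) t h (toLevel i x)) :
    P.IsLimitHeatKernel p := by
  have h1 : ∀ t, 0 < t → ∀ x, ∫ y, p t x y ∂P.limitMeasure = 1 := by
    intro t ht x
    have h := hcomp 0 t ht (fun _ => 1) continuous_const x
    simpa [heatOp, integral_kernel 0 ht] using h
  have hcontr : ∀ t, 0 < t → ∀ x, ∀ f g : P.Limit → ℝ, Continuous f → Continuous g → ∀ ε,
      (∀ y, |f y - g y| ≤ ε) →
      |heatOp P.limitMeasure p t f x - heatOp P.limitMeasure p t g x| ≤ ε :=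
    fun t ht x f g hf hg ε h => abs_heatOp_sub_le hc ht (h0 t ht x) (h1 t ht x) hf hg h
  refine ⟨⟨hc, hsymm, h0, h1, fun s t hs ht f hf x => ?_, fun f hf => ?_,
    fun t ht f hf ⟨C, hC⟩ => continuous_heatOp hc ht hf hC⟩, hcomp⟩
  · refine eq_of_forall_dist_le fun ε hε => ?_
    obtain ⟨i, h, hh, hfh⟩ := exists_abs_sub_comp_toLevel_le hf (half_pos hε)
    have hg : Continuous fun y => h (toLevel i y) := hh.comp (continuous_toLevel i)
    have hT : Continuous (heatOp (P.levelMeasure i) (P.kernel i) t h) :=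
      continuous_heatOp_of_continuous (continuousOn_kernel i) ht hh
    have e : heatOp P.limitMeasure p (s + t) (fun y => h (toLevel i y)) x =
        heatOp P.limitMeasure p s
          (heatOp P.limitMeasure p t fun y => h (toLevel i y)) x := by
      rw [hcomp i _ (add_pos hs ht) h hh, heatOp_add i hh hs ht, ← hcomp i s hs _ hT]
      congr 1
      exact funext fun y => (hcomp i t ht h hh y).symm
    have h2 := abs_le.1 (hcontr (s + t) (add_pos hs ht) x f _ hf hg _ hfh)
    have h3 := abs_le.1 (hcontr s hs x (heatOp P.limitMeasure p t f) _
      (continuous_heatOp_of_continuous hc ht hf) (continuous_heatOp_of_continuous hc ht hg) _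
      fun y => hcontr t ht y f _ hf hg _ hfh)
    rw [Real.dist_eq, abs_le]
    constructor <;> linarith [h2.1, h2.2, h3.1, h3.2]
  · rw [Metric.tendstoUniformly_iff]
    intro ε hε
    obtain ⟨i, h, hh, hfh⟩ := exists_abs_sub_comp_toLevel_le hf (by positivity : 0 < ε / 4)
    have hg : Continuous fun y => h (toLevel i y) := hh.comp (continuous_toLevel i)
    filter_upwards [eventually_abs_heatOp_sub_le i hh (by positivity : 0 < ε / 4),
      self_mem_nhdsWithin] with t h2 ht x
    have h3 := abs_le.1 (hcontr t ht x f _ hf hg _ hfh)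
    have h4 := abs_le.1 (hfh x)
    have h5 := abs_le.1 (h2 (toLevel i x))
    rw [hcomp i t ht h hh] at h3
    rw [Real.dist_eq, abs_lt]
    constructor <;> linarith [h3.1, h3.2, h4.1, h4.2, h5.1, h5.2]

/-- The operators of a heat kernel are determined on the dense set of functions that factor through
some level. -/
theorem IsLimitHeatKernel.unique {q : ℝ → P.Limit → P.Limit → ℝ} (hp : P.IsLimitHeatKernel p)
    (hq : P.IsLimitHeatKernel q) {t : ℝ} (ht : 0 < t) (x y : P.Limit) : p t x y = q t x y := by
  refine eq_of_integral_mul_eq (μ := P.limitMeasure)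
    (continuous_kernel_section hp.markov.continuousOn ht x)
    (continuous_kernel_section hq.markov.continuousOn ht x) (fun f hf => ?_) y
  refine eq_of_forall_dist_le fun ε hε => ?_
  obtain ⟨i, h, hh, hfh⟩ := exists_abs_sub_comp_toLevel_le hf (half_pos hε)
  have hg : Continuous fun y => h (toLevel i y) := hh.comp (continuous_toLevel i)
  have h1 := abs_le.1 (abs_heatOp_sub_le hp.markov.continuousOn ht (hp.markov.nonneg t ht x)
    (hp.markov.conservative t ht x) hf hg hfh)
  have h2 := abs_le.1 (abs_heatOp_sub_le hq.markov.continuousOn ht (hq.markov.nonneg t ht x)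
    (hq.markov.conservative t ht x) hf hg hfh)
  rw [hp.compatible i t ht h hh] at h1
  rw [hq.compatible i t ht h hh] at h2
  simp only [heatOp] at h1 h2
  rw [Real.dist_eq, abs_le]
  constructor <;> linarith [h1.1, h1.2, h2.1, h2.2]

end

theorem heatOp_limitKernel_comp_toLevel (hs : ∀ t₀, 0 < t₀ → Summable (P.incrementBound t₀))
    (i : ℕ) {t : ℝ} (ht : 0 < t) {h : P.Level i → ℝ} (hh : Continuous h) (x : P.Limit) :
    heatOp P.limitMeasure P.limitKernel t (fun y => h (toLevel i y)) x =
      heatOp (P.levelMeasure i) (P.kernel i) t h (toLevel i x) := by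
  have hg : Continuous fun y : P.Limit => h (toLevel i y) := hh.comp (continuous_toLevel i)
  have hcp := continuous_kernel_section (continuousOn_limitKernel hs) ht x
  have hck : ∀ k, Continuous fun y => P.kernel k t (toLevel k x) (toLevel k y) := fun k =>
    (continuous_kernel_section (continuousOn_kernel (P := P) k) ht _).comp (continuous_toLevel k)
  have hlim : Tendsto (fun k => ∫ y, P.kernel k t (toLevel k x) (toLevel k y) * h (toLevel i y)
      ∂P.limitMeasure) atTop
      (𝓝 (heatOp P.limitMeasure P.limitKernel t (fun y => h (toLevel i y)) x)) := by
    refine tendsto_integral_filter_of_dominated_convergence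
      (fun y => (|P.limitKernel t x y| + 1) * |h (toLevel i y)|)
      (Eventually.of_forall fun k => ((hck k).mul hg).aestronglyMeasurable) ?_
      (integrable_of_continuous ((hcp.abs.add continuous_const).mul hg.abs))
      (Eventually.of_forall fun y => (tendsto_kernel hs ht x y).mul_const _)
    have hu := tendstoUniformly_kernel hs ht
    rw [Metric.tendstoUniformly_iff] at hu
    filter_upwards [hu 1 one_pos] with k hk
    refine Eventually.of_forall fun y => ?_
    rw [Real.norm_eq_abs, abs_mul]
    refine mul_le_mul_of_nonneg_right ?_ (abs_nonneg _)
    have h1 := hk (x, y)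
    rw [Real.dist_eq, abs_sub_comm] at h1
    linarith [abs_sub_abs_le_abs_sub (P.kernel k t (toLevel k x) (toLevel k y))
      (P.limitKernel t x y)]
  refine tendsto_nhds_unique hlim (tendsto_const_nhds.congr' ?_)
  filter_upwards [eventually_ge_atTop i] with k hk
  have hc : Continuous fun y => P.kernel k t (toLevel k x) y * h (proj hk y) :=
    (continuous_kernel_section (continuousOn_kernel (P := P) k) ht _).mul
      (hh.comp (continuous_proj hk))
  rw [← proj_toLevel hk x, ← heatOp_comp_proj hk ht hh, heatOp,
    ← integral_limitMeasure_comp P k hc]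
  simp only [proj_toLevel]

theorem isLimitHeatKernel_limitKernel (hs : ∀ t₀, 0 < t₀ → Summable (P.incrementBound t₀)) :
    P.IsLimitHeatKernel P.limitKernel := by
  refine isLimitHeatKernel_of_compatible (continuousOn_limitKernel hs) (fun t _ x y => ?_)
    (fun t ht x y => ?_) fun i t ht h hh x => heatOp_limitKernel_comp_toLevel hs i ht hh x
  · simp only [limitKernel, kernel_symm _ t (toLevel _ x)]
  · exact ge_of_tendsto' (tendsto_kernel hs ht x y) fun i => kernel_nonneg i ht _ _

end Params
end Diamond

end

theorem theorem3 (P : Diamond.Params)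
    (hP : ∃ ε : ℝ, 0 < ε ∧ ∀ t ∈ Set.Ioo (0 : ℝ) ε, ∃ c : ℝ,
      Filter.Tendsto (fun i : ℕ => (P.N i : ℝ) * Real.exp (-(P.J i : ℝ) ^ 2 * t))
        Filter.atTop (nhds c)) :
    (∀ i : ℕ, P.limitMeasure.map (Diamond.Params.toLevel i) = P.levelMeasure i) ∧
    (∀ i : ℕ, P.IsLevelHeatKernel i (P.kernel i)) ∧
    (∀ t : ℝ, 0 < t → TendstoUniformly
      (fun (i : ℕ) (z : P.Limit × P.Limit) =>
        P.kernel i t (Diamond.Params.toLevel i z.1) (Diamond.Params.toLevel i z.2))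
      (fun z : P.Limit × P.Limit => P.limitKernel t z.1 z.2) Filter.atTop) ∧
    (∀ x y : P.Limit, x ≠ y → ∃ m : ℕ,
      IsGreatest {i : ℕ | Diamond.Params.SameBundle (Diamond.Params.toLevel i x)
        (Diamond.Params.toLevel i y)} m ∧
      ∀ t : ℝ, 0 < t → P.limitKernel t x y =
        P.kernel m t (Diamond.Params.toLevel m x) (Diamond.Params.toLevel m y)) ∧
    P.IsLimitHeatKernel P.limitKernel ∧
    (∀ q : ℝ → P.Limit → P.Limit → ℝ, P.IsLimitHeatKernel q →
      ∀ t : ℝ, 0 < t → ∀ x y : P.Limit, q t x y = P.limitKernel t x y) := by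
  have hs : ∀ t₀, 0 < t₀ → Summable (P.incrementBound t₀) := fun t₀ h₀ =>
    Diamond.Params.summable_incrementBound hP h₀
  have hker := Diamond.Params.isLimitHeatKernel_limitKernel hs
  exact ⟨P.map_toLevel_limitMeasure, Diamond.Params.isLevelHeatKernel_kernel,
    fun t ht => Diamond.Params.tendstoUniformly_kernel hs ht,
    fun x y hxy => Diamond.Params.exists_isGreatest_sameBundle hxy, hker,
    fun q hq t ht x y => hq.unique hker ht x y⟩
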